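/- **Model.** Two insurance companies have free surpluses $X_t=x+p_1t-\sum_{i\le N^1_t}U^{(1)}_i$ and $Y_t=y+p_2t-\sum_{i\le N^2_t}U^{(2)}_i$, where $N^1,N^2$ are Poisson processes with intensities $\lambda_1,\lambda_2>0$, the claim sizes $U^{(k)}_i\ge 0$ are i.i.d. with continuous distribution function $F^k$ and finite mean, $p_k>\lambda_kE(U^{(k)}_1)$, and all claim arrivals and claim sizes are independent. Let $\lambda=\lambda_1+\lambda_2$, let $\delta>0$ be the discount rate, $a_1\in[0,1]$, $a_2=1-a_1$, $p=a_1p_1+a_2p_2$. If a claim makes the surplus of one company negative, the other one covers the deficit whenever the sum of the two surpluses is nonnegative; otherwise the collaboration ends (ruin). Let $V^0_k$ be the optimal value function of Company $k$ alone, i.e. the supremum over admissible dividend strategies of the expected discounted dividends until its ruin ($V_k^0=0$ on $(-\infty,0)$). Let $\mathbf R_+^2=[0,\infty)^2$. **Curve strategy.** Let $(\bar x,\bar y)\in\mathbf R_+^2$, $\bar u=\bar x-\frac{p_1}{p_2}\bar y$, $\bar v=\bar y-\frac{p_2}{p_1}\bar x$, and let $\xi_1:[\bar u,M_1]\to\mathbf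 R$, $\xi_2:[\bar v,M_2]\to\mathbf R$ (with $\bar u\le M_1$, $\bar v\le M_2$, $M_1,M_2\ge0$) be $C^1$ with negative derivative (no condition on the derivative if the interval is one point), $\xi_1(\bar u)=\bar y$, $\xi_1(M_1)=0$, $\xi_2(\bar v)=\bar x$, $\xi_2(M_2)=0$, and such that the curves $u\mapsto(u+\frac{p_1}{p_2}\xi_1(u),\xi_1(u))$ and $v\mapsto(\xi_2(v),v+\frac{p_2}{p_1}\xi_2(v))$ stay in $\mathbf R_+^2$. Put $\mathcal O_1=\{(x,y)\in\mathbf R_+^2:x\ge\bar u+\frac{p_1}{p_2}y\}$, $\mathcal O_2=\{(x,y)\in\mathbf R_+^2:y\ge\bar v+\frac{p_2}{p_1}x\}$, $\mathcal A_0=\{(\bar x,\bar y)\}$, $\mathcal A_1=\{(u+\frac{p_1}{p_2}\xi_1(u),\xi_1(u)):\bar u<u\le M_1\}$, $\mathcal A_2=\{(\xi_2(v),v+\frac{p_2}{p_1}\xi_2(v)):\bar v<v\le M_2\}$, $\mathcal B_0=([\bar x,\infty)\times[\bar y,\infty))\setminus\mathcal A_0$, $\mathcal B_1=\{(x,y)\in\mathbf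 R_+^2:y\le\bar y,\ x>\xi_1^{-1}(y)+\frac{p_1}{p_2}y\}$, $\mathcal B_2=\{(x,y)\in\mathbf R_+^2:x\le\bar x,\ y>\xi_2^{-1}(x)+\frac{p_2}{p_1}x\}$, and let $\mathcal C$ be the rest of $\mathbf R_+^2$. The curve strategy pays, at current surplus $(x,y)$: the lump sums $x-\bar x$ and $y-\bar y$ by Company One and Two in $\mathcal B_0$; the lump sum $x-\frac{p_1}{p_2}y-\xi_1^{-1}(y)$ by Company One only in $\mathcal B_1$; the lump sum $y-\frac{p_2}{p_1}x-\xi_2^{-1}(x)$ by Company Two only in $\mathcal B_2$; the rates $p_1$ and $p_2$ in $\mathcal A_0$; the rate $-p_2/\xi_1'(x-\frac{p_1}{p_2}y)$ by Company One only in $\mathcal A_1$; the rate $-p_1/\xi_2'(y-\frac{p_2}{p_1}x)$ by Company Two only in $\mathcal A_2$; nothing in $\mathcal C$. After any initial lump sum, the surplus before the first claim stays in $\mathcal C\cup\mathcal A_0\cup\mathcal A_1\cup\mathcal A_2$. **Value.** Let $W_0:\mathbf R_+^2\to\mathbf R$ be continuous, let $\tau_1$ be the time of the first claim of either company and $\bar\tau$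 the ruin time. For dividends $(L^1,L^2)$ paid from $(x,y)$ up to $\tau_1$ according to the curve strategy, with resulting surpluses $(X^L,Y^L)$, let $$W^{\bar\xi}(x,y)=E_{x,y}\Big(\int_0^{\tau_1}e^{-\delta s}(a_1dL^1_s+a_2dL^2_s)+e^{-\delta\tau_1}W_0(X^L_{\tau_1},Y^L_{\tau_1})I_{\tau_1<\bar\tau}+e^{-\delta\bar\tau}\big(a_1V^0_1(X^L_{\bar\tau})+a_2V^0_2(Y^L_{\bar\tau})\big)I_{\tau_1=\bar\tau}\Big).$$ Let $$\begin{aligned}H(x,y)=\;&\lambda_1\int_0^xW_0(x-\alpha,y)dF^1(\alpha)+\lambda_1\int_x^{x+y}W_0(0,x+y-\alpha)dF^1(\alpha)\\&+\lambda_2\int_0^yW_0(x,y-\alpha)dF^2(\alpha)+\lambda_2\int_y^{x+y}W_0(x+y-\alpha,0)dF^2(\alpha)\\&+\lambda_1a_2V_2^0(y)(1-F^1(x+y))+\lambda_2a_1V_1^0(x)(1-F^2(x+y)),\end{aligned}$$ $$\begin{aligned}k(u)=\;&e^{(\delta+\lambda)\frac{\xi_1(u)-\xi_1(\bar u)}{p_2}}\Big(\frac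 p{\delta+\lambda}+\frac1{\delta+\lambda}H\big(\bar u+\tfrac{p_1}{p_2}\xi_1(\bar u),\xi_1(\bar u)\big)\Big)+e^{(\delta+\lambda)\frac{\xi_1(u)}{p_2}}a_1\int_{\bar u}^ue^{-(\delta+\lambda)\frac{\xi_1(w)}{p_2}}dw\\&+\frac{e^{(\delta+\lambda)\frac{\xi_1(u)}{p_2}}}{p_2}\int_{\xi_1(u)}^{\xi_1(\bar u)}H\big(\xi_1^{-1}(t)+\tfrac{p_1}{p_2}t,t\big)e^{-(\delta+\lambda)\frac t{p_2}}dt,\end{aligned}$$ $$\begin{aligned}\tilde k(v)=\;&e^{(\delta+\lambda)\frac{\xi_2(v)-\xi_2(\bar v)}{p_1}}\Big(\frac p{\delta+\lambda}+\frac1{\delta+\lambda}H\big(\xi_2(\bar v),\bar v+\tfrac{p_2}{p_1}\xi_2(\bar v)\big)\Big)+e^{(\delta+\lambda)\frac{\xi_2(v)}{p_1}}a_2\int_{\bar v}^ve^{-(\delta+\lambda)\frac{\xi_2(w)}{p_1}}dw\\&+\frac{e^{(\delta+\lambda)\frac{\xi_2(v)}{p_1}}}{p_1}\int_{\xi_2(v)}^{\xi_2(\bar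 v)}H\big(t,\xi_2^{-1}(t)+\tfrac{p_2}{p_1}t\big)e^{-(\delta+\lambda)\frac t{p_1}}dt.\end{aligned}$$ **Claim.** For every $(x,y)\in\mathbf R_+^2$ dividends that follow the curve strategy up to the first claim exist, and for all such dividends the payoff defining $W^{\bar\xi}(x,y)$ is integrable and the following holds (so that $W^{\bar\xi}$ is well defined). If $(x,y)\in\mathcal O_1$, then 1. if $y\le\bar y$ and $x\le\xi_1^{-1}(y)+\frac{p_1}{p_2}y$, with $u=x-\frac{p_1}{p_2}y$, $$W^{\bar\xi}(x,y)=e^{-(\delta+\lambda)\frac{\xi_1(u)-y}{p_2}}k(u)+\int_0^{\frac{\xi_1(u)-y}{p_2}}e^{-(\delta+\lambda)w}H(x+p_1w,y+p_2w)\,dw;$$ 2. if $y\le\bar y$ and $x\ge\xi_1^{-1}(y)+\frac{p_1}{p_2}y$, then $W^{\bar\xi}(x,y)=a_1\big(x-\xi_1^{-1}(y)-\frac{p_1}{p_2}y\big)+k(\xi_1^{-1}(y))$; 3. if $x\ge\bar x$ and $y\ge\bar y$, then $W^{\bar\xi}(x,y)=a_1(x-\bar x)+a_2(y-\bar y)+k\big(\bar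 x-\frac{p_1}{p_2}\bar y\big)$. If $(x,y)\in\mathcal O_2$, then 1. if $x\le\bar x$ and $y\le\xi_2^{-1}(x)+\frac{p_2}{p_1}x$, with $v=y-\frac{p_2}{p_1}x$, $$W^{\bar\xi}(x,y)=e^{-(\delta+\lambda)\frac{\xi_2(v)-x}{p_1}}\tilde k(v)+\int_0^{\frac{\xi_2(v)-x}{p_1}}e^{-(\delta+\lambda)w}H(x+p_1w,y+p_2w)\,dw;$$ 2. if $x\le\bar x$ and $y\ge\xi_2^{-1}(x)+\frac{p_2}{p_1}x$, then $W^{\bar\xi}(x,y)=a_2\big(y-\xi_2^{-1}(x)-\frac{p_2}{p_1}x\big)+\tilde k(\xi_2^{-1}(x))$; 3. if $x\ge\bar x$ and $y\ge\bar y$, then $W^{\bar\xi}(x,y)=a_1(x-\bar x)+a_2(y-\bar y)+\tilde k\big(\bar y-\frac{p_2}{p_1}\bar x\big)$. -/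

import Mathlib

open MeasureTheory ProbabilityTheory Set
open scoped NNReal ENNReal

noncomputable section

namespace TwoInsurers

/-- The parameters of one insurance company: premium rate, Poisson claim intensity and law of the
claim sizes. The claim sizes are nonnegative, their distribution function is continuous,
and the net profit condition holds. -/
structure Company where
  premium : ℝ
  intensity : ℝ
  claimLaw : Measure ℝ
  isProbabilityMeasure : IsProbabilityMeasure claimLaw
  continuous_cdf : Continuous (cdf claimLaw)
  claim_nonneg : claimLaw (Iio 0) = 0
  claim_integrable : Integrable (fun α : ℝ => α) claimLaw
  intensity_pos : 0 < intensity
  net_profit : intensity * ∫ α, α ∂claimLaw < premium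

variable {Ω : Type*} [MeasurableSpace Ω]

/-- The claims of a company: `wait i` is the waiting time between the claims number `i` and `i + 1`
(the first claim being number `1`), exponentially distributed, and `size i` is the size of the claim
number `i + 1`. Independence is required in `Model`. -/
structure Claims (c : Company) (P : Measure Ω) where
  wait : ℕ → Ω → ℝ
  size : ℕ → Ω → ℝ
  measurable_wait : ∀ i, Measurable (wait i)
  measurable_size : ∀ i, Measurable (size i)
  law_wait : ∀ i, P.map (wait i) = expMeasure c.intensity
  law_size : ∀ i, P.map (size i) = c.claimLaw

namespace Claims

variable {c : Company} {P : Measure Ω} (D : Claims c P)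

/-- Arrival time of the claim number `i + 1`. -/
def arrival (i : ℕ) (ω : Ω) : ℝ := ∑ j ∈ Finset.range (i + 1), D.wait j ω

/-- Total amount of the claims that have arrived up to time `t`, the compound Poisson process
`∑_{i ≤ N_t} U_i`. -/
def total (t : ℝ≥0) (ω : Ω) : ℝ :=
  (∑' i, {ω' | D.arrival i ω' ≤ t}.indicator (fun ω' => ENNReal.ofReal (D.size i ω')) ω).toReal

/-- Premiums minus claims up to time `t`. The free surplus with initial level `x` is
`x + D.net t ω`. -/
def net (t : ℝ≥0) (ω : Ω) : ℝ := c.premium * t - D.total t ω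

lemma measurable_arrival (i : ℕ) : Measurable (D.arrival i) :=
  Finset.measurable_fun_sum _ fun j _ => D.measurable_wait j

lemma measurable_net (t : ℝ≥0) : Measurable (D.net t) := by
  unfold net total
  refine measurable_const.sub (Measurable.ennreal_toReal (Measurable.tsum fun i => ?_))
  exact ((D.measurable_size i).ennreal_ofReal).indicator
    (measurableSet_le (D.measurable_arrival i) measurable_const)

/-- The filtration generated by the free surplus process (it does not depend on the initial
level). -/
def filtration : Filtration ℝ≥0 (inferInstance : MeasurableSpace Ω) :=
  Filtration.natural D.net fun t => (D.measurable_net t).stronglyMeasurable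

end Claims

/-- A cumulative dividend process: it starts at `0`, is nondecreasing, left continuous (with right
limits, by monotonicity), and predictable with respect to `𝓕`. -/
structure IsDividendProcess (𝓕 : Filtration ℝ≥0 (inferInstance : MeasurableSpace Ω))
    (L : ℝ≥0 → Ω → ℝ) : Prop where
  zero : ∀ ω, L 0 ω = 0
  mono : ∀ ω, Monotone fun t => L t ω
  left_continuous : ∀ ω t, ContinuousWithinAt (fun s => L s ω) (Iic t) t
  predictable : IsStronglyPredictable 𝓕 L

open Classical in
/-- The discounted dividends `∫_0^τ e^{-δ s} dℓ_s` of a nondecreasing left continuous path `ℓ`, as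
a Lebesgue-Stieltjes integral over `[0, τ)`. A lump sum at time `0` counts; one paid immediately
after `τ` does not. (For `s < 0` the path is continued by `ℓ 0`.) -/
def discountedDividends (δ : ℝ) (ℓ : ℝ≥0 → ℝ) (τ : ℝ≥0∞) : ℝ≥0∞ :=
  if h : Monotone (fun s : ℝ => ℓ s.toNNReal) then
    ∫⁻ s in {s : ℝ | 0 ≤ s ∧ ENNReal.ofReal s < τ},
      ENNReal.ofReal (Real.exp (-δ * s)) ∂h.stieltjesFunction.measure
  else 0

namespace Claims

variable {c : Company} {P : Measure Ω} (D : Claims c P)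

/-- Ruin time of a company on its own, with initial surplus `x` and dividends `L`. -/
def ruinTime (x : ℝ) (L : ℝ≥0 → Ω → ℝ) (ω : Ω) : ℝ≥0∞ :=
  sInf ((fun t : ℝ≥0 => (t : ℝ≥0∞)) '' {t | x + D.net t ω - L t ω < 0})

/-- Admissible dividend strategies of a company on its own, with initial surplus `x`. -/
structure IsAdmissible (x : ℝ) (L : ℝ≥0 → Ω → ℝ) : Prop extends
    IsDividendProcess D.filtration L where
  le_surplus : ∀ ω (t : ℝ≥0), (t : ℝ≥0∞) < D.ruinTime x L ω → L t ω ≤ x + D.net t ω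

/-- The optimal value function of the one-dimensional problem: the supremum of the expected
discounted dividends until ruin of the company on its own; zero for a negative surplus. -/
def optimalValue (δ x : ℝ) : ℝ :=
  if x < 0 then 0 else
    (⨆ (L : ℝ≥0 → Ω → ℝ) (_ : D.IsAdmissible x L),
      ∫⁻ ω, discountedDividends δ (fun t => L t ω) (D.ruinTime x L ω) ∂P).toReal

end Claims

/-- Two collaborating companies on a probability space, with all claim arrivals and claim sizes
independent, the discount rate `δ` and the weight `a₁` of the dividends of Company One. -/
structure Model (P : Measure Ω) where
  company₁ : Company
  company₂ : Company
  claims₁ : Claims company₁ P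
  claims₂ : Claims company₂ P
  indep : iIndepFun (Sum.elim (Sum.elim claims₁.wait claims₁.size)
    (Sum.elim claims₂.wait claims₂.size)) P
  δ : ℝ
  δ_pos : 0 < δ
  a₁ : ℝ
  a₁_mem : a₁ ∈ Icc (0 : ℝ) 1

/-- The closed first quadrant. -/
def quadrant : Set (ℝ × ℝ) := {z | 0 ≤ z.1 ∧ 0 ≤ z.2}

/-- `ξ : [w, M] → ℝ` is a continuously differentiable function with negative derivative, `ξ w = h`,
`ξ M = 0` and `0 ≤ M`, such that the curve `u ↦ (u + r ξ(u), ξ(u))` stays in the first quadrant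
(the second coordinate is nonnegative by monotonicity). When `w = M` the domain is one point and
there is no condition on the derivative. -/
structure IsBoundaryCurve (r w h : ℝ) (ξ : ℝ → ℝ) (M : ℝ) : Prop where
  le : w ≤ M
  nonneg : 0 ≤ M
  start : ξ w = h
  finish : ξ M = 0
  differentiable : DifferentiableOn ℝ ξ (Icc w M)
  continuous_deriv : ContinuousOn (derivWithin ξ (Icc w M)) (Icc w M)
  deriv_neg : w < M → ∀ u ∈ Icc w M, derivWithin ξ (Icc w M) u < 0
  curve_nonneg : ∀ u ∈ Icc w M, 0 ≤ u + r * ξ u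

/-- The data of a curve strategy for the premium rates `p₁` and `p₂`: the vertex `(xbar, ybar)` and
the functions `ξ₁` on `[ubar, M₁]` and `ξ₂` on `[vbar, M₂]`, where `ubar` and `vbar` are the
intercepts of the line of slope `p₂ / p₁` through the vertex. -/
structure CurveData (p₁ p₂ : ℝ) where
  xbar : ℝ
  ybar : ℝ
  xbar_nonneg : 0 ≤ xbar
  ybar_nonneg : 0 ≤ ybar
  ξ₁ : ℝ → ℝ
  M₁ : ℝ
  ξ₂ : ℝ → ℝ
  M₂ : ℝ
  curve₁ : IsBoundaryCurve (p₁ / p₂) (xbar - p₁ / p₂ * ybar) ybar ξ₁ M₁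
  curve₂ : IsBoundaryCurve (p₂ / p₁) (ybar - p₂ / p₁ * xbar) xbar ξ₂ M₂

namespace CurveData

variable {p₁ p₂ : ℝ} (ξ : CurveData p₁ p₂)

def ubar : ℝ := ξ.xbar - p₁ / p₂ * ξ.ybar

def vbar : ℝ := ξ.ybar - p₂ / p₁ * ξ.xbar

/-- The inverse function of `ξ₁` on `[ubar, M₁]`. -/
def inv₁ : ℝ → ℝ := Function.invFunOn ξ.ξ₁ (Icc ξ.ubar ξ.M₁)

/-- The inverse function of `ξ₂` on `[vbar, M₂]`. -/
def inv₂ : ℝ → ℝ := Function.invFunOn ξ.ξ₂ (Icc ξ.vbar ξ.M₂)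

/-- The part of the first quadrant below the line of slope `p₂ / p₁` through the vertex. -/
def regionO₁ : Set (ℝ × ℝ) := {z ∈ quadrant | ξ.ubar + p₁ / p₂ * z.2 ≤ z.1}

/-- The part of the first quadrant above the line of slope `p₂ / p₁` through the vertex. -/
def regionO₂ : Set (ℝ × ℝ) := {z ∈ quadrant | ξ.vbar + p₂ / p₁ * z.1 ≤ z.2}

def setA₀ : Set (ℝ × ℝ) := {(ξ.xbar, ξ.ybar)}

def setA₁ : Set (ℝ × ℝ) := (fun u => (u + p₁ / p₂ * ξ.ξ₁ u, ξ.ξ₁ u)) '' Ioc ξ.ubar ξ.M₁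

def setA₂ : Set (ℝ × ℝ) := (fun v => (ξ.ξ₂ v, v + p₂ / p₁ * ξ.ξ₂ v)) '' Ioc ξ.vbar ξ.M₂

def setB₀ : Set (ℝ × ℝ) := (Ici ξ.xbar ×ˢ Ici ξ.ybar) \ ξ.setA₀

def setB₁ : Set (ℝ × ℝ) :=
  {z ∈ quadrant | z.2 ≤ ξ.ybar ∧ ξ.inv₁ z.2 + p₁ / p₂ * z.2 < z.1}

def setB₂ : Set (ℝ × ℝ) :=
  {z ∈ quadrant | z.1 ≤ ξ.xbar ∧ ξ.inv₂ z.1 + p₂ / p₁ * z.1 < z.2}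

/-- The boundary curve between action and no action. -/
def setA : Set (ℝ × ℝ) := ξ.setA₀ ∪ ξ.setA₁ ∪ ξ.setA₂

/-- The no-action region, the rest of the first quadrant. -/
def setC : Set (ℝ × ℝ) := quadrant \ (ξ.setA ∪ (ξ.setB₀ ∪ ξ.setB₁ ∪ ξ.setB₂))

open Classical in
/-- The lump sums paid as dividends by the two companies at surplus `z`. (On the overlap of `B₀`
with `B₁` or `B₂` the two prescriptions agree.) -/
def lump (z : ℝ × ℝ) : ℝ × ℝ :=
  if z ∈ ξ.setB₀ then (z.1 - ξ.xbar, z.2 - ξ.ybar)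
  else if z ∈ ξ.setB₁ then (z.1 - p₁ / p₂ * z.2 - ξ.inv₁ z.2, 0)
  else if z ∈ ξ.setB₂ then (0, z.2 - p₂ / p₁ * z.1 - ξ.inv₂ z.1)
  else (0, 0)

open Classical in
/-- The rates at which the two companies pay dividends at surplus `z`. -/
def rate (z : ℝ × ℝ) : ℝ × ℝ :=
  if z ∈ ξ.setA₀ then (p₁, p₂)
  else if z ∈ ξ.setA₁ then
    (-p₂ / derivWithin ξ.ξ₁ (Icc ξ.ubar ξ.M₁) (z.1 - p₁ / p₂ * z.2), 0)
  else if z ∈ ξ.setA₂ then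
    (0, -p₁ / derivWithin ξ.ξ₂ (Icc ξ.vbar ξ.M₂) (z.2 - p₂ / p₁ * z.1))
  else (0, 0)

end CurveData

/-- The rule of collaboration: after a claim that leaves the surpluses `z` with `0 ≤ z.1 + z.2`, a
deficit of one company is covered by the other one. -/
def coverDeficit (z : ℝ × ℝ) : ℝ × ℝ :=
  if z.1 < 0 then (0, z.1 + z.2) else if z.2 < 0 then (z.1 + z.2, 0) else z

namespace Model

variable {P : Measure Ω} (S : Model P)

def p₁ : ℝ := S.company₁.premium
def p₂ : ℝ := S.company₂.premium
def lam₁ : ℝ := S.company₁.intensity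
def lam₂ : ℝ := S.company₂.intensity
def lam : ℝ := S.lam₁ + S.lam₂
def a₂ : ℝ := 1 - S.a₁
def p : ℝ := S.a₁ * S.p₁ + S.a₂ * S.p₂
def F₁ : Measure ℝ := S.company₁.claimLaw
def F₂ : Measure ℝ := S.company₂.claimLaw

/-- The optimal value functions of the stand-alone companies. -/
def V₁ (x : ℝ) : ℝ := S.claims₁.optimalValue S.δ x
def V₂ (y : ℝ) : ℝ := S.claims₂.optimalValue S.δ y

/-- The time of the first claim. -/
def firstClaim (ω : Ω) : ℝ := min (S.claims₁.arrival 0 ω) (S.claims₂.arrival 0 ω)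

/-- The filtration generated by the bivariate surplus process. -/
def filtration : Filtration ℝ≥0 (inferInstance : MeasurableSpace Ω) :=
  Filtration.natural (fun t ω => (S.claims₁.net t ω, S.claims₂.net t ω)) fun t =>
    ((S.claims₁.measurable_net t).prodMk (S.claims₂.measurable_net t)).stronglyMeasurable

/-- The surpluses at time `t`, from the initial surpluses `z`, after the dividends `L₁` and `L₂` and
before any transfer between the companies; up to the first claim this is the controlled process,
and at the first claim it is the controlled process before the deficit is covered. -/
def surplus (z : ℝ × ℝ) (L₁ L₂ : ℝ≥0 → Ω → ℝ) (t : ℝ≥0) (ω : Ω) : ℝ × ℝ :=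
  (z.1 + S.claims₁.net t ω - L₁ t ω, z.2 + S.claims₂.net t ω - L₂ t ω)

/-- Up to the first claim, the dividends `L₁` and `L₂` are paid according to the curve strategy `ξ`
from the initial surpluses `z`: the lump sums prescribed at `z` are paid at once, after that the
surplus stays in `C ∪ A`, and dividends are paid at the rates prescribed at the current surplus. -/
structure IsCurveStrategy (ξ : CurveData S.p₁ S.p₂) (z : ℝ × ℝ) (L₁ L₂ : ℝ≥0 → Ω → ℝ) :
    Prop where
  dividend₁ : IsDividendProcess S.filtration L₁
  dividend₂ : IsDividendProcess S.filtration L₂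
  rule : ∀ᵐ ω ∂P, ∀ t : ℝ≥0, 0 < t → (t : ℝ) < S.firstClaim ω →
    S.surplus z L₁ L₂ t ω ∈ ξ.setC ∪ ξ.setA ∧
    IntervalIntegrable (fun s : ℝ => ξ.rate (S.surplus z L₁ L₂ s.toNNReal ω)) volume 0 t ∧
    (L₁ t ω, L₂ t ω) =
      ξ.lump z + ∫ s in (0 : ℝ)..t, ξ.rate (S.surplus z L₁ L₂ s.toNNReal ω)

/-- The payoff up to the first claim, at time `τ`: the weighted discounted dividends paid until `τ`
plus the discounted value `W₀` of the surplus at `τ` if the collaboration survives the claim, and the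
discounted weighted value of the surviving company on its own if it does not. -/
def oneStepPayoff (W₀ : ℝ × ℝ → ℝ) (z : ℝ × ℝ) (L₁ L₂ : ℝ≥0 → Ω → ℝ) (ω : Ω) : ℝ :=
  let τ := S.firstClaim ω
  let Z := S.surplus z L₁ L₂ τ.toNNReal ω
  S.a₁ * (discountedDividends S.δ (fun t => L₁ t ω) (ENNReal.ofReal τ)).toReal
    + S.a₂ * (discountedDividends S.δ (fun t => L₂ t ω) (ENNReal.ofReal τ)).toReal
    + Real.exp (-S.δ * τ) *
      (if 0 ≤ Z.1 + Z.2 then W₀ (coverDeficit Z) else S.a₁ * S.V₁ Z.1 + S.a₂ * S.V₂ Z.2)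

/-- The value `E_z` of the payoff up to the first claim. -/
def oneStepValue (W₀ : ℝ × ℝ → ℝ) (z : ℝ × ℝ) (L₁ L₂ : ℝ≥0 → Ω → ℝ) : ℝ :=
  ∫ ω, S.oneStepPayoff W₀ z L₁ L₂ ω ∂P

/-- The integral operator `𝓘`. -/
def opI (W : ℝ × ℝ → ℝ) (x y : ℝ) : ℝ :=
  S.lam₁ * (∫ α in Icc 0 x, W (x - α, y) ∂S.F₁)
    + S.lam₁ * (∫ α in Ioc x (x + y), W (0, x + y - α) ∂S.F₁)
    + S.lam₂ * (∫ α in Icc 0 y, W (x, y - α) ∂S.F₂)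
    + S.lam₂ * (∫ α in Ioc y (x + y), W (x + y - α, 0) ∂S.F₂)

def U (x y : ℝ) : ℝ :=
  S.lam₁ * S.a₂ * S.V₂ y * (1 - cdf S.F₁ (x + y))
    + S.lam₂ * S.a₁ * S.V₁ x * (1 - cdf S.F₂ (x + y))

def H (W₀ : ℝ × ℝ → ℝ) (x y : ℝ) : ℝ := S.opI W₀ x y + S.U x y

/-- The auxiliary function `k` along the curve of `ξ₁`. -/
def k (W₀ : ℝ × ℝ → ℝ) (ξ : CurveData S.p₁ S.p₂) (u : ℝ) : ℝ :=
  Real.exp ((S.δ + S.lam) * ((ξ.ξ₁ u - ξ.ξ₁ ξ.ubar) / S.p₂)) *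
      (S.p / (S.δ + S.lam) + 1 / (S.δ + S.lam) *
        S.H W₀ (ξ.ubar + S.p₁ / S.p₂ * ξ.ξ₁ ξ.ubar) (ξ.ξ₁ ξ.ubar))
    + Real.exp ((S.δ + S.lam) * (ξ.ξ₁ u / S.p₂)) * S.a₁ *
      (∫ w in ξ.ubar..u, Real.exp (-(S.δ + S.lam) * (ξ.ξ₁ w / S.p₂)))
    + Real.exp ((S.δ + S.lam) * (ξ.ξ₁ u / S.p₂)) / S.p₂ *
      (∫ t in ξ.ξ₁ u..ξ.ξ₁ ξ.ubar,
        S.H W₀ (ξ.inv₁ t + S.p₁ / S.p₂ * t) t * Real.exp (-(S.δ + S.lam) * (t / S.p₂)))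

/-- The auxiliary function `k` along the curve of `ξ₂`. -/
def kTilde (W₀ : ℝ × ℝ → ℝ) (ξ : CurveData S.p₁ S.p₂) (v : ℝ) : ℝ :=
  Real.exp ((S.δ + S.lam) * ((ξ.ξ₂ v - ξ.ξ₂ ξ.vbar) / S.p₁)) *
      (S.p / (S.δ + S.lam) + 1 / (S.δ + S.lam) *
        S.H W₀ (ξ.ξ₂ ξ.vbar) (ξ.vbar + S.p₂ / S.p₁ * ξ.ξ₂ ξ.vbar))
    + Real.exp ((S.δ + S.lam) * (ξ.ξ₂ v / S.p₁)) * S.a₂ *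
      (∫ w in ξ.vbar..v, Real.exp (-(S.δ + S.lam) * (ξ.ξ₂ w / S.p₁)))
    + Real.exp ((S.δ + S.lam) * (ξ.ξ₂ v / S.p₁)) / S.p₁ *
      (∫ t in ξ.ξ₂ v..ξ.ξ₂ ξ.vbar,
        S.H W₀ t (ξ.inv₂ t + S.p₂ / S.p₁ * t) * Real.exp (-(S.δ + S.lam) * (t / S.p₁)))

end Model

end TwoInsurers

end

open Filter Topology

namespace TwoInsurers

/-! The proof has a deterministic part and a probabilistic part. Until the first claim the surplus
is a deterministic path. In the coordinates `u = x - (p₁/p₂) y` and `y`, premiums alone leave `u`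
fixed and raise `y` at rate `p₂`. Below the line through the vertex the path is therefore explicit:
`y` grows linearly until it is capped at `ybar`, and `u` stays at its initial value until the curve
is met, after which it equals `inv₁ y`. This is `CurveData.path`: travel to the curve, slide along
it to the vertex, remain there; its value at time `0` already incorporates the lump sums.
`follows_path` shows that it obeys the strategy.

Since the rates depend discontinuously on the surplus, uniqueness is not a matter of standard ODE
theory. `Follows.eq_path` obtains it from comparisons: wherever a trajectory would violate one of
the inequalities that pin down `path`, the relevant rate vanishes, and this pushes the trajectory
back (`nonneg_of_le_of_neg_on_Ioc`).

For the expectation, `e^{-δs}` is read as the probability that an independent exponential time `e_δ`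
exceeds `s`. Hence discounted dividends up to `τ` are the mean of the cumulative dividends at `min
e_δ τ`, and the first claim being exponential with parameter `λ`, this minimum is exponential with
parameter `δ + λ` (`discountedDividends_eq`, `map_min_expMeasure`). The value after the claim splits
according to which company is hit; averaging over the claim size produces `H` (`H_eq`). Together,
`expected_payoff` gives the payoff as `∫ q e^{-qt} (weighted cumulative dividends at t) dt + ∫
e^{-qt} H(path at t) dt` over `t > 0`, with `q = δ + λ`.

What remains is calculus. `pathValue_of_isBelow` splits both integrals at the times when the curve
and the vertex are reached; integration by parts and a change of variable turn the curve phase into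
the integrals in `k`. A starting point off the curve only adds its lump sums (`pathValue_eq_add`).
The region above the line follows by exchanging the two companies. -/

/-- A continuous function that does not decrease on intervals where it is negative stays
nonnegative. -/
lemma nonneg_of_le_of_neg_on_Ioc {f : ℝ → ℝ} {b : ℝ} (hf : ContinuousOn f (Icc 0 b))
    (h0 : 0 ≤ f 0)
    (h : ∀ s t, 0 ≤ s → s < t → t ≤ b → (∀ r ∈ Ioc s t, f r < 0) → f s ≤ f t) :
    ∀ t ∈ Icc 0 b, 0 ≤ f t := by
  intro t ht
  by_contra! hneg
  -- The supremum of `K` is the last time up to `t` at which `f` is nonnegative; on the interval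
  -- after it `f` is negative, so `h` applies there.
  set K := Icc 0 t ∩ f ⁻¹' Ici 0
  have hK : IsCompact K := by
    refine isCompact_Icc.of_isClosed_subset ?_ inter_subset_left
    exact (hf.mono (Icc_subset_Icc_right ht.2)).preimage_isClosed_of_isClosed isClosed_Icc
      isClosed_Ici
  have hs : sSup K ∈ K := hK.sSup_mem ⟨0, ⟨le_rfl, ht.1⟩, h0⟩
  have hst : sSup K < t := by
    refine lt_of_le_of_ne hs.1.2 fun heq => ?_
    have : 0 ≤ f (sSup K) := hs.2
    rw [heq] at this
    linarith
  have := h _ _ hs.1.1 hst ht.2 fun r hr => by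
    by_contra! hr'
    exact absurd (le_csSup hK.bddAbove ⟨⟨hs.1.1.trans hr.1.le, hr.2⟩, hr'⟩) (not_le.2 hr.1)
  have h2 : 0 ≤ f (sSup K) := hs.2
  linarith

/-! ### Boundary curves and their inverse functions -/

namespace IsBoundaryCurve

variable {r w h M : ℝ} {ξ : ℝ → ℝ} (hξ : IsBoundaryCurve r w h ξ M)
include hξ

lemma continuousOn : ContinuousOn ξ (Icc w M) := hξ.differentiable.continuousOn

lemma hasDerivAt {u : ℝ} (hu : u ∈ Ioo w M) : HasDerivAt ξ (derivWithin ξ (Icc w M) u) u :=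
  (hξ.differentiable u (Ioo_subset_Icc_self hu)).hasDerivWithinAt.hasDerivAt
    (Icc_mem_nhds hu.1 hu.2)

lemma derivWithin_neg {u : ℝ} (hu : u ∈ Ioo w M) : derivWithin ξ (Icc w M) u < 0 :=
  hξ.deriv_neg (hu.1.trans hu.2) u (Ioo_subset_Icc_self hu)

lemma strictAntiOn : StrictAntiOn ξ (Icc w M) := by
  refine strictAntiOn_of_deriv_neg (convex_Icc _ _) hξ.continuousOn fun u hu => ?_
  rw [interior_Icc] at hu
  rw [(hξ.hasDerivAt hu).deriv]
  exact hξ.derivWithin_neg hu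

lemma left_mem : w ∈ Icc w M := ⟨le_rfl, hξ.le⟩

lemma right_mem : M ∈ Icc w M := ⟨hξ.le, le_rfl⟩

lemma mapsTo : MapsTo ξ (Icc w M) (Icc 0 h) := fun u hu => by
  rw [← hξ.start, ← hξ.finish]
  exact ⟨hξ.strictAntiOn.antitoneOn hu hξ.right_mem hu.2,
    hξ.strictAntiOn.antitoneOn hξ.left_mem hu hu.1⟩

lemma surjOn : SurjOn ξ (Icc w M) (Icc 0 h) := by
  have := intermediate_value_Icc' hξ.le hξ.continuousOn
  rwa [hξ.start, hξ.finish] at this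

lemma inv_mem {y : ℝ} (hy : y ∈ Icc 0 h) : Function.invFunOn ξ (Icc w M) y ∈ Icc w M :=
  Function.invFunOn_mem (hξ.surjOn hy)

lemma apply_inv {y : ℝ} (hy : y ∈ Icc 0 h) : ξ (Function.invFunOn ξ (Icc w M) y) = y :=
  Function.invFunOn_eq (hξ.surjOn hy)

lemma inv_apply {u : ℝ} (hu : u ∈ Icc w M) : Function.invFunOn ξ (Icc w M) (ξ u) = u :=
  hξ.strictAntiOn.injOn.leftInvOn_invFunOn hu

lemma inv_height : Function.invFunOn ξ (Icc w M) h = w := by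
  have := hξ.inv_apply hξ.left_mem
  rwa [hξ.start] at this

lemma inv_strictAntiOn : StrictAntiOn (Function.invFunOn ξ (Icc w M)) (Icc 0 h) := by
  intro a ha b hb hab
  rw [← hξ.strictAntiOn.lt_iff_gt (hξ.inv_mem ha) (hξ.inv_mem hb), hξ.apply_inv ha,
    hξ.apply_inv hb]
  exact hab

/-- A continuous injection of a compact interval is a closed embedding, so continuity of the inverse
can be tested after composition with `ξ`, where it is trivial. -/
lemma inv_continuousOn : ContinuousOn (Function.invFunOn ξ (Icc w M)) (Icc 0 h) := by
  have he : IsClosedEmbedding ((Icc w M).domRestrict ξ) :=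
    (continuousOn_iff_continuous_domRestrict.1 hξ.continuousOn).isClosedEmbedding
      hξ.strictAntiOn.injOn.injective
  let g : Icc 0 h → Icc w M := fun y => ⟨Function.invFunOn ξ (Icc w M) y, hξ.inv_mem y.2⟩
  have hg : Continuous g := by
    rw [he.isEmbedding.continuous_iff]
    refine continuous_subtype_val.congr fun y => (hξ.apply_inv y.2).symm
  rw [continuousOn_iff_continuous_domRestrict]
  exact continuous_subtype_val.comp hg

lemma inv_mem_Ioo {y : ℝ} (hy : y ∈ Ioo 0 h) : Function.invFunOn ξ (Icc w M) y ∈ Ioo w M := by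
  have hy' := Ioo_subset_Icc_self hy
  have h1 := hξ.inv_mem hy'
  have h2 := hξ.apply_inv hy'
  refine ⟨lt_of_le_of_ne h1.1 fun h3 => ?_, lt_of_le_of_ne h1.2 fun h3 => ?_⟩
  · rw [← h3, hξ.start] at h2
    linarith [hy.2]
  · rw [h3, hξ.finish] at h2
    linarith [hy.1]

/-- Restricted to interior heights, where the preimage is interior as well and `derivWithin` is a
genuine two-sided derivative. -/
lemma inv_hasDerivAt {y : ℝ} (hy : y ∈ Ioo 0 h) :
    HasDerivAt (Function.invFunOn ξ (Icc w M))
      (derivWithin ξ (Icc w M) (Function.invFunOn ξ (Icc w M) y))⁻¹ y := by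
  refine HasDerivAt.of_local_left_inverse
    (hξ.inv_continuousOn.continuousAt (Icc_mem_nhds hy.1 hy.2))
    (hξ.hasDerivAt (hξ.inv_mem_Ioo hy)) (hξ.derivWithin_neg (hξ.inv_mem_Ioo hy)).ne ?_
  filter_upwards [Icc_mem_nhds hy.1 hy.2] with z hz using hξ.apply_inv hz

end IsBoundaryCurve

/-! ### Geometry of the action regions below the line through the vertex -/

namespace CurveData

variable {p₁ p₂ : ℝ} (ξ : CurveData p₁ p₂)

lemma isBoundaryCurve₁ : IsBoundaryCurve (p₁ / p₂) ξ.ubar ξ.ybar ξ.ξ₁ ξ.M₁ := ξ.curve₁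

lemma isBoundaryCurve₂ : IsBoundaryCurve (p₂ / p₁) ξ.vbar ξ.xbar ξ.ξ₂ ξ.M₂ := ξ.curve₂

lemma inv₁_ybar : ξ.inv₁ ξ.ybar = ξ.ubar := ξ.isBoundaryCurve₁.inv_height

lemma xbar_eq : ξ.xbar = ξ.ubar + p₁ / p₂ * ξ.ybar := by
  unfold ubar; ring

variable {ξ} {z : ℝ × ℝ}

/-- Both intercepts describe the same line through the vertex, so everything attached to `ξ₂` lies
strictly on one side of it and everything attached to `ξ₁` on the other. -/
lemma vbar_lt_iff (hp₁ : 0 < p₁) (hp₂ : 0 < p₂) :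
    ξ.vbar < z.2 - p₂ / p₁ * z.1 ↔ z.1 - p₁ / p₂ * z.2 < ξ.ubar := by
  have h1 : z.2 - p₂ / p₁ * z.1 - ξ.vbar
      = p₂ / p₁ * (ξ.ubar - (z.1 - p₁ / p₂ * z.2)) := by
    unfold vbar ubar; field_simp; ring
  rw [← sub_pos, h1, mul_pos_iff_of_pos_left (by positivity), sub_pos]

lemma setA₂_lt (hp₁ : 0 < p₁) (hp₂ : 0 < p₂) (hz : z ∈ ξ.setA₂) :
    z.1 - p₁ / p₂ * z.2 < ξ.ubar := by
  rw [← vbar_lt_iff hp₁ hp₂]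
  obtain ⟨v, hv, rfl⟩ := hz
  simpa using hv.1

lemma setB₂_lt (hp₁ : 0 < p₁) (hp₂ : 0 < p₂) (hz : z ∈ ξ.setB₂) :
    z.1 - p₁ / p₂ * z.2 < ξ.ubar := by
  rw [← vbar_lt_iff hp₁ hp₂]
  have h1 : ξ.vbar ≤ ξ.inv₂ z.1 := (ξ.isBoundaryCurve₂.inv_mem ⟨hz.1.1, hz.2.1⟩).1
  linarith [hz.2.2]

lemma setA₁_lt (hz : z ∈ ξ.setA₁) : ξ.ubar < z.1 - p₁ / p₂ * z.2 := by
  obtain ⟨u, hu, rfl⟩ := hz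
  simpa using hu.1

lemma setB₁_lt (hz : z ∈ ξ.setB₁) : ξ.ubar < z.1 - p₁ / p₂ * z.2 := by
  have h1 : ξ.ubar ≤ ξ.inv₁ z.2 := (ξ.isBoundaryCurve₁.inv_mem ⟨hz.1.2, hz.2.1⟩).1
  linarith [hz.2.2]

lemma setA₀_eq (hz : z ∈ ξ.setA₀) : z.1 - p₁ / p₂ * z.2 = ξ.ubar := by
  rw [mem_singleton_iff.1 hz]; rfl

lemma setA₁_inv (hz : z ∈ ξ.setA₁) :
    z.2 ∈ Icc 0 ξ.ybar ∧ ξ.inv₁ z.2 = z.1 - p₁ / p₂ * z.2 := by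
  obtain ⟨u, hu, rfl⟩ := hz
  refine ⟨ξ.isBoundaryCurve₁.mapsTo (Ioc_subset_Icc_self hu), ?_⟩
  have : ξ.inv₁ (ξ.ξ₁ u) = u := ξ.isBoundaryCurve₁.inv_apply (Ioc_subset_Icc_self hu)
  simp [this]

variable (ξ) in
/-- The points on or below the boundary curve of `ξ₁` and below the line of slope `p₂ / p₁` through
the vertex. -/
structure IsBelow (z : ℝ × ℝ) : Prop where
  fst_nonneg : 0 ≤ z.1
  snd_mem : z.2 ∈ Icc 0 ξ.ybar
  ubar_le : ξ.ubar ≤ z.1 - p₁ / p₂ * z.2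
  le_inv : z.1 - p₁ / p₂ * z.2 ≤ ξ.inv₁ z.2

/-- On this side of the line, a point higher than the vertex would lie in `B₀` and a point to the
right of the curve would lie in `B₁`, so neither can be in `C ∪ A`. -/
lemma isBelow_of_mem (hp₁ : 0 < p₁) (hp₂ : 0 < p₂) (hz : z ∈ ξ.setC ∪ ξ.setA)
    (hu : ξ.ubar ≤ z.1 - p₁ / p₂ * z.2) : ξ.IsBelow z := by
  rcases hz with hz | (hz | hz) | hz
  · have hq : z ∈ quadrant := hz.1
    have hy : z.2 ≤ ξ.ybar := by
      by_contra! hy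
      refine hz.2 (Or.inr (Or.inl (Or.inl ⟨⟨?_, hy.le⟩, fun h => ?_⟩)))
      · have := mul_lt_mul_of_pos_left hy (div_pos hp₁ hp₂)
        rw [mem_Ici, ξ.xbar_eq]
        linarith
      · rw [mem_singleton_iff.1 h] at hy
        exact lt_irrefl _ hy
    refine ⟨hq.1, ⟨hq.2, hy⟩, hu, ?_⟩
    by_contra! h
    exact hz.2 (Or.inr (Or.inl (Or.inr ⟨hq, hy, by linarith⟩)))
  · rw [mem_singleton_iff.1 hz] at hu ⊢
    exact ⟨ξ.xbar_nonneg, ⟨ξ.ybar_nonneg, le_rfl⟩, hu, by rw [ξ.inv₁_ybar]; rfl⟩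
  · refine ⟨?_, (setA₁_inv hz).1, hu, (setA₁_inv hz).2.ge⟩
    obtain ⟨u, hu', rfl⟩ := hz
    exact ξ.isBoundaryCurve₁.curve_nonneg u (Ioc_subset_Icc_self hu')
  · exact absurd (setA₂_lt hp₁ hp₂ hz) (not_lt.2 hu)

lemma IsBelow.mem_quadrant (hz : ξ.IsBelow z) : z ∈ quadrant := ⟨hz.fst_nonneg, hz.snd_mem.1⟩

lemma IsBelow.notMem_setB₀ (hz : ξ.IsBelow z) : z ∉ ξ.setB₀ := by
  rintro ⟨⟨h1, h2⟩, h3⟩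
  have hy : z.2 = ξ.ybar := le_antisymm hz.snd_mem.2 h2
  have h4 := hz.le_inv
  rw [hy, ξ.inv₁_ybar] at h4
  refine h3 (Prod.ext (le_antisymm ?_ h1) hy)
  change z.1 ≤ ξ.xbar
  rw [ξ.xbar_eq]
  linarith

lemma IsBelow.notMem_setB₁ (hz : ξ.IsBelow z) : z ∉ ξ.setB₁ := fun h => by
  linarith [h.2.2, hz.le_inv]

lemma IsBelow.mem (hp₁ : 0 < p₁) (hp₂ : 0 < p₂) (hz : ξ.IsBelow z) :
    z ∈ ξ.setC ∪ ξ.setA := by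
  by_cases hA : z ∈ ξ.setA
  · exact Or.inr hA
  refine Or.inl ⟨hz.mem_quadrant, ?_⟩
  rintro (h | (h | h) | h)
  · exact hA h
  · exact hz.notMem_setB₀ h
  · exact hz.notMem_setB₁ h
  · exact absurd (setB₂_lt hp₁ hp₂ h) (not_lt.2 hz.ubar_le)

lemma derivWithin_ξ₁_nonpos (u : ℝ) (hu : u ∈ Ioc ξ.ubar ξ.M₁) :
    derivWithin ξ.ξ₁ (Icc ξ.ubar ξ.M₁) u < 0 :=
  ξ.isBoundaryCurve₁.deriv_neg (hu.1.trans_le hu.2) u (Ioc_subset_Icc_self hu)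

lemma derivWithin_ξ₂_nonpos (u : ℝ) (hu : u ∈ Ioc ξ.vbar ξ.M₂) :
    derivWithin ξ.ξ₂ (Icc ξ.vbar ξ.M₂) u < 0 :=
  ξ.isBoundaryCurve₂.deriv_neg (hu.1.trans_le hu.2) u (Ioc_subset_Icc_self hu)

lemma rate_nonneg (hp₁ : 0 < p₁) (hp₂ : 0 < p₂) (z : ℝ × ℝ) :
    0 ≤ (ξ.rate z).1 ∧ 0 ≤ (ξ.rate z).2 := by
  unfold rate
  split_ifs with h0 h1 h2
  · exact ⟨hp₁.le, hp₂.le⟩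
  · obtain ⟨u, hu, rfl⟩ := h1
    refine ⟨div_nonneg_of_nonpos (by linarith) ?_, le_rfl⟩
    simpa using (derivWithin_ξ₁_nonpos u hu).le
  · obtain ⟨u, hu, rfl⟩ := h2
    refine ⟨le_rfl, div_nonneg_of_nonpos (by linarith) ?_⟩
    simpa using (derivWithin_ξ₂_nonpos u hu).le
  · exact ⟨le_rfl, le_rfl⟩

lemma rate_fst_of_lt (h : z.1 - p₁ / p₂ * z.2 < ξ.ubar) : (ξ.rate z).1 = 0 := by
  have h0 : z ∉ ξ.setA₀ := fun h' => h.ne (setA₀_eq h')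
  have h1 : z ∉ ξ.setA₁ := fun h' => h.not_gt (setA₁_lt h')
  unfold rate
  rw [if_neg h0, if_neg h1]
  split_ifs <;> rfl

lemma rate_snd_of_ne (hp₁ : 0 < p₁) (hp₂ : 0 < p₂) (h : ξ.ubar ≤ z.1 - p₁ / p₂ * z.2)
    (hy : z.2 ≠ ξ.ybar) : (ξ.rate z).2 = 0 := by
  have h0 : z ∉ ξ.setA₀ := fun h' => hy (by rw [mem_singleton_iff.1 h'])
  have h2 : z ∉ ξ.setA₂ := fun h' => h.not_gt (setA₂_lt hp₁ hp₂ h')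
  unfold rate
  rw [if_neg h0, if_neg h2]
  split_ifs <;> rfl

lemma rate_eq_zero (hp₁ : 0 < p₁) (hp₂ : 0 < p₂) (h : ξ.ubar ≤ z.1 - p₁ / p₂ * z.2)
    (hy : z.1 - p₁ / p₂ * z.2 < ξ.inv₁ z.2) : ξ.rate z = 0 := by
  have h0 : z ∉ ξ.setA₀ := fun h' => by
    rw [setA₀_eq h', mem_singleton_iff.1 h', ξ.inv₁_ybar] at hy
    exact lt_irrefl _ hy
  have h1 : z ∉ ξ.setA₁ := fun h' => hy.ne' (setA₁_inv h').2
  have h2 : z ∉ ξ.setA₂ := fun h' => h.not_gt (setA₂_lt hp₁ hp₂ h')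
  unfold rate
  rw [if_neg h0, if_neg h1, if_neg h2]
  rfl

/-- Company Two pays here only at the vertex, where the two sides agree; elsewhere the left side is
zero. The point is that dividends never increase the intercept `x - (p₁/p₂) y`. -/
lemma rate_snd_le (hp₁ : 0 < p₁) (hp₂ : 0 < p₂) (h : ξ.ubar ≤ z.1 - p₁ / p₂ * z.2) :
    p₁ / p₂ * (ξ.rate z).2 ≤ (ξ.rate z).1 := by
  by_cases h0 : z ∈ ξ.setA₀
  · unfold rate
    rw [if_pos h0]
    simp only
    rw [div_mul_cancel₀ _ hp₂.ne']
  · by_cases hy : z.2 = ξ.ybar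
    · by_cases h1 : z ∈ ξ.setA₁
      · have := setA₁_lt h1
        have h3 := (setA₁_inv h1).2
        rw [hy, ξ.inv₁_ybar, ← hy] at h3
        linarith
      · have h2 : z ∉ ξ.setA₂ := fun h' => h.not_gt (setA₂_lt hp₁ hp₂ h')
        unfold rate
        rw [if_neg h0, if_neg h1, if_neg h2]
        simp
    · rw [rate_snd_of_ne hp₁ hp₂ h hy, mul_zero]
      exact (rate_nonneg hp₁ hp₂ z).1

/-! ### The explicit surplus path -/

variable (ξ) in
/-- The surplus before the first claim when the curve strategy is followed from `z`, for `z` below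
the line of slope `p₂ / p₁` through the vertex. -/
noncomputable def path (z : ℝ × ℝ) (t : ℝ) : ℝ × ℝ :=
  (min (z.1 - p₁ / p₂ * z.2) (ξ.inv₁ (min (z.2 + p₂ * t) ξ.ybar))
    + p₁ / p₂ * min (z.2 + p₂ * t) ξ.ybar, min (z.2 + p₂ * t) ξ.ybar)

lemma path_snd (t : ℝ) : (ξ.path z t).2 = min (z.2 + p₂ * t) ξ.ybar := rfl

/-- The path is simplest in terms of its intercept and its height; most later arguments use only
this relation and `path_snd`. -/
lemma path_fst_sub (t : ℝ) : (ξ.path z t).1 - p₁ / p₂ * (ξ.path z t).2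
    = min (z.1 - p₁ / p₂ * z.2) (ξ.inv₁ (ξ.path z t).2) := by
  simp [path]

lemma path_snd_mem (hp₂ : 0 < p₂) (hz : z ∈ quadrant) {t : ℝ} (ht : 0 ≤ t) :
    (ξ.path z t).2 ∈ Icc 0 ξ.ybar :=
  ⟨le_min (add_nonneg hz.2 (by positivity)) ξ.ybar_nonneg, min_le_right _ _⟩

lemma isBelow_path (hp₁ : 0 < p₁) (hp₂ : 0 < p₂) (hz : z ∈ ξ.regionO₁) {t : ℝ}
    (ht : 0 ≤ t) : ξ.IsBelow (ξ.path z t) := by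
  obtain ⟨hq, hu⟩ := hz
  have hY := path_snd_mem (ξ := ξ) hp₂ hq ht
  have hI := ξ.isBoundaryCurve₁.inv_mem hY
  refine ⟨?_, hY, ?_, ?_⟩
  · have h1 : (ξ.path z t).1 = min (z.1 - p₁ / p₂ * z.2) (ξ.inv₁ (ξ.path z t).2)
      + p₁ / p₂ * (ξ.path z t).2 := rfl
    rw [h1, ← min_add_add_right]
    refine le_min ?_ ?_
    · rcases le_total (z.2 + p₂ * t) ξ.ybar with h | h
      · rw [path_snd, min_eq_left h]
        have : p₁ / p₂ * (z.2 + p₂ * t) = p₁ / p₂ * z.2 + p₁ * t := by field_simp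
        have := mul_nonneg hp₁.le ht
        linarith [hq.1]
      · rw [path_snd, min_eq_right h]
        linarith [ξ.xbar_eq, ξ.xbar_nonneg]
    · have := ξ.isBoundaryCurve₁.curve_nonneg _ hI
      rwa [ξ.isBoundaryCurve₁.apply_inv hY] at this
  · rw [path_fst_sub]
    exact le_min (by linarith) hI.1
  · rw [path_fst_sub]
    exact min_le_right _ _

lemma path_zero_snd (z : ℝ × ℝ) : (ξ.path z 0).2 = min z.2 ξ.ybar := by
  rw [path_snd, mul_zero, add_zero]

/-- Restarting after the initial jump changes nothing, since the extra minima with the values at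
time `0` are inactive: the height does not decrease and `inv₁` is antitone. This reduces statements
about arbitrary starting points to points satisfying `IsBelow`. -/
lemma path_path (hp₂ : 0 < p₂) (hz : z ∈ ξ.regionO₁) {t : ℝ} (ht : 0 ≤ t) :
    ξ.path (ξ.path z 0) t = ξ.path z t := by
  have h2 : (ξ.path (ξ.path z 0) t).2 = (ξ.path z t).2 := by
    rw [path_snd, path_zero_snd, path_snd, min_add, min_assoc,
      min_eq_right (a := ξ.ybar + p₂ * t) (by nlinarith)]
  refine Prod.ext ?_ h2
  have h3 := path_fst_sub (ξ := ξ) (z := z) t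
  have h4 := path_fst_sub (ξ := ξ) (z := ξ.path z 0) t
  rw [h2, path_fst_sub, min_assoc] at h4
  have hY := path_snd_mem (ξ := ξ) hp₂ hz.1 ht
  have hY0 := path_snd_mem (ξ := ξ) hp₂ hz.1 le_rfl
  have h5 : ξ.inv₁ (ξ.path z t).2 ≤ ξ.inv₁ (ξ.path z 0).2 := by
    refine ξ.isBoundaryCurve₁.inv_strictAntiOn.antitoneOn hY0 hY ?_
    rw [path_zero_snd, path_snd]
    exact min_le_min_right _ (by nlinarith)
  rw [min_eq_right h5] at h4
  linarith

/-- The two minima in `path` perform the lump sums: the cap of the height at `ybar` is the jump from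
`B₀` to the vertex, and the cap of the intercept by `inv₁` is the horizontal jump from `B₁` to the
curve. -/
lemma path_zero (hp₁ : 0 < p₁) (hp₂ : 0 < p₂) (hz : z ∈ ξ.regionO₁) :
    ξ.path z 0 = z - ξ.lump z := by
  obtain ⟨hq, hu⟩ := hz
  have h2 : z ∉ ξ.setB₂ := fun h => by linarith [setB₂_lt hp₁ hp₂ h]
  have e1 := path_fst_sub (ξ := ξ) (z := z) 0
  have e2 := path_zero_snd (ξ := ξ) z
  unfold lump
  by_cases hy : ξ.ybar ≤ z.2
  · rw [min_eq_right hy] at e2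
    rw [e2, ξ.inv₁_ybar, min_eq_right (by linarith)] at e1
    have e3 : ξ.path z 0 = (ξ.xbar, ξ.ybar) := Prod.ext (by simp [xbar_eq]; linarith) e2
    rw [e3]
    have hx : ξ.xbar ≤ z.1 := by
      rw [xbar_eq]
      have := mul_le_mul_of_nonneg_left hy (div_pos hp₁ hp₂).le
      linarith
    by_cases h0 : z ∈ ξ.setB₀
    · rw [if_pos h0]
      ext <;> simp
    · have h1 : z = (ξ.xbar, ξ.ybar) := by
        by_contra h
        exact h0 ⟨⟨hx, hy⟩, h⟩
      have h3 : z ∉ ξ.setB₁ := fun h => by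
        have h4 := h.2.2
        rw [h1, inv₁_ybar, xbar_eq] at h4
        exact lt_irrefl _ h4
      rw [if_neg h0, if_neg h3, if_neg h2]
      simp [h1]
  · push Not at hy
    rw [min_eq_left hy.le] at e2
    rw [e2] at e1
    have h0 : z ∉ ξ.setB₀ := fun h => hy.not_ge h.1.2
    rw [if_neg h0]
    by_cases h1 : z ∈ ξ.setB₁
    · have h4 := h1.2.2
      rw [min_eq_right (by linarith)] at e1
      rw [if_pos h1]
      refine Prod.ext ?_ ?_
      · simp only [Prod.fst_sub]; linarith
      · simp [e2]
    · rw [if_neg h1, if_neg h2]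
      have h5 : z.1 - p₁ / p₂ * z.2 ≤ ξ.inv₁ z.2 := by
        by_contra! h
        exact h1 ⟨hq, hy.le, by linarith⟩
      rw [min_eq_left h5] at e1
      refine Prod.ext ?_ ?_
      · simp only [Prod.fst_sub]; linarith
      · simp [e2]

lemma continuousOn_path (hp₂ : 0 < p₂) (hz : z ∈ quadrant) :
    ContinuousOn (ξ.path z) (Ici 0) := by
  have h1 : Continuous fun t : ℝ => min (z.2 + p₂ * t) ξ.ybar := by fun_prop
  have h2 : ContinuousOn (fun t : ℝ => ξ.inv₁ (min (z.2 + p₂ * t) ξ.ybar)) (Ici 0) :=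
    ξ.isBoundaryCurve₁.inv_continuousOn.comp h1.continuousOn fun t ht =>
      path_snd_mem (ξ := ξ) hp₂ hz ht
  unfold path
  fun_prop

end CurveData

/-! ### The explicit path obeys the strategy -/

/-- The fundamental theorem of calculus for a nonnegative derivative that exists off two points. -/
lemma integral_eq_sub_of_hasDerivAt_off_pair {f g : ℝ → ℝ} {S T t : ℝ} (hS : 0 ≤ S)
    (hST : S ≤ T) (ht : 0 ≤ t) (hf : ContinuousOn f (Icc 0 t))
    (hd : ∀ s ∈ Ioo 0 t, s ≠ S → s ≠ T → HasDerivAt f (g s) s) (hg : ∀ s, 0 ≤ g s) :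
    IntervalIntegrable g volume 0 t ∧ ∫ s in (0 : ℝ)..t, g s = f t - f 0 := by
  have key : ∀ a b, 0 ≤ a → a ≤ b → b ≤ t → (∀ s ∈ Ioo a b, s ≠ S ∧ s ≠ T) →
      IntervalIntegrable g volume a b ∧ ∫ s in a..b, g s = f b - f a := by
    intro a b ha hab hb hne
    have hc : ContinuousOn f (Icc a b) := hf.mono (Icc_subset_Icc ha hb)
    have hd' : ∀ s ∈ Ioo a b, HasDerivAt f (g s) s := fun s hs =>
      hd s ⟨ha.trans_lt hs.1, hs.2.trans_le hb⟩ (hne s hs).1 (hne s hs).2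
    have hi : IntervalIntegrable g volume a b := by
      rw [intervalIntegrable_iff_integrableOn_Ioc_of_le hab]
      -- Integrability comes for free from the sign of the derivative, so no regularity of the rates
      -- along the path is needed.
      exact intervalIntegral.integrableOn_deriv_of_nonneg hc hd' fun s _ => hg s
    exact ⟨hi, intervalIntegral.integral_eq_sub_of_hasDerivAt_of_le hab hc hd' hi⟩
  -- The break points are truncated at `t`, so that some of the three intervals may degenerate and
  -- no case distinction on the position of `t` is needed.
  obtain ⟨i1, e1⟩ := key 0 (min S t) le_rfl (le_min hS ht) (min_le_right _ _) fun s hs => by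
    have := lt_min_iff.1 hs.2
    exact ⟨this.1.ne, (this.1.trans_le hST).ne⟩
  obtain ⟨i2, e2⟩ := key (min S t) (min T t) (le_min hS ht) (min_le_min_right _ hST)
    (min_le_right _ _) fun s hs => by
    have := lt_min_iff.1 hs.2
    refine ⟨fun h => ?_, this.1.ne⟩
    have h1 := hs.1
    rw [← h, min_eq_left this.2.le] at h1
    exact lt_irrefl _ h1
  obtain ⟨i3, e3⟩ := key (min T t) t (le_min (hS.trans hST) ht) (min_le_right _ _) le_rfl
    fun s hs => by
    have hT : T < s := by
      rcases min_lt_iff.1 hs.1 with h | h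
      · exact h
      · exact absurd hs.2 h.not_gt
    exact ⟨(hST.trans_lt hT).ne', hT.ne'⟩
  refine ⟨(i1.trans i2).trans i3, ?_⟩
  rw [← intervalIntegral.integral_add_adjacent_intervals (i1.trans i2) i3,
    ← intervalIntegral.integral_add_adjacent_intervals i1 i2, e1, e2, e3]
  ring

namespace CurveData

variable {p₁ p₂ : ℝ} {ξ : CurveData p₁ p₂} {z : ℝ × ℝ}

variable (ξ) in
/-- The time at which the boundary curve of `ξ₁` is reached from `z`. -/
noncomputable def curveTime (z : ℝ × ℝ) : ℝ := (ξ.ξ₁ (z.1 - p₁ / p₂ * z.2) - z.2) / p₂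

variable (ξ) in
/-- The time at which the vertex is reached from `z`. -/
noncomputable def vertexTime (z : ℝ × ℝ) : ℝ := (ξ.ybar - z.2) / p₂

lemma IsBelow.intercept_mem (hz : ξ.IsBelow z) : z.1 - p₁ / p₂ * z.2 ∈ Icc ξ.ubar ξ.M₁ :=
  ⟨hz.ubar_le, hz.le_inv.trans (ξ.isBoundaryCurve₁.inv_mem hz.snd_mem).2⟩

lemma IsBelow.curveTime_nonneg (hp₂ : 0 < p₂) (hz : ξ.IsBelow z) : 0 ≤ ξ.curveTime z := by
  refine div_nonneg (sub_nonneg.2 ?_) hp₂.le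
  have h := ξ.isBoundaryCurve₁.strictAntiOn.antitoneOn hz.intercept_mem
    (ξ.isBoundaryCurve₁.inv_mem hz.snd_mem) hz.le_inv
  rwa [ξ.isBoundaryCurve₁.apply_inv hz.snd_mem] at h

lemma IsBelow.curveTime_le (hp₂ : 0 < p₂) (hz : ξ.IsBelow z) :
    ξ.curveTime z ≤ ξ.vertexTime z := by
  have h := (ξ.isBoundaryCurve₁.mapsTo hz.intercept_mem).2
  unfold curveTime vertexTime
  gcongr

lemma path_of_le (hp₂ : 0 < p₂) (hz : ξ.IsBelow z) {t : ℝ} (ht : 0 ≤ t)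
    (htS : t ≤ ξ.curveTime z) : ξ.path z t = (z.1 + p₁ * t, z.2 + p₂ * t) := by
  have h1 : z.2 + p₂ * t ≤ ξ.ξ₁ (z.1 - p₁ / p₂ * z.2) := by
    rw [curveTime, le_div_iff₀ hp₂] at htS
    linarith
  have hm := ξ.isBoundaryCurve₁.mapsTo hz.intercept_mem
  have h2 : z.2 + p₂ * t ≤ ξ.ybar := h1.trans hm.2
  have h3 : z.1 - p₁ / p₂ * z.2 ≤ ξ.inv₁ (z.2 + p₂ * t) := by
    have := ξ.isBoundaryCurve₁.inv_strictAntiOn.antitoneOn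
      ⟨add_nonneg hz.snd_mem.1 (by positivity), h2⟩ hm h1
    rwa [ξ.isBoundaryCurve₁.inv_apply hz.intercept_mem] at this
  unfold path
  rw [min_eq_left h2, min_eq_left h3]
  ext
  · simp only
    field_simp
    ring
  · rfl

lemma inv_lt_of_lt (hp₂ : 0 < p₂) (hz : ξ.IsBelow z) {t : ℝ} (ht : 0 ≤ t)
    (htS : t < ξ.curveTime z) : z.1 - p₁ / p₂ * z.2 < ξ.inv₁ (z.2 + p₂ * t) := by
  have h1 : z.2 + p₂ * t < ξ.ξ₁ (z.1 - p₁ / p₂ * z.2) := by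
    rw [curveTime, lt_div_iff₀ hp₂] at htS
    linarith
  have hm := ξ.isBoundaryCurve₁.mapsTo hz.intercept_mem
  have := ξ.isBoundaryCurve₁.inv_strictAntiOn
    ⟨add_nonneg hz.snd_mem.1 (by positivity), h1.le.trans hm.2⟩ hm h1
  rwa [ξ.isBoundaryCurve₁.inv_apply hz.intercept_mem] at this

lemma path_of_mem_Icc (hp₂ : 0 < p₂) (hz : ξ.IsBelow z) {t : ℝ}
    (ht : t ∈ Icc (ξ.curveTime z) (ξ.vertexTime z)) :
    ξ.path z t = (ξ.inv₁ (z.2 + p₂ * t) + p₁ / p₂ * (z.2 + p₂ * t), z.2 + p₂ * t) := by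
  have h2 : z.2 + p₂ * t ≤ ξ.ybar := by
    have := ht.2
    rw [vertexTime, le_div_iff₀ hp₂] at this
    linarith
  have h1 : ξ.ξ₁ (z.1 - p₁ / p₂ * z.2) ≤ z.2 + p₂ * t := by
    have := ht.1
    rw [curveTime, div_le_iff₀ hp₂] at this
    linarith
  have hm := ξ.isBoundaryCurve₁.mapsTo hz.intercept_mem
  have h3 : ξ.inv₁ (z.2 + p₂ * t) ≤ z.1 - p₁ / p₂ * z.2 := by
    have := ξ.isBoundaryCurve₁.inv_strictAntiOn.antitoneOn hm ⟨hm.1.trans h1, h2⟩ h1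
    rwa [ξ.isBoundaryCurve₁.inv_apply hz.intercept_mem] at this
  unfold path
  rw [min_eq_left h2, min_eq_right h3]

lemma path_of_ge (hp₂ : 0 < p₂) (hz : ξ.IsBelow z) {t : ℝ} (ht : ξ.vertexTime z ≤ t) :
    ξ.path z t = (ξ.xbar, ξ.ybar) := by
  have h2 : ξ.ybar ≤ z.2 + p₂ * t := by
    rw [vertexTime, div_le_iff₀ hp₂] at ht
    linarith
  unfold path
  rw [min_eq_right h2, inv₁_ybar, min_eq_right hz.ubar_le, ← xbar_eq]

lemma rate_vertex : ξ.rate (ξ.xbar, ξ.ybar) = (p₁, p₂) := by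
  unfold rate
  rw [if_pos (by rfl)]

/-- Premiums minus surplus are the dividends paid. They are constant before the curve is reached;
along the curve the derivative of `inv₁` produces the rate `-p₂ / ξ₁'`; at the vertex all premiums
are paid out. Only the two transition times are excluded. -/
lemma hasDerivAt_path (hp₁ : 0 < p₁) (hp₂ : 0 < p₂) (hz : ξ.IsBelow z) {t : ℝ} (ht : 0 < t)
    (htS : t ≠ ξ.curveTime z) (htT : t ≠ ξ.vertexTime z) :
    HasDerivAt (fun s => z.1 + p₁ * s - (ξ.path z s).1) (ξ.rate (ξ.path z t)).1 t ∧
    HasDerivAt (fun s => z.2 + p₂ * s - (ξ.path z s).2) (ξ.rate (ξ.path z t)).2 t := by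
  rcases htS.lt_or_gt with hS | hS
  · have hr : ξ.rate (ξ.path z t) = 0 := by
      rw [path_of_le hp₂ hz ht.le hS.le]
      have e : z.1 + p₁ * t - p₁ / p₂ * (z.2 + p₂ * t) = z.1 - p₁ / p₂ * z.2 := by
        field_simp; ring
      refine rate_eq_zero hp₁ hp₂ ?_ ?_
      · simp only [e]; exact hz.ubar_le
      · simp only [e]; exact inv_lt_of_lt hp₂ hz ht.le hS
    have he : ∀ᶠ s in 𝓝 t, ξ.path z s = (z.1 + p₁ * s, z.2 + p₂ * s) := by
      filter_upwards [Icc_mem_nhds ht hS] with s hs using path_of_le hp₂ hz hs.1 hs.2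
    rw [hr]
    constructor
    · refine (hasDerivAt_const t (0 : ℝ)).congr_of_eventuallyEq ?_
      filter_upwards [he] with s hs
      rw [hs]; simp
    · refine (hasDerivAt_const t (0 : ℝ)).congr_of_eventuallyEq ?_
      filter_upwards [he] with s hs
      rw [hs]; simp
  rcases htT.lt_or_gt with hT | hT
  · have he : ∀ᶠ s in 𝓝 t, ξ.path z s
        = (ξ.inv₁ (z.2 + p₂ * s) + p₁ / p₂ * (z.2 + p₂ * s), z.2 + p₂ * s) := by
      filter_upwards [Icc_mem_nhds hS hT] with s hs using path_of_mem_Icc hp₂ hz hs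
    have hy : z.2 + p₂ * t ∈ Ioo 0 ξ.ybar := by
      refine ⟨add_pos_of_nonneg_of_pos hz.snd_mem.1 (by positivity), ?_⟩
      rw [vertexTime, lt_div_iff₀ hp₂] at hT
      linarith
    have hI := ξ.isBoundaryCurve₁.inv_mem_Ioo hy
    have hA₁ : (ξ.inv₁ (z.2 + p₂ * t) + p₁ / p₂ * (z.2 + p₂ * t), z.2 + p₂ * t) ∈ ξ.setA₁ := by
      refine ⟨ξ.inv₁ (z.2 + p₂ * t), Ioo_subset_Ioc_self hI, ?_⟩
      have : ξ.ξ₁ (ξ.inv₁ (z.2 + p₂ * t)) = z.2 + p₂ * t :=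
        ξ.isBoundaryCurve₁.apply_inv (Ioo_subset_Icc_self hy)
      simp [this]
    have hA₀ : (ξ.inv₁ (z.2 + p₂ * t) + p₁ / p₂ * (z.2 + p₂ * t), z.2 + p₂ * t) ∉ ξ.setA₀ :=
      fun h => hy.2.ne (congrArg Prod.snd h)
    have hd : HasDerivAt (fun s => ξ.inv₁ (z.2 + p₂ * s))
        ((derivWithin ξ.ξ₁ (Icc ξ.ubar ξ.M₁) (ξ.inv₁ (z.2 + p₂ * t)))⁻¹ * p₂) t := by
      refine HasDerivAt.comp t (ξ.isBoundaryCurve₁.inv_hasDerivAt hy) ?_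
      simpa using ((hasDerivAt_id t).const_mul p₂).const_add z.2
    rw [he.self_of_nhds]
    unfold rate
    rw [if_neg hA₀, if_pos hA₁]
    constructor
    · have := (hd.const_sub (z.1 - p₁ / p₂ * z.2)).congr_of_eventuallyEq
        (f₁ := fun s => z.1 + p₁ * s - (ξ.path z s).1) (by
          filter_upwards [he] with s hs
          rw [hs]
          field_simp
          ring)
      convert! this using 1
      simp only [add_sub_cancel_right]
      ring
    · refine (hasDerivAt_const t (0 : ℝ)).congr_of_eventuallyEq ?_
      filter_upwards [he] with s hs
      rw [hs]; simp
  · have he : ∀ᶠ s in 𝓝 t, ξ.path z s = (ξ.xbar, ξ.ybar) := by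
      filter_upwards [Ici_mem_nhds hT] with s hs using path_of_ge hp₂ hz hs
    rw [he.self_of_nhds, rate_vertex]
    constructor
    · have := (((hasDerivAt_id t).const_mul p₁).const_add z.1).sub_const ξ.xbar
      rw [mul_one] at this
      refine this.congr_of_eventuallyEq ?_
      filter_upwards [he] with s hs
      rw [hs]; simp
    · have := (((hasDerivAt_id t).const_mul p₂).const_add z.2).sub_const ξ.ybar
      rw [mul_one] at this
      refine this.congr_of_eventuallyEq ?_
      filter_upwards [he] with s hs
      rw [hs]; simp

lemma fst_intervalIntegral {f : ℝ → ℝ × ℝ} {a b : ℝ} (hf : IntervalIntegrable f volume a b) :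
    (∫ s in a..b, f s).1 = ∫ s in a..b, (f s).1 :=
  ((ContinuousLinearMap.fst ℝ ℝ ℝ).intervalIntegral_comp_comm hf).symm

lemma snd_intervalIntegral {f : ℝ → ℝ × ℝ} {a b : ℝ} (hf : IntervalIntegrable f volume a b) :
    (∫ s in a..b, f s).2 = ∫ s in a..b, (f s).2 :=
  ((ContinuousLinearMap.snd ℝ ℝ ℝ).intervalIntegral_comp_comm hf).symm

lemma integral_rate_path (hp₁ : 0 < p₁) (hp₂ : 0 < p₂) (hz : z ∈ ξ.regionO₁) {t : ℝ}
    (ht : 0 ≤ t) :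
    IntervalIntegrable (fun s => ξ.rate (ξ.path z s)) volume 0 t ∧
    ξ.path z t = z + t • (p₁, p₂) - (ξ.lump z + ∫ s in (0 : ℝ)..t, ξ.rate (ξ.path z s)) := by
  -- The surplus just after the lump sums satisfies `IsBelow`, as the phase-by-phase formulas
  -- require.
  set z' := ξ.path z 0 with hz'
  have hb : ξ.IsBelow z' := isBelow_path hp₁ hp₂ hz le_rfl
  have hS := hb.curveTime_nonneg hp₂
  have hST := hb.curveTime_le hp₂
  have hc : ContinuousOn (ξ.path z') (Icc 0 t) :=
    (continuousOn_path hp₂ hb.mem_quadrant).mono Icc_subset_Ici_self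
  obtain ⟨i1, e1⟩ := integral_eq_sub_of_hasDerivAt_off_pair hS hST ht
    (f := fun s => z'.1 + p₁ * s - (ξ.path z' s).1)
    ((by fun_prop : Continuous fun s => z'.1 + p₁ * s).continuousOn.sub hc.fst)
    (fun s hs h1 h2 => (hasDerivAt_path hp₁ hp₂ hb hs.1 h1 h2).1)
    fun s => (rate_nonneg hp₁ hp₂ _).1
  obtain ⟨i2, e2⟩ := integral_eq_sub_of_hasDerivAt_off_pair hS hST ht
    (f := fun s => z'.2 + p₂ * s - (ξ.path z' s).2)
    ((by fun_prop : Continuous fun s => z'.2 + p₂ * s).continuousOn.sub hc.snd)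
    (fun s hs h1 h2 => (hasDerivAt_path hp₁ hp₂ hb hs.1 h1 h2).2)
    fun s => (rate_nonneg hp₁ hp₂ _).2
  have hi : IntervalIntegrable (fun s => ξ.rate (ξ.path z' s)) volume 0 t := by
    rw [intervalIntegrable_iff] at *
    exact i1.prodMk i2
  have hpp : ∀ s, 0 ≤ s → ξ.path z' s = ξ.path z s := fun s hs => path_path hp₂ hz hs
  have hEq : EqOn (fun s => ξ.rate (ξ.path z' s)) (fun s => ξ.rate (ξ.path z s)) (uIcc 0 t) := by
    intro s hs
    rw [uIcc_of_le ht] at hs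
    simp only [hpp s hs.1]
  have hi' : IntervalIntegrable (fun s => ξ.rate (ξ.path z s)) volume 0 t :=
    hi.congr (hEq.mono uIoc_subset_uIcc)
  refine ⟨hi', ?_⟩
  rw [← intervalIntegral.integral_congr hEq]
  have h0 : z' = z - ξ.lump z := path_zero hp₁ hp₂ hz
  have h00 : ξ.path z' 0 = z' := by rw [hpp 0 le_rfl]
  rw [h00] at e1 e2
  rw [hpp t ht] at e1 e2
  rw [← fst_intervalIntegral hi] at e1
  rw [← snd_intervalIntegral hi] at e2
  have h1 : z'.1 = z.1 - (ξ.lump z).1 := by rw [h0]; rfl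
  have h2 : z'.2 = z.2 - (ξ.lump z).2 := by rw [h0]; rfl
  refine Prod.ext ?_ ?_
  · simp only [Prod.fst_sub, Prod.fst_add, Prod.smul_fst, smul_eq_mul]
    linarith
  · simp only [Prod.snd_sub, Prod.snd_add, Prod.smul_snd, smul_eq_mul]
    linarith

/-! ### Uniqueness of the path that follows the strategy -/

variable (ξ) in
/-- The surplus path `Z`, started in `z`, follows the curve strategy before time `τ`. -/
def Follows (z : ℝ × ℝ) (τ : ℝ) (Z : ℝ → ℝ × ℝ) : Prop :=
  ∀ t, 0 < t → t < τ → Z t ∈ ξ.setC ∪ ξ.setA ∧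
    IntervalIntegrable (fun s => ξ.rate (Z s)) volume 0 t ∧
    Z t = z + t • (p₁, p₂) - (ξ.lump z + ∫ s in (0 : ℝ)..t, ξ.rate (Z s))

lemma follows_path (hp₁ : 0 < p₁) (hp₂ : 0 < p₂) (hz : z ∈ ξ.regionO₁) (τ : ℝ) :
    ξ.Follows z τ (ξ.path z) := fun _ ht _ =>
  ⟨(isBelow_path hp₁ hp₂ hz ht.le).mem hp₁ hp₂, integral_rate_path hp₁ hp₂ hz ht.le⟩

/-- With cumulative continuous payments `A` and `B`, the intercept is `u = u 0 - A + (p₁/p₂) B`.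
Height and intercept are each squeezed between the two bounds that define `path`: the upper bounds
come from staying in `C ∪ A` and from monotonicity, the lower bounds from the vanishing of the rates
off the boundary. -/
lemma Follows.eq_path (hp₁ : 0 < p₁) (hp₂ : 0 < p₂) (hz : z ∈ ξ.regionO₁) {τ : ℝ}
    {Z : ℝ → ℝ × ℝ} (hZ : ξ.Follows z τ Z) {b : ℝ} (hb : 0 < b) (hbτ : b < τ) :
    Z b = ξ.path z b := by
  obtain ⟨-, hi, -⟩ := hZ b hb hbτ
  set ρ := fun s => ξ.rate (Z s) with hρ
  set z' := ξ.path z 0 with hz'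
  have hbel : ξ.IsBelow z' := isBelow_path hp₁ hp₂ hz le_rfl
  have h0 : z' = z - ξ.lump z := path_zero hp₁ hp₂ hz
  have hi1 : IntervalIntegrable (fun s => (ρ s).1) volume 0 b := by
    rw [intervalIntegrable_iff] at *; exact hi.fst
  have hi2 : IntervalIntegrable (fun s => (ρ s).2) volume 0 b := by
    rw [intervalIntegrable_iff] at *; exact hi.snd
  set A : ℝ → ℝ := fun t => ∫ s in (0 : ℝ)..t, (ρ s).1 with hA
  set B : ℝ → ℝ := fun t => ∫ s in (0 : ℝ)..t, (ρ s).2 with hB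
  have hsub : ∀ t ∈ Icc 0 b, uIcc 0 t ⊆ uIcc 0 b := fun t ht => by
    rw [uIcc_of_le ht.1, uIcc_of_le hb.le]; exact Icc_subset_Icc_right ht.2
  have hAc : ContinuousOn A (Icc 0 b) := by
    have := intervalIntegral.continuousOn_primitive_interval' hi1 left_mem_uIcc
    rwa [uIcc_of_le hb.le] at this
  have hBc : ContinuousOn B (Icc 0 b) := by
    have := intervalIntegral.continuousOn_primitive_interval' hi2 left_mem_uIcc
    rwa [uIcc_of_le hb.le] at this
  have hAsub : ∀ s t, 0 ≤ s → s ≤ t → t ≤ b → A t - A s = ∫ r in s..t, (ρ r).1 :=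
    fun s t hs hst ht => intervalIntegral.integral_interval_sub_left
      (hi1.mono_set (hsub t ⟨hs.trans hst, ht⟩)) (hi1.mono_set (hsub s ⟨hs, hst.trans ht⟩))
  have hBsub : ∀ s t, 0 ≤ s → s ≤ t → t ≤ b → B t - B s = ∫ r in s..t, (ρ r).2 :=
    fun s t hs hst ht => intervalIntegral.integral_interval_sub_left
      (hi2.mono_set (hsub t ⟨hs.trans hst, ht⟩)) (hi2.mono_set (hsub s ⟨hs, hst.trans ht⟩))
  have hi1' : ∀ s t, 0 ≤ s → s ≤ t → t ≤ b → IntervalIntegrable (fun s => (ρ s).1) volume s t :=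
    fun s t hs hst ht => hi1.mono_set (by
      rw [uIcc_of_le hst, uIcc_of_le hb.le]; exact Icc_subset_Icc hs ht)
  have hi2' : ∀ s t, 0 ≤ s → s ≤ t → t ≤ b → IntervalIntegrable (fun s => (ρ s).2) volume s t :=
    fun s t hs hst ht => hi2.mono_set (by
      rw [uIcc_of_le hst, uIcc_of_le hb.le]; exact Icc_subset_Icc hs ht)
  have hAmono : ∀ s t, 0 ≤ s → s ≤ t → t ≤ b → A s ≤ A t := fun s t hs hst ht => by
    rw [← sub_nonneg, hAsub s t hs hst ht]
    exact intervalIntegral.integral_nonneg hst fun r _ => (rate_nonneg hp₁ hp₂ _).1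
  have hBmono : ∀ s t, 0 ≤ s → s ≤ t → t ≤ b → B s ≤ B t := fun s t hs hst ht => by
    rw [← sub_nonneg, hBsub s t hs hst ht]
    exact intervalIntegral.integral_nonneg hst fun r _ => (rate_nonneg hp₁ hp₂ _).2
  have hA0 : A 0 = 0 := intervalIntegral.integral_same
  have hB0 : B 0 = 0 := intervalIntegral.integral_same
  set X : ℝ → ℝ := fun t => z'.1 + p₁ * t - A t with hX
  set Y : ℝ → ℝ := fun t => z'.2 + p₂ * t - B t with hY
  have hXZ : ∀ t, 0 < t → t ≤ b → (Z t).1 = X t ∧ (Z t).2 = Y t := fun t ht htb => by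
    obtain ⟨-, hit, e⟩ := hZ t ht (htb.trans_lt hbτ)
    have e1 := congrArg Prod.fst e
    have e2 := congrArg Prod.snd e
    simp only [Prod.fst_sub, Prod.fst_add, Prod.smul_fst, smul_eq_mul] at e1
    simp only [Prod.snd_sub, Prod.snd_add, Prod.smul_snd, smul_eq_mul] at e2
    rw [fst_intervalIntegral hit] at e1
    rw [snd_intervalIntegral hit] at e2
    have h1 : z'.1 = z.1 - (ξ.lump z).1 := by rw [h0]; rfl
    have h2 : z'.2 = z.2 - (ξ.lump z).2 := by rw [h0]; rfl
    refine ⟨?_, ?_⟩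
    · simp only [hX, hA, hρ]; linarith
    · simp only [hY, hB, hρ]; linarith
  set u : ℝ → ℝ := fun t => X t - p₁ / p₂ * Y t with hu
  have hueq : ∀ t, u t = z'.1 - p₁ / p₂ * z'.2 - A t + p₁ / p₂ * B t := fun t => by
    simp only [hu, hX, hY]; field_simp; ring
  have hZu : ∀ t, 0 < t → t ≤ b → (Z t).1 - p₁ / p₂ * (Z t).2 = u t := fun t ht htb => by
    rw [(hXZ t ht htb).1, (hXZ t ht htb).2]
  have huc : ContinuousOn u (Icc 0 b) := by fun_prop
  have hYc : ContinuousOn Y (Icc 0 b) := by fun_prop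
  have hr : 0 < p₁ / p₂ := div_pos hp₁ hp₂
  -- the path does not cross the line through the vertex
  have hubar : ∀ t ∈ Icc 0 b, 0 ≤ u t - ξ.ubar := by
    refine nonneg_of_le_of_neg_on_Ioc (by fun_prop) ?_ ?_
    · rw [hueq, hA0, hB0]
      linarith [hbel.ubar_le]
    -- Where `u < ubar` Company One pays nothing, and payments by Company Two can only raise `u`.
    · intro s t hs hst ht hneg
      have hz1 : A t - A s = 0 := by
        rw [hAsub s t hs hst.le ht]
        refine intervalIntegral.integral_zero_ae (Eventually.of_forall fun r hr => ?_)
        rw [uIoc_of_le hst.le] at hr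
        refine rate_fst_of_lt ?_
        rw [hZu r (hs.trans_lt hr.1) (hr.2.trans ht)]
        linarith [hneg r hr]
      have := mul_le_mul_of_nonneg_left (hBmono s t hs hst.le ht) hr.le
      rw [hueq, hueq]
      linarith
  have hbelow : ∀ t, 0 < t → t ≤ b → ξ.IsBelow (Z t) := fun t ht htb => by
    refine isBelow_of_mem hp₁ hp₂ (hZ t ht (htb.trans_lt hbτ)).1 ?_
    rw [hZu t ht htb]
    linarith [hubar t ⟨ht.le, htb⟩]
  have hY0 : Y 0 = z'.2 := by simp [hY, hB0]
  have hYle : ∀ t ∈ Icc 0 b, Y t ≤ min (z'.2 + p₂ * t) ξ.ybar := by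
    intro t ht
    refine le_min ?_ ?_
    · have := hBmono 0 t le_rfl ht.1 ht.2
      simp only [hY]
      linarith
    · rcases ht.1.eq_or_lt with rfl | h
      · rw [hY0]; exact hbel.snd_mem.2
      · rw [← (hXZ t h ht.2).2]; exact (hbelow t h ht.2).snd_mem.2
  -- While the height is below the cap, hence below `ybar`, Company Two pays nothing and the height
  -- grows at the full rate `p₂`, at least as fast as the cap.
  have hYge : ∀ t ∈ Icc 0 b, 0 ≤ Y t - min (z'.2 + p₂ * t) ξ.ybar := by
    refine nonneg_of_le_of_neg_on_Ioc (by fun_prop) ?_ ?_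
    · rw [hY0, mul_zero, add_zero, min_eq_left hbel.snd_mem.2, sub_self]
    · intro s t hs hst ht hneg
      have hz2 : B t - B s = 0 := by
        rw [hBsub s t hs hst.le ht]
        refine intervalIntegral.integral_zero_ae (Eventually.of_forall fun r hr => ?_)
        rw [uIoc_of_le hst.le] at hr
        have hr0 := hs.trans_lt hr.1
        refine rate_snd_of_ne hp₁ hp₂ (hbelow r hr0 (hr.2.trans ht)).ubar_le ?_
        rw [(hXZ r hr0 (hr.2.trans ht)).2]
        have h1 := hneg r hr
        have h2 := min_le_right (z'.2 + p₂ * r) ξ.ybar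
        exact (by linarith : Y r < ξ.ybar).ne
      have h1 : min (z'.2 + p₂ * t) ξ.ybar ≤ min (z'.2 + p₂ * s) ξ.ybar + p₂ * (t - s) := by
        rw [← min_add_add_right]
        refine min_le_min (by linarith) ?_
        have := mul_nonneg hp₂.le (sub_nonneg.2 hst.le)
        linarith
      simp only [hY]
      linarith
  have hYeq : ∀ t ∈ Icc 0 b, Y t = (ξ.path z' t).2 := fun t ht => by
    rw [path_snd]
    exact le_antisymm (hYle t ht) (by linarith [hYge t ht])
  have hYmem : ∀ t ∈ Icc 0 b, Y t ∈ Icc 0 ξ.ybar := fun t ht => by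
    rw [hYeq t ht]
    exact path_snd_mem hp₂ hbel.mem_quadrant ht.1
  have hinvc : ContinuousOn (fun t => ξ.inv₁ (Y t)) (Icc 0 b) :=
    ξ.isBoundaryCurve₁.inv_continuousOn.comp hYc hYmem
  have huanti : ∀ s t, 0 ≤ s → s ≤ t → t ≤ b → u t ≤ u s := fun s t hs hst ht => by
    rw [hueq, hueq]
    have h1 : p₁ / p₂ * (B t - B s) ≤ A t - A s := by
      rw [hAsub s t hs hst ht, hBsub s t hs hst ht, ← intervalIntegral.integral_const_mul]
      refine intervalIntegral.integral_mono_on_of_le_Ioo hst ((hi2' s t hs hst ht).const_mul _)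
        (hi1' s t hs hst ht) fun r hr => rate_snd_le hp₁ hp₂ ?_
      exact (hbelow r (hs.trans_lt hr.1) (hr.2.le.trans ht)).ubar_le
    linarith
  have hu0 : u 0 = z'.1 - p₁ / p₂ * z'.2 := by rw [hueq, hA0, hB0]; ring
  have hule : ∀ t ∈ Icc 0 b, u t ≤ min (u 0) (ξ.inv₁ (Y t)) := fun t ht => by
    refine le_min (huanti 0 t le_rfl ht.1 ht.2) ?_
    rcases ht.1.eq_or_lt with rfl | h
    · rw [hu0, hY0]; exact hbel.le_inv
    · rw [← hZu t h ht.2, ← (hXZ t h ht.2).2]; exact (hbelow t h ht.2).le_inv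
  -- Strictly inside the curve nobody pays: `u` is constant while the height rises, so `inv₁ (Y t)`
  -- and with it the bound falls towards `u`.
  have huge : ∀ t ∈ Icc 0 b, 0 ≤ u t - min (u 0) (ξ.inv₁ (Y t)) := by
    refine nonneg_of_le_of_neg_on_Ioc (by fun_prop) ?_ ?_
    · have := min_le_left (u 0) (ξ.inv₁ (Y 0))
      linarith
    · intro s t hs hst ht hneg
      have hzero : ∀ r ∈ Ioc s t, ρ r = 0 := fun r hr => by
        have hr0 := hs.trans_lt hr.1
        refine rate_eq_zero hp₁ hp₂ (hbelow r hr0 (hr.2.trans ht)).ubar_le ?_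
        rw [hZu r hr0 (hr.2.trans ht), (hXZ r hr0 (hr.2.trans ht)).2]
        have h1 := hneg r hr
        have h2 := min_le_right (u 0) (ξ.inv₁ (Y r))
        linarith
      have hz1 : A t - A s = 0 := by
        rw [hAsub s t hs hst.le ht]
        refine intervalIntegral.integral_zero_ae (Eventually.of_forall fun r hr => ?_)
        rw [uIoc_of_le hst.le] at hr
        rw [hzero r hr]; rfl
      have hz2 : B t - B s = 0 := by
        rw [hBsub s t hs hst.le ht]
        refine intervalIntegral.integral_zero_ae (Eventually.of_forall fun r hr => ?_)
        rw [uIoc_of_le hst.le] at hr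
        rw [hzero r hr]; rfl
      have h1 : u t = u s := by
        rw [hueq, hueq, sub_eq_zero.1 hz1, sub_eq_zero.1 hz2]
      have h2 : Y s ≤ Y t := by
        simp only [hY, sub_eq_zero.1 hz2]
        have := mul_le_mul_of_nonneg_left hst.le hp₂.le
        linarith
      have h3 : ξ.inv₁ (Y t) ≤ ξ.inv₁ (Y s) :=
        ξ.isBoundaryCurve₁.inv_strictAntiOn.antitoneOn (hYmem s ⟨hs, hst.le.trans ht⟩)
          (hYmem t ⟨hs.trans hst.le, ht⟩) h2
      have h4 := min_le_min_left (u 0) h3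
      linarith
  have hbb : b ∈ Icc 0 b := ⟨hb.le, le_rfl⟩
  rw [← path_path hp₂ hz hb.le]
  have e2 : (Z b).2 = (ξ.path z' b).2 := by rw [(hXZ b hb le_rfl).2, hYeq b hbb]
  refine Prod.ext ?_ e2
  have e3 := path_fst_sub (ξ := ξ) (z := z') b
  have e4 := hZu b hb le_rfl
  have e5 : u b = min (u 0) (ξ.inv₁ (Y b)) := le_antisymm (hule b hbb) (by linarith [huge b hbb])
  rw [hu0, hYeq b hbb] at e5
  rw [← e5, ← e2] at e3
  linarith

end CurveData

/-! ### The discounted value along the path -/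

/-- The exponential moment of an affine function over a half-line. -/
lemma integral_exp_mul_affine_Ioi {q A B T : ℝ} (hq : 0 < q) (hB : 0 ≤ B)
    (hAB : 0 ≤ A) :
    IntegrableOn (fun t => q * Real.exp (-q * t) * (A + B * (t - T))) (Ioi T) ∧
    ∫ t in Ioi T, q * Real.exp (-q * t) * (A + B * (t - T)) = Real.exp (-q * T) * (A + B / q) := by
  have hd : ∀ t, HasDerivAt (fun t => -(Real.exp (-q * t) * (A + B * (t - T) + B / q)))
      (q * Real.exp (-q * t) * (A + B * (t - T))) t := by
    intro t
    have h1 : HasDerivAt (fun t => Real.exp (-q * t)) (Real.exp (-q * t) * (-q)) t := by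
      simpa using ((hasDerivAt_id t).const_mul (-q)).exp
    have h2 : HasDerivAt (fun t => A + B * (t - T) + B / q) B t := by
      simpa using ((((hasDerivAt_id t).sub_const T).const_mul B).const_add A).add_const (B / q)
    have hBq : B / q * q = B := by field_simp
    convert! (h1.mul h2).neg using 1
    linear_combination (-Real.exp (-q * t)) * hBq
  have hpos : ∀ t ∈ Ioi T, 0 ≤ q * Real.exp (-q * t) * (A + B * (t - T)) := fun t ht => by
    have : 0 ≤ t - T := sub_nonneg.2 (le_of_lt ht)
    positivity
  -- The primitive is an affine function times a decaying exponential, hence vanishes at infinity.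
  have hlim : Tendsto (fun t => -(Real.exp (-q * t) * (A + B * (t - T) + B / q))) atTop (𝓝 0) := by
    have h1 : Tendsto (fun t : ℝ => q * t) atTop atTop := tendsto_id.const_mul_atTop hq
    have e0 : Tendsto (fun t : ℝ => Real.exp (-(q * t))) atTop (𝓝 0) :=
      Real.tendsto_exp_neg_atTop_nhds_zero.comp h1
    have e1 : Tendsto (fun t : ℝ => (q * t) ^ 1 * Real.exp (-(q * t))) atTop (𝓝 0) :=
      (Real.tendsto_pow_mul_exp_neg_atTop_nhds_zero 1).comp h1
    have := ((e0.mul_const (A - B * T + B / q)).add (e1.mul_const (B / q))).neg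
    simp only [zero_mul, add_zero, neg_zero] at this
    refine this.congr fun t => ?_
    rw [neg_mul]
    field_simp
    ring
  refine ⟨integrableOn_Ioi_deriv_of_nonneg' (fun t _ => hd t) hpos hlim, ?_⟩
  rw [integral_Ioi_of_hasDerivAt_of_nonneg' (fun t _ => hd t) hpos hlim]
  ring

namespace CurveData

variable {p₁ p₂ : ℝ} {ξ : CurveData p₁ p₂} {z : ℝ × ℝ}

variable (ξ) in
/-- The value on the boundary curve of `ξ₁` for the discount rate `q`, the weights `a₁`, `a₂` and the
running reward `h`. -/
noncomputable def curveValue (q a₁ a₂ : ℝ) (h : ℝ × ℝ → ℝ) (u : ℝ) : ℝ :=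
  Real.exp (q * ((ξ.ξ₁ u - ξ.ξ₁ ξ.ubar) / p₂)) *
      ((a₁ * p₁ + a₂ * p₂) / q + 1 / q * h (ξ.ubar + p₁ / p₂ * ξ.ξ₁ ξ.ubar, ξ.ξ₁ ξ.ubar))
    + Real.exp (q * (ξ.ξ₁ u / p₂)) * a₁ * (∫ w in ξ.ubar..u, Real.exp (-q * (ξ.ξ₁ w / p₂)))
    + Real.exp (q * (ξ.ξ₁ u / p₂)) / p₂ *
      (∫ t in ξ.ξ₁ u..ξ.ξ₁ ξ.ubar,
        h (ξ.inv₁ t + p₁ / p₂ * t, t) * Real.exp (-q * (t / p₂)))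

variable (ξ) in
/-- The discounted value of the dividends and of the running reward `h` along the path from `z`. -/
noncomputable def pathValue (q a₁ a₂ : ℝ) (h : ℝ × ℝ → ℝ) (z : ℝ × ℝ) : ℝ :=
  (∫ t in Ioi 0, q * Real.exp (-q * t) *
    (a₁ * (z.1 + p₁ * t - (ξ.path z t).1) + a₂ * (z.2 + p₂ * t - (ξ.path z t).2)))
    + ∫ t in Ioi 0, Real.exp (-q * t) * h (ξ.path z t)

lemma add_mul_mem (hp₂ : 0 < p₂) {t : ℝ}
    (ht : t ∈ Icc (ξ.curveTime z) (ξ.vertexTime z)) :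
    z.2 + p₂ * t ∈ Icc (ξ.ξ₁ (z.1 - p₁ / p₂ * z.2)) ξ.ybar := by
  have h1 := ht.1
  have h2 := ht.2
  rw [curveTime, div_le_iff₀ hp₂] at h1
  rw [vertexTime, le_div_iff₀ hp₂] at h2
  exact ⟨by linarith, by linarith⟩

lemma add_mul_curveTime (hp₂ : 0 < p₂) :
    z.2 + p₂ * ξ.curveTime z = ξ.ξ₁ (z.1 - p₁ / p₂ * z.2) := by
  rw [curveTime, mul_div_cancel₀ _ hp₂.ne']; ring

lemma add_mul_vertexTime (hp₂ : 0 < p₂) : z.2 + p₂ * ξ.vertexTime z = ξ.ybar := by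
  rw [vertexTime, mul_div_cancel₀ _ hp₂.ne']; ring

/-- Integration by parts for the dividends paid along the boundary curve. -/
lemma integral_dividends_curve (hp₂ : 0 < p₂) (hz : ξ.IsBelow z) (q : ℝ) :
    ∫ t in ξ.curveTime z..ξ.vertexTime z,
      q * Real.exp (-q * t) * (z.1 - p₁ / p₂ * z.2 - ξ.inv₁ (z.2 + p₂ * t))
    = (∫ w in ξ.ubar..z.1 - p₁ / p₂ * z.2, Real.exp (-q * ((ξ.ξ₁ w - z.2) / p₂)))
      - Real.exp (-q * ξ.vertexTime z) * (z.1 - p₁ / p₂ * z.2 - ξ.ubar) := by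
  set S := ξ.curveTime z with hS
  set T := ξ.vertexTime z with hT
  set u := z.1 - p₁ / p₂ * z.2 with hu
  have hξ := ξ.isBoundaryCurve₁
  have hST : S ≤ T := hz.curveTime_le hp₂
  set g : ℝ → ℝ := fun w => Real.exp (-q * ((ξ.ξ₁ w - z.2) / p₂)) with hg
  have hgc : ContinuousOn g (Icc ξ.ubar ξ.M₁) := by
    have := hξ.continuousOn
    fun_prop
  have hgi : IntervalIntegrable g volume ξ.ubar ξ.M₁ :=
    ContinuousOn.intervalIntegrable_of_Icc hξ.le hgc
  set G : ℝ → ℝ := fun c => ∫ w in ξ.ubar..c, g w with hG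
  have hGc : ContinuousOn G (Icc ξ.ubar ξ.M₁) := by
    have := intervalIntegral.continuousOn_primitive_interval' hgi left_mem_uIcc
    rwa [uIcc_of_le hξ.le] at this
  have hGd : ∀ c ∈ Ioo ξ.ubar ξ.M₁, HasDerivAt G (g c) c := fun c hc => by
    refine intervalIntegral.integral_hasDerivAt_right (hgi.mono_set ?_) ?_ ?_
    · rw [uIcc_of_le hc.1.le, uIcc_of_le hξ.le]
      exact Icc_subset_Icc_right hc.2.le
    · exact (hgc.mono Ioo_subset_Icc_self).stronglyMeasurableAtFilter isOpen_Ioo c hc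
    · exact hgc.continuousAt (Icc_mem_nhds hc.1 hc.2)
  have hmem : MapsTo (fun t => z.2 + p₂ * t) (Icc S T) (Icc 0 ξ.ybar) := fun t ht => by
    have := add_mul_mem hp₂ ht
    exact ⟨(hξ.mapsTo hz.intercept_mem).1.trans this.1, this.2⟩
  have hic : ContinuousOn (fun t => ξ.inv₁ (z.2 + p₂ * t)) (Icc S T) :=
    hξ.inv_continuousOn.comp (by fun_prop) hmem
  have hGi : ContinuousOn (fun t => G (ξ.inv₁ (z.2 + p₂ * t))) (Icc S T) :=
    hGc.comp hic fun t ht => hξ.inv_mem (hmem ht)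
  -- The primitive combines integration by parts with the substitution `w = inv₁ (y + p₂ t)`. Since
  -- the integrand of `G` equals `e^{-qt}` at that `w`, the two terms containing the derivative of
  -- `inv₁` cancel.
  have hFTC := intervalIntegral.integral_eq_sub_of_hasDerivAt_of_le hST
    (f := fun t => -(Real.exp (-q * t) * (u - ξ.inv₁ (z.2 + p₂ * t)))
      - G (ξ.inv₁ (z.2 + p₂ * t)))
    (f' := fun t => q * Real.exp (-q * t) * (u - ξ.inv₁ (z.2 + p₂ * t)))
    ((by fun_prop : ContinuousOn (fun t => -(Real.exp (-q * t) * (u - ξ.inv₁ (z.2 + p₂ * t))))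
      (Icc S T)).sub hGi) ?_
    (ContinuousOn.intervalIntegrable_of_Icc hST (by fun_prop))
  · rw [hFTC]
    have e1 : ξ.inv₁ (z.2 + p₂ * T) = ξ.ubar := by
      rw [hT, add_mul_vertexTime hp₂, inv₁_ybar]
    have e2 : ξ.inv₁ (z.2 + p₂ * S) = u := by
      rw [hS, add_mul_curveTime hp₂]
      exact hξ.inv_apply hz.intercept_mem
    rw [e1, e2]
    simp only [hG, intervalIntegral.integral_same]
    ring
  · intro t ht
    have hy : z.2 + p₂ * t ∈ Ioo 0 ξ.ybar := by
      have h1 := ht.1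
      have h2 := ht.2
      rw [hS, curveTime, div_lt_iff₀ hp₂] at h1
      rw [hT, vertexTime, lt_div_iff₀ hp₂] at h2
      have := (hξ.mapsTo hz.intercept_mem).1
      exact ⟨by linarith, by linarith⟩
    have hI := hξ.inv_mem_Ioo hy
    set D := (derivWithin ξ.ξ₁ (Icc ξ.ubar ξ.M₁) (ξ.inv₁ (z.2 + p₂ * t)))⁻¹ * p₂
    have hd : HasDerivAt (fun s => ξ.inv₁ (z.2 + p₂ * s)) D t := by
      refine HasDerivAt.comp t (hξ.inv_hasDerivAt hy) ?_
      simpa using ((hasDerivAt_id t).const_mul p₂).const_add z.2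
    have hd2 : HasDerivAt (fun s => G (ξ.inv₁ (z.2 + p₂ * s)))
        (g (ξ.inv₁ (z.2 + p₂ * t)) * D) t := HasDerivAt.comp t (hGd _ hI) hd
    have h1 : HasDerivAt (fun t => Real.exp (-q * t)) (Real.exp (-q * t) * (-q)) t := by
      simpa using ((hasDerivAt_id t).const_mul (-q)).exp
    have hgt : g (ξ.inv₁ (z.2 + p₂ * t)) = Real.exp (-q * t) := by
      have : ξ.ξ₁ (ξ.inv₁ (z.2 + p₂ * t)) = z.2 + p₂ * t :=
        hξ.apply_inv (Ioo_subset_Icc_self hy)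
      simp only [hg, this]
      congr 1
      field_simp
      ring
    convert! ((h1.mul (hd.const_sub u)).neg.sub hd2) using 1
    rw [hgt]
    ring

/-- Both integrals are split at the time `S` of reaching the curve and the time `T` of reaching the
vertex. Before `S` there are no dividends and the reward runs along a straight line; from `S` to `T`
the curve is followed; after `T` the surplus is constant and the dividends are affine in time. All
that happens after `S`, discounted back to `S`, is `curveValue`. -/
lemma pathValue_of_isBelow (hp₂ : 0 < p₂) (hp₁ : 0 < p₁) (hz : ξ.IsBelow z) {q a₁ a₂ : ℝ}
    (hq : 0 < q) (ha₁ : 0 ≤ a₁) (ha₂ : 0 ≤ a₂) {h : ℝ × ℝ → ℝ}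
    (hh : IntegrableOn (fun t => Real.exp (-q * t) * h (ξ.path z t)) (Ioi 0)) :
    ξ.pathValue q a₁ a₂ h z
      = Real.exp (-q * ξ.curveTime z) * ξ.curveValue q a₁ a₂ h (z.1 - p₁ / p₂ * z.2)
        + ∫ w in (0 : ℝ)..ξ.curveTime z,
            Real.exp (-q * w) * h (z.1 + p₁ * w, z.2 + p₂ * w) := by
  have hdiv := integral_dividends_curve hp₂ hz q
  have hξ := ξ.isBoundaryCurve₁
  have hS0 := hz.curveTime_nonneg hp₂
  have hST := hz.curveTime_le hp₂
  have hT0 := hS0.trans hST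
  have hub := hz.ubar_le
  have eS := add_mul_curveTime (ξ := ξ) (z := z) hp₂
  have eT := add_mul_vertexTime (ξ := ξ) (z := z) hp₂
  have pS : ∀ t, 0 ≤ t → t ≤ ξ.curveTime z → ξ.path z t = (z.1 + p₁ * t, z.2 + p₂ * t) :=
    fun t h1 h2 => path_of_le hp₂ hz h1 h2
  have pM : ∀ t ∈ Icc (ξ.curveTime z) (ξ.vertexTime z), ξ.path z t
      = (ξ.inv₁ (z.2 + p₂ * t) + p₁ / p₂ * (z.2 + p₂ * t), z.2 + p₂ * t) :=
    fun t ht => path_of_mem_Icc hp₂ hz ht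
  have pT : ∀ t, ξ.vertexTime z ≤ t → ξ.path z t = (ξ.xbar, ξ.ybar) :=
    fun t ht => path_of_ge hp₂ hz ht
  set S := ξ.curveTime z
  set T := ξ.vertexTime z
  set u := z.1 - p₁ / p₂ * z.2 with hu
  -- dividends
  set d : ℝ → ℝ := fun t => q * Real.exp (-q * t) *
    (a₁ * (z.1 + p₁ * t - (ξ.path z t).1) + a₂ * (z.2 + p₂ * t - (ξ.path z t).2)) with hd
  have hdc : ContinuousOn d (Ici 0) := by
    have hc := continuousOn_path (ξ := ξ) hp₂ hz.mem_quadrant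
    have h1 : ContinuousOn (fun t => z.1 + p₁ * t - (ξ.path z t).1) (Ici 0) :=
      (by fun_prop : Continuous fun t => z.1 + p₁ * t).continuousOn.sub hc.fst
    have h2 : ContinuousOn (fun t => z.2 + p₂ * t - (ξ.path z t).2) (Ici 0) :=
      (by fun_prop : Continuous fun t => z.2 + p₂ * t).continuousOn.sub hc.snd
    exact (by fun_prop : Continuous fun t => q * Real.exp (-q * t)).continuousOn.mul
      ((h1.const_mul a₁).add (h2.const_mul a₂))
  have hdI : ∀ a b, 0 ≤ a → a ≤ b → IntervalIntegrable d volume a b := fun a b ha hab =>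
    ContinuousOn.intervalIntegrable_of_Icc hab
      (hdc.mono fun t ht => ha.trans ht.1)
  have hp0 : 0 ≤ a₁ * p₁ + a₂ * p₂ := by positivity
  obtain ⟨iT, vT⟩ := integral_exp_mul_affine_Ioi (T := T) hq hp0
    (mul_nonneg ha₁ (sub_nonneg.2 hub))
  have hdT : EqOn (fun t => q * Real.exp (-q * t) *
      (a₁ * (u - ξ.ubar) + (a₁ * p₁ + a₂ * p₂) * (t - T))) d (Ioi T) := fun t ht => by
    have e1 : p₂ * T = ξ.ybar - z.2 := by linarith
    have e2 : p₁ * T = p₁ / p₂ * ξ.ybar - p₁ / p₂ * z.2 := by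
      rw [← mul_sub, ← e1]; field_simp
    simp only [hd, pT t (le_of_lt ht), xbar_eq]
    congr 1
    linear_combination (-a₁) * e2 - a₂ * e1
  rw [setIntegral_congr_fun measurableSet_Ioi hdT] at vT
  have iT' : IntegrableOn d (Ioi T) := iT.congr_fun hdT measurableSet_Ioi
  have i0 : IntegrableOn d (Ioi 0) := by
    rw [← Ioc_union_Ioi_eq_Ioi hT0]
    exact ((intervalIntegrable_iff_integrableOn_Ioc_of_le hT0).1 (hdI 0 T le_rfl hT0)).union iT'
  have vS : ∫ t in (0 : ℝ)..S, d t = 0 := by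
    rw [intervalIntegral.integral_congr (g := fun _ => 0), intervalIntegral.integral_zero]
    intro t ht
    rw [uIcc_of_le hS0] at ht
    simp [hd, pS t ht.1 ht.2]
  have vM : ∫ t in S..T, d t
      = a₁ * ∫ t in S..T, q * Real.exp (-q * t) * (u - ξ.inv₁ (z.2 + p₂ * t)) := by
    rw [← intervalIntegral.integral_const_mul]
    refine intervalIntegral.integral_congr fun t ht => ?_
    rw [uIcc_of_le hST] at ht
    have : z.1 + p₁ * t - (ξ.inv₁ (z.2 + p₂ * t) + p₁ / p₂ * (z.2 + p₂ * t))
        = u - ξ.inv₁ (z.2 + p₂ * t) := by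
      rw [hu]; field_simp; ring
    simp only [hd, pM t ht, this]
    ring
  have hdtot : ∫ t in Ioi 0, d t = a₁ * (∫ w in ξ.ubar..u,
      Real.exp (-q * ((ξ.ξ₁ w - z.2) / p₂)))
      + Real.exp (-q * T) * ((a₁ * p₁ + a₂ * p₂) / q) := by
    rw [← intervalIntegral.integral_interval_add_Ioi i0 iT',
      ← intervalIntegral.integral_add_adjacent_intervals (hdI 0 S le_rfl hS0) (hdI S T hS0 hST),
      vS, vM, hdiv, vT]
    ring
  -- running reward
  set f : ℝ → ℝ := fun t => Real.exp (-q * t) * h (ξ.path z t) with hf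
  have hfI : ∀ a b, 0 ≤ a → a ≤ b → IntervalIntegrable f volume a b := fun a b ha hab => by
    rw [intervalIntegrable_iff_integrableOn_Ioc_of_le hab]
    exact hh.mono_set fun t ht => ha.trans_lt ht.1
  have wS : ∫ t in (0 : ℝ)..S, f t
      = ∫ w in (0 : ℝ)..S, Real.exp (-q * w) * h (z.1 + p₁ * w, z.2 + p₂ * w) := by
    refine intervalIntegral.integral_congr fun t ht => ?_
    rw [uIcc_of_le hS0] at ht
    simp only [hf, pS t ht.1 ht.2]
  -- Along the curve, time is replaced by the height `y + p₂ t`.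
  have wM : ∫ t in S..T, f t = Real.exp (q * (z.2 / p₂)) / p₂ *
      ∫ t in ξ.ξ₁ u..ξ.ybar, h (ξ.inv₁ t + p₁ / p₂ * t, t) * Real.exp (-q * (t / p₂)) := by
    have := intervalIntegral.integral_comp_add_mul (a := S) (b := T)
      (fun t => Real.exp (q * (z.2 / p₂)) *
        (h (ξ.inv₁ t + p₁ / p₂ * t, t) * Real.exp (-q * (t / p₂)))) hp₂.ne' z.2
    simp only [eS, eT] at this
    rw [intervalIntegral.integral_const_mul, intervalIntegral.integral_const_mul,
      smul_eq_mul] at this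
    have e : Real.exp (q * (z.2 / p₂)) / p₂ *
        (∫ t in ξ.ξ₁ u..ξ.ybar, h (ξ.inv₁ t + p₁ / p₂ * t, t) * Real.exp (-q * (t / p₂)))
        = p₂⁻¹ * (Real.exp (q * (z.2 / p₂)) *
        (∫ t in ξ.ξ₁ u..ξ.ybar, h (ξ.inv₁ t + p₁ / p₂ * t, t) * Real.exp (-q * (t / p₂)))) := by
      ring
    rw [e, ← this, ← intervalIntegral.integral_const_mul]
    refine intervalIntegral.integral_congr fun t ht => ?_
    rw [uIcc_of_le hST] at ht
    simp only [hf, pM t ht]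
    have e2 : Real.exp (-q * t)
        = Real.exp (q * (z.2 / p₂)) * Real.exp (-q * ((z.2 + p₂ * t) / p₂)) := by
      rw [← Real.exp_add]
      congr 1
      field_simp
      ring
    rw [e2]
    ring
  have wT : ∫ t in Ioi T, f t = Real.exp (-q * T) * (1 / q * h (ξ.xbar, ξ.ybar)) := by
    have : EqOn f (fun t => Real.exp (-q * t) * h (ξ.xbar, ξ.ybar)) (Ioi T) := fun t ht => by
      simp only [hf, pT t (le_of_lt ht)]
    rw [setIntegral_congr_fun measurableSet_Ioi this, integral_mul_const,
      integral_exp_mul_Ioi (by linarith) T]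
    field_simp
  have hftot : ∫ t in Ioi 0, f t
      = (∫ w in (0 : ℝ)..S, Real.exp (-q * w) * h (z.1 + p₁ * w, z.2 + p₂ * w))
        + Real.exp (q * (z.2 / p₂)) / p₂ * (∫ t in ξ.ξ₁ u..ξ.ybar,
            h (ξ.inv₁ t + p₁ / p₂ * t, t) * Real.exp (-q * (t / p₂)))
        + Real.exp (-q * T) * (1 / q * h (ξ.xbar, ξ.ybar)) := by
    rw [← intervalIntegral.integral_interval_add_Ioi hh
      (hh.mono_set (Ioi_subset_Ioi hT0)),
      ← intervalIntegral.integral_add_adjacent_intervals (hfI 0 S le_rfl hS0) (hfI S T hS0 hST),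
      wS, wM, wT]
  have hstart : ξ.ξ₁ ξ.ubar = ξ.ybar := hξ.start
  -- The prefactors in `curveValue`, discounted over the travel time to the curve, become a factor
  -- depending only on the arrival time at the vertex, and in `g2` one depending only on the initial
  -- height.
  have g1 : Real.exp (-q * S) * Real.exp (q * ((ξ.ξ₁ u - ξ.ybar) / p₂)) = Real.exp (-q * T) := by
    rw [← Real.exp_add, ← eS, ← eT]
    congr 1
    field_simp
    ring
  have g2 : Real.exp (-q * S) * Real.exp (q * (ξ.ξ₁ u / p₂)) = Real.exp (q * (z.2 / p₂)) := by
    rw [← Real.exp_add, ← eS]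
    congr 1
    field_simp
    ring
  have g3 : ∫ w in ξ.ubar..u, Real.exp (-q * ((ξ.ξ₁ w - z.2) / p₂))
      = Real.exp (q * (z.2 / p₂)) * ∫ w in ξ.ubar..u, Real.exp (-q * (ξ.ξ₁ w / p₂)) := by
    rw [← intervalIntegral.integral_const_mul]
    refine intervalIntegral.integral_congr fun w _ => ?_
    simp only [← Real.exp_add]
    congr 1
    ring
  have hxbar : ξ.ubar + p₁ / p₂ * ξ.ybar = ξ.xbar := ξ.xbar_eq.symm
  change (∫ t in Ioi 0, d t) + ∫ t in Ioi 0, f t = _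
  unfold curveValue
  rw [hdtot, hftot, g3, hstart, hxbar, ← g1, ← g2]
  ring

/-- The value along the path is the value after the lump sums plus the lump sums. -/
lemma pathValue_eq_add (hp₂ : 0 < p₂) (hz : z ∈ ξ.regionO₁) {q a₁ a₂ : ℝ}
    (hq : 0 < q) (h : ℝ × ℝ → ℝ)
    (hint : IntegrableOn (fun t => q * Real.exp (-q * t) * (a₁ * (z.1 + p₁ * t - (ξ.path z t).1)
      + a₂ * (z.2 + p₂ * t - (ξ.path z t).2))) (Ioi 0)) :
    ξ.pathValue q a₁ a₂ h z = a₁ * (z.1 - (ξ.path z 0).1) + a₂ * (z.2 - (ξ.path z 0).2)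
      + ξ.pathValue q a₁ a₂ h (ξ.path z 0) := by
  set c := a₁ * (z.1 - (ξ.path z 0).1) + a₂ * (z.2 - (ξ.path z 0).2) with hc
  have hI : IntegrableOn (fun t : ℝ => q * Real.exp (-q * t) * c) (Ioi 0) :=
    ((integrableOn_exp_mul_Ioi (by linarith) 0).const_mul q).mul_const c
  -- The density `q e^{-qt}` has total mass one, so a payment made at the outset contributes exactly
  -- its amount.
  have hIv : ∫ t in Ioi 0, q * Real.exp (-q * t) * c = c := by
    rw [integral_mul_const, integral_const_mul, integral_exp_mul_Ioi (by linarith) 0]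
    simp
    field_simp
  have e1 : ∫ t in Ioi 0, Real.exp (-q * t) * h (ξ.path (ξ.path z 0) t)
      = ∫ t in Ioi 0, Real.exp (-q * t) * h (ξ.path z t) :=
    setIntegral_congr_fun measurableSet_Ioi fun t ht => by
      simp only [path_path hp₂ hz (le_of_lt ht)]
  have e2 : ∫ t in Ioi 0, q * Real.exp (-q * t) *
      (a₁ * ((ξ.path z 0).1 + p₁ * t - (ξ.path (ξ.path z 0) t).1)
        + a₂ * ((ξ.path z 0).2 + p₂ * t - (ξ.path (ξ.path z 0) t).2))
      = (∫ t in Ioi 0, q * Real.exp (-q * t) * (a₁ * (z.1 + p₁ * t - (ξ.path z t).1)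
      + a₂ * (z.2 + p₂ * t - (ξ.path z t).2))) - c := by
    rw [← hIv, ← integral_sub hint hI]
    refine setIntegral_congr_fun measurableSet_Ioi fun t ht => ?_
    simp only [path_path hp₂ hz (le_of_lt ht), hc]
    ring
  unfold pathValue
  rw [e1, e2]
  ring

end CurveData

/-! ### Integrability along surplus paths, and the value by starting region -/

/-- A continuous bounded path in the first quadrant for which the payments `z + t p - Z t` are
nonnegative and nondecreasing. -/
structure IsSurplusPath (p₁ p₂ : ℝ) (z : ℝ × ℝ) (Z : ℝ → ℝ × ℝ) : Prop where
  continuousOn : ContinuousOn Z (Ici 0)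
  mem_quadrant : ∀ t, 0 ≤ t → Z t ∈ quadrant
  bounded : ∃ R, ∀ t, 0 ≤ t → (Z t).1 + (Z t).2 ≤ R
  start_fst : (Z 0).1 ≤ z.1
  start_snd : (Z 0).2 ≤ z.2
  mono_fst : MonotoneOn (fun t => z.1 + p₁ * t - (Z t).1) (Ici 0)
  mono_snd : MonotoneOn (fun t => z.2 + p₂ * t - (Z t).2) (Ici 0)

namespace IsSurplusPath

variable {p₁ p₂ : ℝ} {z : ℝ × ℝ} {Z : ℝ → ℝ × ℝ}

lemma swap (hZ : IsSurplusPath p₁ p₂ z Z) :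
    IsSurplusPath p₂ p₁ z.swap (fun t => (Z t).swap) where
  continuousOn := continuous_swap.comp_continuousOn hZ.continuousOn
  mem_quadrant t ht := ⟨(hZ.mem_quadrant t ht).2, (hZ.mem_quadrant t ht).1⟩
  bounded := by
    obtain ⟨R, hR⟩ := hZ.bounded
    exact ⟨R, fun t ht => (add_comm _ _).trans_le (hR t ht)⟩
  start_fst := hZ.start_snd
  start_snd := hZ.start_fst
  mono_fst := hZ.mono_snd
  mono_snd := hZ.mono_fst

lemma fst_nonneg (hZ : IsSurplusPath p₁ p₂ z Z) {t : ℝ} (ht : 0 ≤ t) :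
    0 ≤ z.1 + p₁ * t - (Z t).1 := by
  have := hZ.mono_fst (self_mem_Ici (a := (0 : ℝ))) ht ht
  simp only [mul_zero, add_zero] at this
  linarith [hZ.start_fst]

lemma snd_nonneg (hZ : IsSurplusPath p₁ p₂ z Z) {t : ℝ} (ht : 0 ≤ t) :
    0 ≤ z.2 + p₂ * t - (Z t).2 := hZ.swap.fst_nonneg ht

lemma integrableOn_fst (hZ : IsSurplusPath p₁ p₂ z Z) (hp₁ : 0 < p₁) {q : ℝ}
    (hq : 0 < q) :
    IntegrableOn (fun t => q * Real.exp (-q * t) * (z.1 + p₁ * t - (Z t).1)) (Ioi 0) := by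
  have hz : 0 ≤ z.1 := (hZ.mem_quadrant 0 le_rfl).1.trans hZ.start_fst
  refine Integrable.mono' (integral_exp_mul_affine_Ioi (T := 0) hq hp₁.le hz).1 ?_ ?_
  · refine ContinuousOn.aestronglyMeasurable ?_ measurableSet_Ioi
    have h1 : ContinuousOn (fun t => z.1 + p₁ * t - (Z t).1) (Ioi 0) :=
      (by fun_prop : Continuous fun t => z.1 + p₁ * t).continuousOn.sub
        (hZ.continuousOn.mono Ioi_subset_Ici_self).fst
    exact (by fun_prop : Continuous fun t => q * Real.exp (-q * t)).continuousOn.mul h1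
  · filter_upwards [ae_restrict_mem measurableSet_Ioi] with t ht
    have ht' : 0 ≤ t := le_of_lt ht
    have h1 := hZ.fst_nonneg ht'
    have h2 := (hZ.mem_quadrant t ht').1
    rw [Real.norm_of_nonneg (by positivity), sub_zero]
    gcongr
    linarith

lemma integrableOn_snd (hZ : IsSurplusPath p₁ p₂ z Z) (hp₂ : 0 < p₂) {q : ℝ}
    (hq : 0 < q) :
    IntegrableOn (fun t => q * Real.exp (-q * t) * (z.2 + p₂ * t - (Z t).2)) (Ioi 0) :=
  hZ.swap.integrableOn_fst hp₂ hq

lemma integrableOn_dividends (hZ : IsSurplusPath p₁ p₂ z Z) (hp₁ : 0 < p₁) (hp₂ : 0 < p₂)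
    {q : ℝ} (hq : 0 < q) (a₁ a₂ : ℝ) :
    IntegrableOn (fun t => q * Real.exp (-q * t) * (a₁ * (z.1 + p₁ * t - (Z t).1)
      + a₂ * (z.2 + p₂ * t - (Z t).2))) (Ioi 0) := by
  have := ((hZ.integrableOn_fst hp₁ hq).const_mul a₁).add
    ((hZ.integrableOn_snd hp₂ hq).const_mul a₂)
  refine this.congr (Eventually.of_forall fun t => ?_)
  simp only [Pi.add_apply]
  ring

end IsSurplusPath

namespace CurveData

variable {p₁ p₂ : ℝ} {ξ : CurveData p₁ p₂} {z : ℝ × ℝ}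

lemma isSurplusPath_path (hp₁ : 0 < p₁) (hp₂ : 0 < p₂) (hz : z ∈ ξ.regionO₁) :
    IsSurplusPath p₁ p₂ z (ξ.path z) := by
  have hb : ∀ {t}, 0 ≤ t → ξ.IsBelow (ξ.path z t) := fun ht => isBelow_path hp₁ hp₂ hz ht
  have hr : 0 < p₁ / p₂ := div_pos hp₁ hp₂
  have hYsub : ∀ {s t}, s ≤ t →
      (ξ.path z t).2 - (ξ.path z s).2 ≤ p₂ * (t - s) := fun {s t} hst => by
    rw [sub_le_iff_le_add, path_snd, path_snd, add_comm (p₂ * (t - s)), ← min_add_add_right]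
    refine min_le_min (by linarith) ?_
    have := mul_nonneg hp₂.le (sub_nonneg.2 hst)
    linarith
  have hYmono : ∀ {s t}, s ≤ t → (ξ.path z s).2 ≤ (ξ.path z t).2 := fun {s t} hst => by
    rw [path_snd, path_snd]
    exact min_le_min_right _ (by gcongr)
  refine ⟨continuousOn_path hp₂ hz.1, fun t ht => (hb ht).mem_quadrant,
    -- The intercept never exceeds its initial value and the height never exceeds `ybar`, which
    -- bounds the sum of the coordinates.
    ⟨z.1 - p₁ / p₂ * z.2 + p₁ / p₂ * ξ.ybar + ξ.ybar, fun t ht => ?_⟩, ?_, ?_, ?_, ?_⟩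
  · have h1 := path_fst_sub (ξ := ξ) (z := z) t
    have h2 := min_le_left (z.1 - p₁ / p₂ * z.2) (ξ.inv₁ (ξ.path z t).2)
    have h3 := (hb ht).snd_mem.2
    have h4 := mul_le_mul_of_nonneg_left h3 hr.le
    linarith
  · have h1 := path_fst_sub (ξ := ξ) (z := z) 0
    have h2 := min_le_left (z.1 - p₁ / p₂ * z.2) (ξ.inv₁ (ξ.path z 0).2)
    have h3 : (ξ.path z 0).2 ≤ z.2 := by rw [path_zero_snd]; exact min_le_left _ _
    have h4 := mul_le_mul_of_nonneg_left h3 hr.le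
    linarith
  · rw [path_zero_snd]; exact min_le_left _ _
  · intro s hs t ht hst
    have h1 := path_fst_sub (ξ := ξ) (z := z) t
    have h2 := path_fst_sub (ξ := ξ) (z := z) s
    have h3 : ξ.inv₁ (ξ.path z t).2 ≤ ξ.inv₁ (ξ.path z s).2 :=
      ξ.isBoundaryCurve₁.inv_strictAntiOn.antitoneOn (hb hs).snd_mem (hb ht).snd_mem (hYmono hst)
    have h4 := min_le_min_left (z.1 - p₁ / p₂ * z.2) h3
    have h5 := mul_le_mul_of_nonneg_left (hYsub hst) hr.le
    have h6 : p₁ / p₂ * (p₂ * (t - s)) = p₁ * t - p₁ * s := by field_simp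
    simp only
    linarith
  · intro s _ t _ hst
    have := hYsub hst
    simp only
    linarith

lemma pathValue_of_le (hp₁ : 0 < p₁) (hp₂ : 0 < p₂) (hz : z ∈ ξ.regionO₁) {q a₁ a₂ : ℝ}
    (hq : 0 < q) (ha₁ : 0 ≤ a₁) (ha₂ : 0 ≤ a₂) {h : ℝ × ℝ → ℝ}
    (hh : IntegrableOn (fun t => Real.exp (-q * t) * h (ξ.path z t)) (Ioi 0))
    (hy : z.2 ≤ ξ.ybar) (hx : z.1 ≤ ξ.inv₁ z.2 + p₁ / p₂ * z.2) :
    ξ.pathValue q a₁ a₂ h z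
      = Real.exp (-q * ((ξ.ξ₁ (z.1 - p₁ / p₂ * z.2) - z.2) / p₂)) *
          ξ.curveValue q a₁ a₂ h (z.1 - p₁ / p₂ * z.2)
        + ∫ w in (0 : ℝ)..((ξ.ξ₁ (z.1 - p₁ / p₂ * z.2) - z.2) / p₂),
            Real.exp (-q * w) * h (z.1 + p₁ * w, z.2 + p₂ * w) :=
  pathValue_of_isBelow hp₂ hp₁ ⟨hz.1.1, ⟨hz.1.2, hy⟩, by linarith [hz.2], by linarith⟩
    hq ha₁ ha₂ hh

/-- After the jump the path starts on the curve, so the travel time is zero and only the lump sums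
and `curveValue` remain. The parameter `w` covers both the jumps to the curve and, for `w = ubar`,
the jump to the vertex. -/
lemma pathValue_of_jump (hp₁ : 0 < p₁) (hp₂ : 0 < p₂) (hz : z ∈ ξ.regionO₁) {q a₁ a₂ : ℝ}
    (hq : 0 < q) (ha₁ : 0 ≤ a₁) (ha₂ : 0 ≤ a₂) {h : ℝ × ℝ → ℝ}
    (hh : IntegrableOn (fun t => Real.exp (-q * t) * h (ξ.path z t)) (Ioi 0)) {w : ℝ}
    (h0 : ξ.path z 0 = (w + p₁ / p₂ * ξ.ξ₁ w, ξ.ξ₁ w)) :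
    ξ.pathValue q a₁ a₂ h z = a₁ * (z.1 - (w + p₁ / p₂ * ξ.ξ₁ w)) + a₂ * (z.2 - ξ.ξ₁ w)
      + ξ.curveValue q a₁ a₂ h w := by
  have hb := isBelow_path hp₁ hp₂ hz le_rfl
  rw [pathValue_eq_add hp₂ hz hq h ((isSurplusPath_path hp₁ hp₂ hz).integrableOn_dividends
    hp₁ hp₂ hq a₁ a₂), pathValue_of_isBelow hp₂ hp₁ hb hq ha₁ ha₂ (hh.congr_fun (fun t ht => by
      simp only [path_path hp₂ hz (le_of_lt ht)]) measurableSet_Ioi)]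
  have hT : ξ.curveTime (ξ.path z 0) = 0 := by
    rw [curveTime, h0]; simp
  rw [hT, h0]
  simp

lemma pathValue_of_ge (hp₁ : 0 < p₁) (hp₂ : 0 < p₂) (hz : z ∈ ξ.regionO₁) {q a₁ a₂ : ℝ}
    (hq : 0 < q) (ha₁ : 0 ≤ a₁) (ha₂ : 0 ≤ a₂) {h : ℝ × ℝ → ℝ}
    (hh : IntegrableOn (fun t => Real.exp (-q * t) * h (ξ.path z t)) (Ioi 0))
    (hy : z.2 ≤ ξ.ybar) (hx : ξ.inv₁ z.2 + p₁ / p₂ * z.2 ≤ z.1) :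
    ξ.pathValue q a₁ a₂ h z
      = a₁ * (z.1 - ξ.inv₁ z.2 - p₁ / p₂ * z.2) + ξ.curveValue q a₁ a₂ h (ξ.inv₁ z.2) := by
  have hm : z.2 ∈ Icc 0 ξ.ybar := ⟨hz.1.2, hy⟩
  have e : ξ.ξ₁ (ξ.inv₁ z.2) = z.2 := ξ.isBoundaryCurve₁.apply_inv hm
  rw [pathValue_of_jump hp₁ hp₂ hz hq ha₁ ha₂ hh (w := ξ.inv₁ z.2)]
  · rw [e]; ring
  · have e2 := path_zero_snd (ξ := ξ) z
    have e1 := path_fst_sub (ξ := ξ) (z := z) 0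
    rw [min_eq_left hy] at e2
    rw [e2, min_eq_right (by linarith)] at e1
    rw [e]
    exact Prod.ext (by simp only; linarith) e2

lemma pathValue_of_vertex_le (hp₁ : 0 < p₁) (hp₂ : 0 < p₂) (hz : z ∈ ξ.regionO₁) {q a₁ a₂ : ℝ}
    (hq : 0 < q) (ha₁ : 0 ≤ a₁) (ha₂ : 0 ≤ a₂) {h : ℝ × ℝ → ℝ}
    (hh : IntegrableOn (fun t => Real.exp (-q * t) * h (ξ.path z t)) (Ioi 0))
    (hy : ξ.ybar ≤ z.2) :
    ξ.pathValue q a₁ a₂ h z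
      = a₁ * (z.1 - ξ.xbar) + a₂ * (z.2 - ξ.ybar) + ξ.curveValue q a₁ a₂ h ξ.ubar := by
  have e : ξ.ξ₁ ξ.ubar = ξ.ybar := ξ.isBoundaryCurve₁.start
  rw [pathValue_of_jump hp₁ hp₂ hz hq ha₁ ha₂ hh (w := ξ.ubar)]
  · rw [e, xbar_eq]
  · have e2 := path_zero_snd (ξ := ξ) z
    have e1 := path_fst_sub (ξ := ξ) (z := z) 0
    rw [min_eq_right hy] at e2
    rw [e2, inv₁_ybar, min_eq_right (by linarith [hz.2])] at e1
    rw [e]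
    exact Prod.ext (by simp only; linarith) e2

/-! ### Exchanging the two companies -/

/-- The curve strategy with the companies exchanged. -/
def swap (ξ : CurveData p₁ p₂) : CurveData p₂ p₁ :=
  ⟨ξ.ybar, ξ.xbar, ξ.ybar_nonneg, ξ.xbar_nonneg, ξ.ξ₂, ξ.M₂, ξ.ξ₁, ξ.M₁, ξ.curve₂, ξ.curve₁⟩

lemma mem_swap_quadrant : z.swap ∈ quadrant ↔ z ∈ quadrant := and_comm

lemma mem_swap_setA₀ : z.swap ∈ ξ.swap.setA₀ ↔ z ∈ ξ.setA₀ := by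
  simp only [setA₀, mem_singleton_iff, Prod.ext_iff]
  exact and_comm

lemma mem_swap_setA₁ : z.swap ∈ ξ.swap.setA₁ ↔ z ∈ ξ.setA₂ := by
  constructor
  · rintro ⟨v, hv, h⟩
    exact ⟨v, hv, by rw [← Prod.swap_swap z, ← h]; rfl⟩
  · rintro ⟨v, hv, rfl⟩
    exact ⟨v, hv, rfl⟩

lemma mem_swap_setA₂ : z.swap ∈ ξ.swap.setA₂ ↔ z ∈ ξ.setA₁ :=
  (mem_swap_setA₁ (ξ := ξ.swap) (z := z.swap)).symm

lemma mem_swap_setB₀ : z.swap ∈ ξ.swap.setB₀ ↔ z ∈ ξ.setB₀ :=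
  and_congr and_comm (not_congr mem_swap_setA₀)

lemma mem_swap_setB₁ : z.swap ∈ ξ.swap.setB₁ ↔ z ∈ ξ.setB₂ :=
  and_congr_left' mem_swap_quadrant

lemma mem_swap_setB₂ : z.swap ∈ ξ.swap.setB₂ ↔ z ∈ ξ.setB₁ :=
  and_congr_left' mem_swap_quadrant

lemma mem_swap_setA : z.swap ∈ ξ.swap.setA ↔ z ∈ ξ.setA := by
  simp only [setA, mem_union, mem_swap_setA₀, mem_swap_setA₁, mem_swap_setA₂]
  tauto

lemma mem_swap_setC : z.swap ∈ ξ.swap.setC ↔ z ∈ ξ.setC := by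
  simp only [setC, Set.mem_sdiff, mem_union, mem_swap_quadrant, mem_swap_setA, mem_swap_setB₀,
    mem_swap_setB₁, mem_swap_setB₂]
  tauto

/-- The definition tests `A₁` before `A₂`, an order that the exchange reverses; this is harmless
because the two sets lie on opposite sides of the line. The same applies to `B₁` and `B₂` in
`lump_swap`. -/
lemma rate_swap (hp₁ : 0 < p₁) (hp₂ : 0 < p₂) (z : ℝ × ℝ) :
    ξ.swap.rate z.swap = (ξ.rate z).swap := by
  unfold rate
  by_cases h0 : z ∈ ξ.setA₀
  · rw [if_pos (mem_swap_setA₀.2 h0), if_pos h0]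
    rfl
  rw [if_neg (mt mem_swap_setA₀.1 h0), if_neg h0]
  by_cases h1 : z ∈ ξ.setA₁
  · have h2 : z ∉ ξ.setA₂ := fun h2 => (setA₁_lt h1).not_gt (setA₂_lt hp₁ hp₂ h2)
    rw [if_neg (mt mem_swap_setA₁.1 h2), if_pos (mem_swap_setA₂.2 h1), if_pos h1]
    rfl
  rw [if_neg h1]
  by_cases h2 : z ∈ ξ.setA₂
  · rw [if_pos (mem_swap_setA₁.2 h2), if_pos h2]
    rfl
  · rw [if_neg (mt mem_swap_setA₁.1 h2), if_neg (mt mem_swap_setA₂.1 h1), if_neg h2]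
    rfl

lemma lump_swap (hp₁ : 0 < p₁) (hp₂ : 0 < p₂) (z : ℝ × ℝ) :
    ξ.swap.lump z.swap = (ξ.lump z).swap := by
  unfold lump
  by_cases h0 : z ∈ ξ.setB₀
  · rw [if_pos (mem_swap_setB₀.2 h0), if_pos h0]
    rfl
  rw [if_neg (mt mem_swap_setB₀.1 h0), if_neg h0]
  by_cases h1 : z ∈ ξ.setB₁
  · have h2 : z ∉ ξ.setB₂ := fun h2 => (setB₁_lt h1).not_gt (setB₂_lt hp₁ hp₂ h2)
    rw [if_neg (mt mem_swap_setB₁.1 h2), if_pos (mem_swap_setB₂.2 h1), if_pos h1]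
    rfl
  rw [if_neg h1]
  by_cases h2 : z ∈ ξ.setB₂
  · rw [if_pos (mem_swap_setB₁.2 h2), if_pos h2]
    rfl
  · rw [if_neg (mt mem_swap_setB₁.1 h2), if_neg (mt mem_swap_setB₂.1 h1), if_neg h2]
    rfl

lemma Follows.swap (hp₁ : 0 < p₁) (hp₂ : 0 < p₂) {τ : ℝ} {Z : ℝ → ℝ × ℝ}
    (hZ : ξ.Follows z τ Z) : ξ.swap.Follows z.swap τ (fun t => (Z t).swap) := by
  intro t ht htτ
  obtain ⟨h1, h2, h3⟩ := hZ t ht htτ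
  have hi : IntervalIntegrable (fun s => ξ.swap.rate (Z s).swap) volume 0 t := by
    simp only [rate_swap hp₁ hp₂]
    rw [intervalIntegrable_iff] at *
    exact h2.snd.prodMk h2.fst
  refine ⟨h1.imp mem_swap_setC.2 mem_swap_setA.2, hi, ?_⟩
  have e1 := congrArg Prod.fst h3
  have e2 := congrArg Prod.snd h3
  simp only [Prod.fst_sub, Prod.fst_add, Prod.smul_fst, smul_eq_mul] at e1
  simp only [Prod.snd_sub, Prod.snd_add, Prod.smul_snd, smul_eq_mul] at e2
  rw [fst_intervalIntegral h2] at e1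
  rw [snd_intervalIntegral h2] at e2
  have i1 := fst_intervalIntegral hi
  have i2 := snd_intervalIntegral hi
  simp only [rate_swap hp₁ hp₂] at i1 i2
  refine Prod.ext ?_ ?_
  · simp only [Prod.fst_sub, Prod.fst_add, Prod.smul_fst, smul_eq_mul, i1, rate_swap hp₁ hp₂, lump_swap hp₁ hp₂, Prod.fst_swap]
    exact e2
  · simp only [Prod.snd_sub, Prod.snd_add, Prod.smul_snd, smul_eq_mul, i2, rate_swap hp₁ hp₂, lump_swap hp₁ hp₂, Prod.snd_swap]
    exact e1

lemma mem_swap_regionO₁ (hz : z ∈ ξ.regionO₂) : z.swap ∈ ξ.swap.regionO₁ :=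
  ⟨mem_swap_quadrant.2 hz.1, hz.2⟩

lemma mem_regionO₁_or (hp₁ : 0 < p₁) (hp₂ : 0 < p₂) (hz : z ∈ quadrant) :
    z ∈ ξ.regionO₁ ∨ z ∈ ξ.regionO₂ := by
  by_contra! h
  have h1 : z.1 - p₁ / p₂ * z.2 < ξ.ubar := by
    by_contra! h'
    exact h.1 ⟨hz, by linarith⟩
  rw [← vbar_lt_iff hp₁ hp₂] at h1
  exact h.2 ⟨hz, by linarith⟩

end CurveData

/-! ### Exponential random times -/

section Exponential

variable {r : ℝ}

/-- The origin is a null set, so the density may be taken on the open half-line, the domain of the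
integrals over time. -/
lemma expMeasure_eq_withDensity (r : ℝ) : expMeasure r =
    (volume.restrict (Ioi 0)).withDensity fun t => ENNReal.ofReal (r * Real.exp (-r * t)) := by
  rw [← withDensity_indicator measurableSet_Ioi]
  change volume.withDensity (exponentialPDF r) = _
  refine withDensity_congr_ae ?_
  filter_upwards [compl_mem_ae_iff.2 (measure_singleton (0 : ℝ))] with t ht
  rcases lt_trichotomy t 0 with h | h | h
  · rw [exponentialPDF_of_neg h, indicator_of_notMem (by simpa using h.le)]
  · exact absurd h ht
  · rw [exponentialPDF_of_nonneg h.le, indicator_of_mem (by exact h), neg_mul]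

lemma measurable_expDensity (r : ℝ) :
    Measurable fun t : ℝ => ENNReal.ofReal (r * Real.exp (-r * t)) := by fun_prop

lemma integral_expMeasure (hr : 0 < r) (f : ℝ → ℝ) :
    ∫ t, f t ∂expMeasure r = ∫ t in Ioi 0, r * Real.exp (-r * t) * f t := by
  rw [expMeasure_eq_withDensity, integral_withDensity_eq_integral_toReal_smul
    (measurable_expDensity r) (Eventually.of_forall fun _ => ENNReal.ofReal_lt_top)]
  refine integral_congr_ae (Eventually.of_forall fun t => ?_)
  simp only [smul_eq_mul]
  rw [ENNReal.toReal_ofReal (by positivity)]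

lemma integrable_expMeasure_iff (hr : 0 < r) {f : ℝ → ℝ} :
    Integrable f (expMeasure r) ↔
      IntegrableOn (fun t => r * Real.exp (-r * t) * f t) (Ioi 0) := by
  rw [expMeasure_eq_withDensity, integrable_withDensity_iff_integrable_smul'
    (measurable_expDensity r) (Eventually.of_forall fun _ => ENNReal.ofReal_lt_top)]
  refine integrable_congr (Eventually.of_forall fun t => ?_)
  simp only [smul_eq_mul]
  rw [ENNReal.toReal_ofReal (by positivity)]

lemma expMeasure_absolutelyContinuous (r : ℝ) : expMeasure r ≪ volume := by
  rw [expMeasure_eq_withDensity]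
  exact (withDensity_absolutelyContinuous _ _).trans Measure.restrict_le_self.absolutelyContinuous

lemma ae_expMeasure_pos (r : ℝ) : ∀ᵐ t ∂expMeasure r, 0 < t := by
  rw [expMeasure_eq_withDensity]
  exact (withDensity_absolutelyContinuous _ _).ae_le (ae_restrict_mem measurableSet_Ioi)

lemma expMeasure_singleton (r t : ℝ) : expMeasure r {t} = 0 :=
  expMeasure_absolutelyContinuous r (measure_singleton t)

lemma expMeasure_Ioi (hr : 0 < r) (s : ℝ) :
    expMeasure r (Ioi s) = ENNReal.ofReal (Real.exp (-r * max s 0)) := by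
  have := isProbabilityMeasure_expMeasure hr
  rw [← compl_Iic, prob_compl_eq_one_sub measurableSet_Iic, ← ofReal_cdf, cdf_expMeasure_eq hr]
  split_ifs with h
  · rw [max_eq_left h, ← ENNReal.ofReal_one, ← ENNReal.ofReal_sub]
    · congr 1
      rw [neg_mul]
      ring
    · rw [sub_nonneg, Real.exp_le_one_iff]
      nlinarith
  · rw [max_eq_right (not_le.1 h).le]
    simp

lemma expMeasure_Ici (hr : 0 < r) (s : ℝ) :
    expMeasure r (Ici s) = ENNReal.ofReal (Real.exp (-r * max s 0)) := by
  rw [← expMeasure_Ioi hr]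
  refine le_antisymm ?_ (measure_mono Ioi_subset_Ici_self)
  rw [← Ioi_union_left]
  refine (measure_union_le _ _).trans ?_
  rw [expMeasure_singleton, add_zero]

/-- The minimum of two independent exponential variables is exponential. -/
lemma map_min_expMeasure {a b : ℝ} (ha : 0 < a) (hb : 0 < b) :
    ((expMeasure a).prod (expMeasure b)).map (fun x => min x.1 x.2) = expMeasure (a + b) := by
  have := isProbabilityMeasure_expMeasure ha
  have := isProbabilityMeasure_expMeasure hb
  have hm : Measurable fun x : ℝ × ℝ => min x.1 x.2 := by fun_prop
  have := Measure.isProbabilityMeasure_map (μ := (expMeasure a).prod (expMeasure b))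
    hm.aemeasurable
  refine Measure.ext_of_Ici _ _ fun s => ?_
  have hs : (fun x : ℝ × ℝ => min x.1 x.2) ⁻¹' Ici s = Ici s ×ˢ Ici s := by
    ext x; simp only [mem_preimage, mem_Ici, mem_prod, le_min_iff]
  rw [Measure.map_apply hm measurableSet_Ici, hs, Measure.prod_prod, expMeasure_Ici ha,
    expMeasure_Ici hb, expMeasure_Ici (add_pos ha hb), ← ENNReal.ofReal_mul (Real.exp_pos _).le,
    ← Real.exp_add]
  congr 2
  ring

/-- An expectation on the event that the first of two independent exponential times comes first. -/
lemma integral_ite_lt_expMeasure {a b C : ℝ} (ha : 0 < a) (hb : 0 < b) {F : Measure ℝ}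
    [IsProbabilityMeasure F] {φ : ℝ × ℝ → ℝ} (hφ : Measurable φ) (hC : ∀ x, ‖φ x‖ ≤ C) :
    Integrable (fun x : ℝ × ℝ × ℝ => if x.1 < x.2.1 then φ (x.1, x.2.2) else 0)
      ((expMeasure a).prod ((expMeasure b).prod F)) ∧
    ∫ x : ℝ × ℝ × ℝ, (if x.1 < x.2.1 then φ (x.1, x.2.2) else 0)
      ∂(expMeasure a).prod ((expMeasure b).prod F)
      = ∫ t in Ioi 0, a * Real.exp (-(a + b) * t) * ∫ α, φ (t, α) ∂F ∧
    IntegrableOn (fun t => a * Real.exp (-(a + b) * t) * ∫ α, φ (t, α) ∂F) (Ioi 0) := by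
  have := isProbabilityMeasure_expMeasure ha
  have := isProbabilityMeasure_expMeasure hb
  have hC0 : 0 ≤ C := (norm_nonneg _).trans (hC 0)
  have hint : Integrable (fun x : ℝ × ℝ × ℝ => if x.1 < x.2.1 then φ (x.1, x.2.2) else 0)
      ((expMeasure a).prod ((expMeasure b).prod F)) := by
    refine Integrable.of_bound (C := C) (Measurable.aestronglyMeasurable ?_)
      (Eventually.of_forall fun x => ?_)
    · exact Measurable.ite (measurableSet_lt (by fun_prop) (by fun_prop)) (by fun_prop)
        measurable_const
    · split_ifs
      · exact hC _
      · simpa using hC0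
  have hEq : EqOn (fun t => a * Real.exp (-a * t) *
      ∫ y : ℝ × ℝ, (if t < y.1 then φ (t, y.2) else 0) ∂(expMeasure b).prod F)
      (fun t => a * Real.exp (-(a + b) * t) * ∫ α, φ (t, α) ∂F) (Ioi 0) := fun t ht => by
    have ht' : 0 ≤ t := le_of_lt ht
    -- Written as a product, the integrand separates the second time from the claim size; the second
    -- time contributes its survival probability `e^{-bt}`.
    have h1 : ∀ y : ℝ × ℝ, (if t < y.1 then φ (t, y.2) else 0)
        = (Ioi t).indicator (fun _ => (1 : ℝ)) y.1 * φ (t, y.2) := fun y => by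
      by_cases h : t < y.1
      · rw [if_pos h, indicator_of_mem (by exact h), one_mul]
      · rw [if_neg h, indicator_of_notMem (by exact h), zero_mul]
    simp_rw [h1]
    rw [integral_prod_mul (fun s => (Ioi t).indicator (fun _ => (1 : ℝ)) s) fun α => φ (t, α),
      integral_indicator measurableSet_Ioi, setIntegral_const, smul_eq_mul, mul_one,
      measureReal_def, expMeasure_Ioi hb, max_eq_left ht',
      ENNReal.toReal_ofReal (Real.exp_pos _).le]
    have h2 : Real.exp (-(a + b) * t) = Real.exp (-a * t) * Real.exp (-b * t) := by
      rw [← Real.exp_add]; congr 1; ring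
    rw [h2]
    ring
  refine ⟨hint, ?_, ?_⟩
  · rw [integral_prod _ hint, integral_expMeasure ha]
    exact setIntegral_congr_fun measurableSet_Ioi hEq
  · exact ((integrable_expMeasure_iff ha).1 hint.integral_prod_left).congr_fun hEq
      measurableSet_Ioi

end Exponential

/-! ### Discounted dividends as values at an exponential time -/

section DiscountedDividends

/-- The Stieltjes measure is built from the right-continuous version of `g`; for left continuous `g`
its left limits recover `g`. Half-open intervals `[a, b)` thus get mass `g b - g a`. -/
lemma leftLim_stieltjesFunction {g : ℝ → ℝ} (hg : Monotone g) {a : ℝ}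
    (ha : ContinuousWithinAt g (Iic a) a) :
    Function.leftLim hg.stieltjesFunction a = g a := by
  refine leftLim_eq_of_tendsto ?_
  have h1 : Tendsto g (𝓝[<] a) (𝓝 (g a)) := ha.mono_left (nhdsWithin_mono _ Iio_subset_Iic_self)
  refine tendsto_of_tendsto_of_tendsto_of_le_of_le' h1 tendsto_const_nhds ?_ ?_
  · refine Eventually.of_forall fun s => ?_
    rw [hg.stieltjesFunction_eq]
    exact hg.le_rightLim le_rfl
  · filter_upwards [self_mem_nhdsWithin] with s hs
    rw [hg.stieltjesFunction_eq]
    exact hg.rightLim_le hs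

/-- The discounted dividends up to `τ` are the mean of the dividends paid up to `τ` or an independent
exponential time. -/
lemma discountedDividends_eq {δ : ℝ} (hδ : 0 < δ) {ℓ : ℝ≥0 → ℝ} (hm : Monotone ℓ)
    (hl : ∀ t, ContinuousWithinAt ℓ (Iic t) t) (h0 : ℓ 0 = 0) (τ : ℝ≥0∞) :
    discountedDividends δ ℓ τ
      = ∫⁻ r, ENNReal.ofReal (ℓ (min (ENNReal.ofReal r) τ).toNNReal) ∂expMeasure δ := by
  have := isProbabilityMeasure_expMeasure hδ
  have hg : Monotone (fun s : ℝ => ℓ s.toNNReal) := hm.comp fun _ _ h => Real.toNNReal_mono h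
  have hgl : ∀ s : ℝ, ContinuousWithinAt (fun s : ℝ => ℓ s.toNNReal) (Iic s) s := fun s =>
    (hl s.toNNReal).comp continuous_real_toNNReal.continuousWithinAt
      fun x hx => Real.toNNReal_mono hx
  set A : Set ℝ := {s : ℝ | 0 ≤ s ∧ ENNReal.ofReal s < τ} with hA
  have hAm : MeasurableSet A := by
    refine MeasurableSet.inter measurableSet_Ici ?_
    exact measurableSet_lt ENNReal.measurable_ofReal measurable_const
  unfold discountedDividends
  rw [dif_pos hg]
  set μ := hg.stieltjesFunction.measure
  -- The discount factor `e^{-δs}` is the probability that the exponential time exceeds `s`; Tonelli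
  -- then integrates over the payments first.
  have e1 : ∫⁻ s in A, ENNReal.ofReal (Real.exp (-δ * s)) ∂μ
      = ∫⁻ s in A, ∫⁻ r, (Ioi s).indicator 1 r ∂expMeasure δ ∂μ := by
    refine setLIntegral_congr_fun hAm fun s hs => ?_
    rw [lintegral_indicator_one measurableSet_Ioi, expMeasure_Ioi hδ, max_eq_left hs.1]
  have hmeas : MeasurableSet {p : ℝ × ℝ | p.1 < p.2} :=
    measurableSet_lt measurable_fst measurable_snd
  rw [e1, lintegral_lintegral_swap]
  swap
  · exact (measurable_one.indicator hmeas).aemeasurable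
  refine lintegral_congr_ae ?_
  filter_upwards [ae_expMeasure_pos δ] with r hr
  have e2 : ∀ s, (Ioi s).indicator (1 : ℝ → ℝ≥0∞) r = (Iio r).indicator 1 s := fun s => rfl
  simp_rw [e2]
  rw [lintegral_indicator_one measurableSet_Iio, Measure.restrict_apply measurableSet_Iio]
  have hne : min (ENNReal.ofReal r) τ ≠ ⊤ :=
    ((min_le_left _ _).trans_lt ENNReal.ofReal_lt_top).ne
  have e3 : Iio r ∩ A = Ico 0 (min (ENNReal.ofReal r) τ).toReal := by
    ext s
    simp only [mem_inter_iff, mem_Iio, hA, mem_ofPred_eq, mem_Ico]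
    constructor
    · rintro ⟨h1, h2, h3⟩
      refine ⟨h2, (ENNReal.ofReal_lt_iff_lt_toReal h2 hne).1 (lt_min ?_ h3)⟩
      exact (ENNReal.ofReal_lt_ofReal_iff hr).2 h1
    · rintro ⟨h1, h2⟩
      have h3 := lt_min_iff.1 ((ENNReal.ofReal_lt_iff_lt_toReal h1 hne).2 h2)
      exact ⟨(ENNReal.ofReal_lt_ofReal_iff hr).1 h3.1, h1, h3.2⟩
  rw [e3, StieltjesFunction.measure_Ico, leftLim_stieltjesFunction hg (hgl _),
    leftLim_stieltjesFunction hg (hgl _), Real.toNNReal_zero, h0, sub_zero,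
    ENNReal.toNNReal_toReal_eq]

/-- The bound is assumed strictly before `τ` only, and left continuity carries it to `τ` itself. At
time `0`, which has no earlier times, the path is zero. -/
lemma discountedDividends_le {δ x p : ℝ} (hδ : 0 < δ) {ℓ : ℝ≥0 → ℝ} (hm : Monotone ℓ)
    (hl : ∀ t, ContinuousWithinAt ℓ (Iic t) t) (h0 : ℓ 0 = 0) {τ : ℝ≥0∞} (hx : 0 ≤ x)
    (hp : 0 ≤ p) (hb : ∀ t : ℝ≥0, (t : ℝ≥0∞) < τ → ℓ t ≤ x + p * t) :
    discountedDividends δ ℓ τ ≤ ∫⁻ r, ENNReal.ofReal (x + p * r) ∂expMeasure δ := by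
  rw [discountedDividends_eq hδ hm hl h0]
  refine lintegral_mono_ae ?_
  filter_upwards [ae_expMeasure_pos δ] with r hr
  refine ENNReal.ofReal_le_ofReal ?_
  have hne : min (ENNReal.ofReal r) τ ≠ ⊤ :=
    ((min_le_left _ _).trans_lt ENNReal.ofReal_lt_top).ne
  set m := (min (ENNReal.ofReal r) τ).toNNReal with hmdef
  have hmr : (m : ℝ) ≤ r := by
    have : (min (ENNReal.ofReal r) τ).toReal ≤ (ENNReal.ofReal r).toReal :=
      ENNReal.toReal_mono ENNReal.ofReal_ne_top (min_le_left _ _)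
    rwa [ENNReal.toReal_ofReal hr.le] at this
  have hmτ : (m : ℝ≥0∞) ≤ τ := by
    rw [hmdef, ENNReal.coe_toNNReal hne]
    exact min_le_right _ _
  have hle : x + p * m ≤ x + p * r := by gcongr
  refine le_trans ?_ hle
  rcases eq_zero_or_pos m with h | h
  · rw [h, h0]
    simpa using hx
  · have hlim : Tendsto ℓ (𝓝[<] m) (𝓝 (ℓ m)) :=
      (hl m).mono_left (nhdsWithin_mono _ Iio_subset_Iic_self)
    have : (𝓝[<] m).NeBot := nhdsLT_neBot_of_exists_lt ⟨0, h⟩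
    refine le_of_tendsto hlim ?_
    filter_upwards [self_mem_nhdsWithin] with s hs
    have hs' : s < m := hs
    refine (hb s ((ENNReal.coe_lt_coe.2 hs').trans_le hmτ)).trans ?_
    gcongr

lemma lintegral_affine_expMeasure_lt_top {δ x p : ℝ} (hδ : 0 < δ) (hx : 0 ≤ x) (hp : 0 ≤ p) :
    ∫⁻ r, ENNReal.ofReal (x + p * r) ∂expMeasure δ < ∞ := by
  have : Integrable (fun r => x + p * r) (expMeasure δ) := by
    rw [integrable_expMeasure_iff hδ]
    simpa using (integral_exp_mul_affine_Ioi (T := 0) hδ hp hx).1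
  exact this.lintegral_lt_top

/-- The mean discounted dividends up to an exponential time, for dividends that follow a
deterministic path. -/
lemma integral_discountedDividends {Ω : Type*} [MeasurableSpace Ω] {P : Measure Ω} {δ lam : ℝ}
    (hδ : 0 < δ) (hlam : 0 < lam) {τ : Ω → ℝ} (hτ : Measurable τ)
    (hlaw : P.map τ = expMeasure lam) {𝓕 : Filtration ℝ≥0 (inferInstance : MeasurableSpace Ω)}
    {L : ℝ≥0 → Ω → ℝ} (hL : IsDividendProcess 𝓕 L) {ℓ : ℝ → ℝ} (hℓ : ContinuousOn ℓ (Ici 0))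
    (hℓ0 : ∀ t, 0 ≤ t → 0 ≤ ℓ t)
    (hLℓ : ∀ᵐ ω ∂P, ∀ t : ℝ≥0, 0 < t → (t : ℝ) ≤ τ ω → L t ω = ℓ t)
    (hint : IntegrableOn (fun t => (δ + lam) * Real.exp (-(δ + lam) * t) * ℓ t) (Ioi 0)) :
    Integrable (fun ω =>
      (discountedDividends δ (fun t => L t ω) (ENNReal.ofReal (τ ω))).toReal) P ∧
    ∫ ω, (discountedDividends δ (fun t => L t ω) (ENNReal.ofReal (τ ω))).toReal ∂P
      = ∫ t in Ioi 0, (δ + lam) * Real.exp (-(δ + lam) * t) * ℓ t := by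
  have hq := add_pos hδ hlam
  have := isProbabilityMeasure_expMeasure hδ
  have := isProbabilityMeasure_expMeasure hlam
  -- Freezing the path at negative times makes it continuous on the whole line, hence measurable,
  -- without changing it at the positive times that matter.
  set ℓ' : ℝ → ℝ := fun t => ℓ (max t 0) with hℓ'
  have hℓ'c : Continuous ℓ' :=
    hℓ.comp_continuous (by fun_prop) fun t => le_max_right t 0
  have hℓ'0 : ∀ t, 0 ≤ ℓ' t := fun t => hℓ0 _ (le_max_right t 0)
  set D : ℝ → ℝ≥0∞ := fun t => ∫⁻ r, ENNReal.ofReal (ℓ' (min r t)) ∂expMeasure δ with hD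
  have hDm : Measurable D := by
    refine Measurable.lintegral_prod_left' (f := fun x : ℝ × ℝ => ENNReal.ofReal (ℓ' (min x.1 x.2))) ?_
    fun_prop
  have hτpos : ∀ᵐ ω ∂P, 0 < τ ω := by
    have := ae_expMeasure_pos lam
    rw [← hlaw] at this
    exact ae_of_ae_map hτ.aemeasurable this
  have hae : (fun ω => discountedDividends δ (fun t => L t ω) (ENNReal.ofReal (τ ω)))
      =ᵐ[P] fun ω => D (τ ω) := by
    filter_upwards [hLℓ, hτpos] with ω h1 h2
    rw [discountedDividends_eq hδ (hL.mono ω) (hL.left_continuous ω) (hL.zero ω)]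
    refine lintegral_congr_ae ?_
    filter_upwards [ae_expMeasure_pos δ] with r hr
    have hpos : 0 < min r (τ ω) := lt_min hr h2
    rw [← ENNReal.ofReal_min]
    have e : (ENNReal.ofReal (min r (τ ω))).toNNReal = (min r (τ ω)).toNNReal := rfl
    rw [e, h1 _ (Real.toNNReal_pos.2 hpos) (by
      rw [Real.coe_toNNReal _ hpos.le]; exact min_le_right _ _), Real.coe_toNNReal _ hpos.le]
    simp only [hℓ', max_eq_left hpos.le]
  have hint' : Integrable ℓ' (expMeasure (δ + lam)) := by
    rw [integrable_expMeasure_iff hq]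
    refine hint.congr_fun (fun t ht => ?_) measurableSet_Ioi
    have ht' : 0 ≤ t := le_of_lt ht
    simp only [hℓ', max_eq_left ht']
  have hlint : ∫⁻ ω, D (τ ω) ∂P = ∫⁻ t, ENNReal.ofReal (ℓ' t) ∂expMeasure (δ + lam) := by
    have e1 : ∫⁻ ω, D (τ ω) ∂P = ∫⁻ t, D t ∂expMeasure lam := by
      rw [← hlaw, lintegral_map hDm hτ]
    have hm : Measurable fun t => ENNReal.ofReal (ℓ' t) := by fun_prop
    -- The discounting time and the claim time are merged: their minimum is exponential with
    -- parameter `δ + lam`.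
    rw [e1, ← map_min_expMeasure hδ hlam, lintegral_map hm (by fun_prop),
      lintegral_prod_symm' (fun x : ℝ × ℝ => ENNReal.ofReal (ℓ' (min x.1 x.2))) (by fun_prop)]
  have hfin : ∫⁻ ω, D (τ ω) ∂P ≠ ∞ := by
    rw [hlint]
    exact hint'.lintegral_lt_top.ne
  have hDτ : Measurable fun ω => D (τ ω) := hDm.comp hτ
  have hae' : (fun ω => (discountedDividends δ (fun t => L t ω) (ENNReal.ofReal (τ ω))).toReal)
      =ᵐ[P] fun ω => (D (τ ω)).toReal := hae.fun_comp ENNReal.toReal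
  refine ⟨(integrable_toReal_of_lintegral_ne_top hDτ.aemeasurable hfin).congr hae'.symm, ?_⟩
  rw [integral_congr_ae hae', integral_toReal hDτ.aemeasurable (ae_lt_top hDτ hfin), hlint,
    ← integral_eq_lintegral_of_nonneg_ae (Eventually.of_forall hℓ'0)
      hℓ'c.measurable.aestronglyMeasurable, integral_expMeasure hq]
  refine setIntegral_congr_fun measurableSet_Ioi fun t ht => ?_
  have ht' : 0 ≤ t := le_of_lt ht
  simp only [hℓ', max_eq_left ht']

end DiscountedDividends

/-! ### Stand-alone values, and the claims up to the first one -/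

variable {Ω : Type*} [MeasurableSpace Ω]

lemma Company.ae_nonneg (c : Company) : ∀ᵐ α ∂c.claimLaw, 0 ≤ α := by
  have h := c.claim_nonneg
  rw [ae_iff]
  convert! h using 2
  ext α
  simp

lemma Company.premium_pos (c : Company) : 0 < c.premium :=
  (mul_nonneg c.intensity_pos.le (integral_nonneg_of_ae c.ae_nonneg)).trans_lt c.net_profit

lemma discountedDividends_mono {δ : ℝ} (ℓ : ℝ≥0 → ℝ) {τ τ' : ℝ≥0∞} (h : τ ≤ τ') :
    discountedDividends δ ℓ τ ≤ discountedDividends δ ℓ τ' := by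
  unfold discountedDividends
  split_ifs
  · exact lintegral_mono_set fun s hs => ⟨hs.1, hs.2.trans_le h⟩
  · exact le_rfl

namespace Claims

variable {c : Company} {P : Measure Ω} (D : Claims c P)

lemma net_le (t : ℝ≥0) (ω : Ω) : D.net t ω ≤ c.premium * t :=
  sub_le_self _ ENNReal.toReal_nonneg

lemma ruinTime_mono {x y : ℝ} (hxy : x ≤ y) (L : ℝ≥0 → Ω → ℝ) (ω : Ω) :
    D.ruinTime x L ω ≤ D.ruinTime y L ω := by
  refine sInf_le_sInf (image_mono fun t ht => ?_)
  have ht' : y + D.net t ω - L t ω < 0 := ht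
  change x + D.net t ω - L t ω < 0
  linarith

variable {D} in
-- Before ruin the surplus is nonnegative by the very definition of the ruin time as an infimum, so
-- the constraint in admissibility is automatic and does not depend on the initial level.
lemma IsAdmissible.of_level {x : ℝ} (y : ℝ) {L : ℝ≥0 → Ω → ℝ} (hL : D.IsAdmissible x L) :
    D.IsAdmissible y L where
  toIsDividendProcess := hL.toIsDividendProcess
  le_surplus ω t ht := by
    by_contra! h
    refine ht.not_ge (sInf_le ⟨t, ?_, rfl⟩)
    change y + D.net t ω - L t ω < 0
    linarith

/-- The supremum in the definition of the optimal value is finite. -/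
lemma iSup_dividends_ne_top [IsProbabilityMeasure P] {δ x : ℝ} (hδ : 0 < δ) (hx : 0 ≤ x) :
    (⨆ (L : ℝ≥0 → Ω → ℝ) (_ : D.IsAdmissible x L),
      ∫⁻ ω, discountedDividends δ (fun t => L t ω) (D.ruinTime x L ω) ∂P) ≠ ∞ := by
  refine ((iSup₂_le fun L hL => ?_).trans_lt
    (lintegral_affine_expMeasure_lt_top hδ hx c.premium_pos.le)).ne
  refine (lintegral_mono fun ω => discountedDividends_le hδ (hL.mono ω)
    (hL.left_continuous ω) (hL.zero ω) hx c.premium_pos.le fun t ht => ?_).trans ?_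
  · exact (hL.le_surplus ω t ht).trans (by linarith [D.net_le t ω])
  · simp

lemma optimalValue_nonneg (δ x : ℝ) : 0 ≤ D.optimalValue δ x := by
  unfold optimalValue
  split_ifs
  · exact le_rfl
  · exact ENNReal.toReal_nonneg

/-- A larger initial level keeps every strategy admissible and delays ruin; finiteness of the
supremum is needed for `toReal` to preserve the order. Monotonicity later supplies measurability and
local bounds for the stand-alone values. -/
lemma optimalValue_mono [IsProbabilityMeasure P] {δ : ℝ} (hδ : 0 < δ) :
    Monotone (D.optimalValue δ) := by
  intro x y hxy
  by_cases hx : x < 0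
  · refine le_trans ?_ (D.optimalValue_nonneg δ y)
    unfold optimalValue
    rw [if_pos hx]
  · push Not at hx
    unfold optimalValue
    rw [if_neg hx.not_gt, if_neg (hx.trans hxy).not_gt]
    refine ENNReal.toReal_mono (D.iSup_dividends_ne_top hδ (hx.trans hxy)) ?_
    refine iSup₂_le fun L hL => le_iSup₂_of_le L (hL.of_level y) ?_
    exact lintegral_mono fun ω => discountedDividends_mono _ (D.ruinTime_mono hxy L ω)

lemma optimalValue_of_neg {δ x : ℝ} (hx : x < 0) : D.optimalValue δ x = 0 := if_pos hx

lemma ae_wait_pos : ∀ᵐ ω ∂P, ∀ i, 0 < D.wait i ω := by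
  refine ae_all_iff.2 fun i => ?_
  have := ae_expMeasure_pos c.intensity
  rw [← D.law_wait i] at this
  exact ae_of_ae_map (D.measurable_wait i).aemeasurable this

lemma ae_size_nonneg (i : ℕ) : ∀ᵐ ω ∂P, 0 ≤ D.size i ω := by
  have := c.ae_nonneg
  rw [← D.law_size i] at this
  exact ae_of_ae_map (D.measurable_size i).aemeasurable this

lemma arrival_zero (ω : Ω) : D.arrival 0 ω = D.wait 0 ω := by simp [arrival]

lemma arrival_zero_lt {ω : Ω} (h : ∀ i, 0 < D.wait i ω) {i : ℕ} (hi : i ≠ 0) :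
    D.arrival 0 ω < D.arrival i ω := by
  refine Finset.sum_lt_sum_of_subset (i := i) ?_ ?_ ?_ (h i) fun j _ _ => (h j).le
  · exact Finset.range_mono (by omega)
  · simp
  · simpa using hi

lemma arrival_zero_le {ω : Ω} (h : ∀ i, 0 < D.wait i ω) (i : ℕ) :
    D.arrival 0 ω ≤ D.arrival i ω := by
  rcases eq_or_ne i 0 with rfl | hi
  · exact le_rfl
  · exact (D.arrival_zero_lt h hi).le

lemma net_of_lt {ω : Ω} (h : ∀ i, 0 < D.wait i ω) {t : ℝ≥0} (ht : (t : ℝ) < D.arrival 0 ω) :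
    D.net t ω = c.premium * t := by
  have : ∀ i, {ω' | D.arrival i ω' ≤ t}.indicator
      (fun ω' => ENNReal.ofReal (D.size i ω')) ω = 0 := fun i => by
    refine indicator_of_notMem (fun h' => ?_) _
    have h'' : D.arrival i ω ≤ t := h'
    exact (ht.trans_le (D.arrival_zero_le h i)).not_ge h''
  simp [net, total, this]

/-- All later arrivals are strictly later because waiting times are positive, so exactly one term of
the series survives. -/
lemma net_of_eq {ω : Ω} (h : ∀ i, 0 < D.wait i ω) (hs : 0 ≤ D.size 0 ω) {t : ℝ≥0}
    (ht : (t : ℝ) = D.arrival 0 ω) : D.net t ω = c.premium * t - D.size 0 ω := by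
  unfold net total
  rw [tsum_eq_single 0 fun i hi => indicator_of_notMem (fun h' => ?_) _,
    indicator_of_mem (by exact ht.ge), ENNReal.toReal_ofReal hs]
  have h'' : D.arrival i ω ≤ t := h'
  exact (D.arrival_zero_lt h hi).not_ge (h''.trans_eq ht)

end Claims

/-! ### The value after the first claim and the function `H` -/

namespace Model

variable {P : Measure Ω} (S : Model P)

lemma p₁_pos : 0 < S.p₁ := S.company₁.premium_pos
lemma p₂_pos : 0 < S.p₂ := S.company₂.premium_pos
lemma lam₁_pos : 0 < S.lam₁ := S.company₁.intensity_pos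
lemma lam₂_pos : 0 < S.lam₂ := S.company₂.intensity_pos
lemma lam_pos : 0 < S.lam := add_pos S.lam₁_pos S.lam₂_pos
lemma a₁_nonneg : 0 ≤ S.a₁ := S.a₁_mem.1
lemma a₂_nonneg : 0 ≤ S.a₂ := sub_nonneg.2 S.a₁_mem.2

instance isProbabilityMeasure_F₁ : IsProbabilityMeasure S.F₁ := S.company₁.isProbabilityMeasure
instance isProbabilityMeasure_F₂ : IsProbabilityMeasure S.F₂ := S.company₂.isProbabilityMeasure

/-- The value after the first claim, as a function of the surpluses before the deficit is covered. -/
noncomputable def exitValue (W₀ : ℝ × ℝ → ℝ) (w : ℝ × ℝ) : ℝ :=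
  if 0 ≤ w.1 + w.2 then W₀ (coverDeficit w) else S.a₁ * S.V₁ w.1 + S.a₂ * S.V₂ w.2

lemma coverDeficit_mem {w : ℝ × ℝ} (hw : 0 ≤ w.1 + w.2) :
    coverDeficit w ∈ quadrant ∧ (coverDeficit w).1 + (coverDeficit w).2 = w.1 + w.2 := by
  unfold coverDeficit
  split_ifs with h1 h2
  · exact ⟨⟨le_rfl, hw⟩, by simp⟩
  · exact ⟨⟨hw, le_rfl⟩, by simp⟩
  · exact ⟨⟨not_lt.1 h1, not_lt.1 h2⟩, rfl⟩

lemma measurable_coverDeficit : Measurable coverDeficit := by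
  unfold coverDeficit
  refine Measurable.ite (measurableSet_lt (by fun_prop) (by fun_prop)) (by fun_prop) ?_
  exact Measurable.ite (measurableSet_lt (by fun_prop) (by fun_prop)) (by fun_prop) (by fun_prop)

lemma isClosed_quadrant : IsClosed quadrant :=
  (isClosed_le continuous_const continuous_fst).inter (isClosed_le continuous_const continuous_snd)

variable [IsProbabilityMeasure P] {W₀ : ℝ × ℝ → ℝ}

lemma V₁_mono : Monotone S.V₁ := S.claims₁.optimalValue_mono S.δ_pos
lemma V₂_mono : Monotone S.V₂ := S.claims₂.optimalValue_mono S.δ_pos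
omit [IsProbabilityMeasure P] in
lemma V₁_nonneg (x : ℝ) : 0 ≤ S.V₁ x := S.claims₁.optimalValue_nonneg _ _
omit [IsProbabilityMeasure P] in
lemma V₂_nonneg (x : ℝ) : 0 ≤ S.V₂ x := S.claims₂.optimalValue_nonneg _ _

lemma measurable_exitValue (hW₀ : ContinuousOn W₀ quadrant) : Measurable (S.exitValue W₀) := by
  classical
  -- Only the values of `W₀` on the quadrant are controlled; covering a deficit always lands there,
  -- so `W₀` may be replaced by its extension by zero.
  have hW : Measurable (quadrant.indicator W₀) :=
    by
    rw [← piecewise_eq_indicator]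
    exact hW₀.measurable_piecewise continuousOn_const isClosed_quadrant.measurableSet
  have e : S.exitValue W₀ = fun w => if 0 ≤ w.1 + w.2 then quadrant.indicator W₀ (coverDeficit w)
      else S.a₁ * S.V₁ w.1 + S.a₂ * S.V₂ w.2 := by
    funext w
    unfold exitValue
    split_ifs with h
    · rw [indicator_of_mem (coverDeficit_mem h).1]
    · rfl
  rw [e]
  have h1 := S.V₁_mono.measurable
  have h2 := S.V₂_mono.measurable
  have h3 := measurable_coverDeficit
  exact Measurable.ite (measurableSet_le (by fun_prop) (by fun_prop)) (by fun_prop) (by fun_prop)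

/-- Covering a deficit preserves the sum of the surpluses, so a surviving pair ends up in a compact
part of the quadrant where `W₀` is bounded; after ruin the monotone stand-alone values are bounded
by their values at `R`. -/
lemma exists_exitValue_le (hW₀ : ContinuousOn W₀ quadrant) (R : ℝ) :
    ∃ C, ∀ w : ℝ × ℝ, w.1 ≤ R → w.2 ≤ R → w.1 + w.2 ≤ R → ‖S.exitValue W₀ w‖ ≤ C := by
  set K : Set (ℝ × ℝ) := quadrant ∩ {w | w.1 + w.2 ≤ R}
  have hK : IsCompact K := by
    refine (isCompact_Icc (a := ((0 : ℝ), (0 : ℝ))) (b := (R, R))).of_isClosed_subset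
      (isClosed_quadrant.inter (isClosed_le (by fun_prop) (by fun_prop))) ?_
    rintro w ⟨⟨h1, h2⟩, h3⟩
    have h3' : w.1 + w.2 ≤ R := h3
    exact ⟨⟨h1, h2⟩, ⟨by simp only; linarith, by simp only; linarith⟩⟩
  obtain ⟨C, hC⟩ := hK.exists_bound_of_continuousOn (hW₀.mono inter_subset_left)
  refine ⟨max C (S.a₁ * S.V₁ R + S.a₂ * S.V₂ R), fun w h1 h2 h3 => ?_⟩
  unfold exitValue
  split_ifs with h
  · obtain ⟨h4, h5⟩ := coverDeficit_mem h
    exact (hC _ ⟨h4, h5.trans_le h3⟩).trans (le_max_left _ _)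
  · refine le_trans ?_ (le_max_right _ _)
    have g1 := mul_nonneg S.a₁_nonneg (S.V₁_nonneg w.1)
    have g2 := mul_nonneg S.a₂_nonneg (S.V₂_nonneg w.2)
    rw [Real.norm_of_nonneg (add_nonneg g1 g2)]
    exact add_le_add (mul_le_mul_of_nonneg_left (S.V₁_mono h1) S.a₁_nonneg)
      (mul_le_mul_of_nonneg_left (S.V₂_mono h2) S.a₂_nonneg)

/-- Decomposition of the mean of a bounded function of a nonnegative random variable. -/
lemma integral_eq_add_add {F : Measure ℝ} [IsProbabilityMeasure F] (hF : ∀ᵐ α ∂F, 0 ≤ α)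
    {f : ℝ → ℝ} (hf : Integrable f F) {x s : ℝ} (hx : 0 ≤ x) (hxs : x ≤ s) :
    ∫ α, f α ∂F = ∫ α in Icc 0 x, f α ∂F + ∫ α in Ioc x s, f α ∂F + ∫ α in Ioi s, f α ∂F := by
  have h1 : ∫ α, f α ∂F = ∫ α in Ici 0, f α ∂F := by
    rw [Measure.restrict_eq_self_of_ae_mem]
    exact hF
  have h2 : Icc 0 x ∪ Ioc x s = Icc 0 s := Icc_union_Ioc_eq_Icc hx hxs
  have h3 : Icc 0 s ∪ Ioi s = Ici 0 := Icc_union_Ioi_eq_Ici (hx.trans hxs)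
  rw [h1, ← h3, setIntegral_union _ measurableSet_Ioi hf.integrableOn hf.integrableOn, ← h2,
    setIntegral_union _ measurableSet_Ioc hf.integrableOn hf.integrableOn]
  · exact disjoint_left.2 fun a ha hb => hb.1.not_ge ha.2
  · exact disjoint_left.2 fun a ha hb => ha.2.not_gt hb

lemma one_sub_cdf (F : Measure ℝ) [IsProbabilityMeasure F] (s : ℝ) :
    1 - cdf F s = F.real (Ioi s) := by
  rw [cdf_eq_real, ← compl_Iic, probReal_compl_eq_one_sub measurableSet_Iic]

/-- The three ranges of the claim size are: no deficit, a deficit covered by the other company, and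
ruin. Writing `max α 0` for the claim alters nothing almost surely, and makes the integrands bounded
for every `α`. -/
lemma H_eq (hW₀ : ContinuousOn W₀ quadrant) {z : ℝ × ℝ} (hz : z ∈ quadrant) :
    S.H W₀ z.1 z.2 = S.lam₁ * (∫ α, S.exitValue W₀ (z.1 - max α 0, z.2) ∂S.F₁)
      + S.lam₂ * ∫ α, S.exitValue W₀ (z.1, z.2 - max α 0) ∂S.F₂ := by
  obtain ⟨x, y⟩ := z
  obtain ⟨hx, hy⟩ := hz
  simp only at hx hy ⊢
  obtain ⟨C, hC⟩ := S.exists_exitValue_le hW₀ (x + y)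
  have hm := S.measurable_exitValue hW₀
  have i1 : Integrable (fun α => S.exitValue W₀ (x - max α 0, y)) S.F₁ := by
    refine Integrable.of_bound (C := C) (Measurable.aestronglyMeasurable (by fun_prop))
      (Eventually.of_forall fun α => ?_)
    have := le_max_right α 0
    exact hC _ (by simp only; linarith) (by simp only; linarith) (by simp only; linarith)
  have i2 : Integrable (fun α => S.exitValue W₀ (x, y - max α 0)) S.F₂ := by
    refine Integrable.of_bound (C := C) (Measurable.aestronglyMeasurable (by fun_prop))
      (Eventually.of_forall fun α => ?_)
    have := le_max_right α 0
    exact hC _ (by simp only; linarith) (by simp only; linarith) (by simp only; linarith)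
  have a1 : ∫ α in Icc 0 x, S.exitValue W₀ (x - max α 0, y) ∂S.F₁
      = ∫ α in Icc 0 x, W₀ (x - α, y) ∂S.F₁ := by
    refine setIntegral_congr_fun measurableSet_Icc fun α hα => ?_
    have h1 : ¬ x - α < 0 := by linarith [hα.2]
    simp only [exitValue, coverDeficit, max_eq_left hα.1]
    rw [if_pos (by linarith), if_neg h1, if_neg hy.not_gt]
  have a2 : ∫ α in Ioc x (x + y), S.exitValue W₀ (x - max α 0, y) ∂S.F₁
      = ∫ α in Ioc x (x + y), W₀ (0, x + y - α) ∂S.F₁ := by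
    refine setIntegral_congr_fun measurableSet_Ioc fun α hα => ?_
    have h1 : x - α < 0 := by linarith [hα.1]
    have h2 : x - α + y = x + y - α := by ring
    simp only [exitValue, coverDeficit, max_eq_left (hx.trans hα.1.le)]
    rw [if_pos (by linarith [hα.2]), if_pos h1, h2]
  have a3 : ∫ α in Ioi (x + y), S.exitValue W₀ (x - max α 0, y) ∂S.F₁
      = S.a₂ * S.V₂ y * (1 - cdf S.F₁ (x + y)) := by
    rw [setIntegral_congr_fun measurableSet_Ioi (g := fun _ => S.a₂ * S.V₂ y) fun α hα => ?_,
      setIntegral_const, one_sub_cdf, smul_eq_mul, mul_comm]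
    have hα' : x + y < α := hα
    -- The company that suffered the ruinous claim has a negative surplus, so only the other
    -- stand-alone value remains.
    have h3 : S.V₁ (x - α) = 0 := S.claims₁.optimalValue_of_neg (by linarith)
    simp only [exitValue, max_eq_left (show (0 : ℝ) ≤ α by linarith), h3]
    rw [if_neg (by linarith)]
    ring
  have b1 : ∫ α in Icc 0 y, S.exitValue W₀ (x, y - max α 0) ∂S.F₂
      = ∫ α in Icc 0 y, W₀ (x, y - α) ∂S.F₂ := by
    refine setIntegral_congr_fun measurableSet_Icc fun α hα => ?_
    have h1 : ¬ y - α < 0 := by linarith [hα.2]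
    simp only [exitValue, coverDeficit, max_eq_left hα.1]
    rw [if_pos (by linarith), if_neg hx.not_gt, if_neg h1]
  have b2 : ∫ α in Ioc y (x + y), S.exitValue W₀ (x, y - max α 0) ∂S.F₂
      = ∫ α in Ioc y (x + y), W₀ (x + y - α, 0) ∂S.F₂ := by
    refine setIntegral_congr_fun measurableSet_Ioc fun α hα => ?_
    have h1 : y - α < 0 := by linarith [hα.1]
    have h2 : x + (y - α) = x + y - α := by ring
    simp only [exitValue, coverDeficit, max_eq_left (hy.trans hα.1.le)]
    rw [if_pos (by linarith [hα.2]), if_neg hx.not_gt, if_pos h1, h2]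
  have b3 : ∫ α in Ioi (x + y), S.exitValue W₀ (x, y - max α 0) ∂S.F₂
      = S.a₁ * S.V₁ x * (1 - cdf S.F₂ (x + y)) := by
    rw [setIntegral_congr_fun measurableSet_Ioi (g := fun _ => S.a₁ * S.V₁ x) fun α hα => ?_,
      setIntegral_const, one_sub_cdf, smul_eq_mul, mul_comm]
    have hα' : x + y < α := hα
    have h3 : S.V₂ (y - α) = 0 := S.claims₂.optimalValue_of_neg (by linarith)
    simp only [exitValue, max_eq_left (show (0 : ℝ) ≤ α by linarith), h3]
    rw [if_neg (by linarith)]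
    ring
  have n1 : ∀ᵐ α ∂S.F₁, 0 ≤ α := S.company₁.ae_nonneg
  have n2 : ∀ᵐ α ∂S.F₂, 0 ≤ α := S.company₂.ae_nonneg
  rw [integral_eq_add_add n1 i1 hx (by linarith : x ≤ x + y),
    integral_eq_add_add n2 i2 hy (by linarith : y ≤ x + y), a1, a2, a3, b1, b2,
    b3]
  simp only [H, opI, U]
  ring

end Model

/-! ### The first claim and the expected payoff -/

/-- An expectation on the event that the first of two exponential times comes first, where the times
and the claim size are independent. -/
lemma integral_ite_lt_of_law {P : Measure Ω} {a b C : ℝ} (ha : 0 < a) (hb : 0 < b)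
    {F : Measure ℝ} [IsProbabilityMeasure F] {X Y V : Ω → ℝ} (hX : Measurable X)
    (hY : Measurable Y) (hV : Measurable V)
    (hlaw : P.map (fun ω => (X ω, (Y ω, V ω))) = (expMeasure a).prod ((expMeasure b).prod F))
    {φ : ℝ × ℝ → ℝ} (hφ : Measurable φ) (hC : ∀ x, ‖φ x‖ ≤ C) :
    Integrable (fun ω => if X ω < Y ω then φ (X ω, V ω) else 0) P ∧
    ∫ ω, (if X ω < Y ω then φ (X ω, V ω) else 0) ∂P
      = ∫ t in Ioi 0, a * Real.exp (-(a + b) * t) * ∫ α, φ (t, α) ∂F ∧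
    IntegrableOn (fun t => a * Real.exp (-(a + b) * t) * ∫ α, φ (t, α) ∂F) (Ioi 0) := by
  obtain ⟨h1, h2, h3⟩ := integral_ite_lt_expMeasure ha hb (F := F) hφ hC
  have hm : Measurable fun ω => (X ω, (Y ω, V ω)) := by fun_prop
  rw [← hlaw] at h1 h2
  refine ⟨h1.comp_measurable hm, ?_, h3⟩
  rw [← h2, integral_map hm.aemeasurable h1.aestronglyMeasurable]

namespace Model

variable {P : Measure Ω} (S : Model P)

lemma measurable_family (i : (ℕ ⊕ ℕ) ⊕ (ℕ ⊕ ℕ)) :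
    Measurable (Sum.elim (Sum.elim S.claims₁.wait S.claims₁.size)
      (Sum.elim S.claims₂.wait S.claims₂.size) i) := by
  rcases i with (i | i) | (i | i)
  exacts [S.claims₁.measurable_wait i, S.claims₁.measurable_size i, S.claims₂.measurable_wait i,
    S.claims₂.measurable_size i]

variable [IsProbabilityMeasure P]

lemma map_wait_wait : P.map (fun ω => (S.claims₁.wait 0 ω, S.claims₂.wait 0 ω))
    = (expMeasure S.lam₁).prod (expMeasure S.lam₂) := by
  have h : IndepFun (S.claims₁.wait 0) (S.claims₂.wait 0) P :=
    S.indep.indepFun (i := Sum.inl (Sum.inl 0)) (j := Sum.inr (Sum.inl 0)) (by simp)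
  rw [h.map_prod_eq_prod_map_map (S.claims₁.measurable_wait 0).aemeasurable
    (S.claims₂.measurable_wait 0).aemeasurable, S.claims₁.law_wait, S.claims₂.law_wait]
  rfl

lemma map_first_second_size₁ :
    P.map (fun ω => (S.claims₁.wait 0 ω, (S.claims₂.wait 0 ω, S.claims₁.size 0 ω)))
      = (expMeasure S.lam₁).prod ((expMeasure S.lam₂).prod S.F₁) := by
  have h1 : IndepFun (S.claims₂.wait 0) (S.claims₁.size 0) P :=
    S.indep.indepFun (i := Sum.inr (Sum.inl 0)) (j := Sum.inl (Sum.inr 0)) (by simp)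
  have h2 : IndepFun (S.claims₁.wait 0) (fun ω => (S.claims₂.wait 0 ω, S.claims₁.size 0 ω)) P :=
    (S.indep.indepFun_prodMk S.measurable_family (Sum.inr (Sum.inl 0)) (Sum.inl (Sum.inr 0))
      (Sum.inl (Sum.inl 0)) (by simp) (by simp)).symm
  have m1 := S.claims₁.measurable_wait 0
  have m2 := S.claims₂.measurable_wait 0
  have m3 := S.claims₁.measurable_size 0
  rw [h2.map_prod_eq_prod_map_map m1.aemeasurable (m2.prodMk m3).aemeasurable,
    h1.map_prod_eq_prod_map_map m2.aemeasurable m3.aemeasurable, S.claims₁.law_wait,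
    S.claims₂.law_wait, S.claims₁.law_size]
  rfl

lemma map_first_second_size₂ :
    P.map (fun ω => (S.claims₂.wait 0 ω, (S.claims₁.wait 0 ω, S.claims₂.size 0 ω)))
      = (expMeasure S.lam₂).prod ((expMeasure S.lam₁).prod S.F₂) := by
  have h1 : IndepFun (S.claims₁.wait 0) (S.claims₂.size 0) P :=
    S.indep.indepFun (i := Sum.inl (Sum.inl 0)) (j := Sum.inr (Sum.inr 0)) (by simp)
  have h2 : IndepFun (S.claims₂.wait 0) (fun ω => (S.claims₁.wait 0 ω, S.claims₂.size 0 ω)) P :=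
    (S.indep.indepFun_prodMk S.measurable_family (Sum.inl (Sum.inl 0)) (Sum.inr (Sum.inr 0))
      (Sum.inr (Sum.inl 0)) (by simp) (by simp)).symm
  have m1 := S.claims₂.measurable_wait 0
  have m2 := S.claims₁.measurable_wait 0
  have m3 := S.claims₂.measurable_size 0
  rw [h2.map_prod_eq_prod_map_map m1.aemeasurable (m2.prodMk m3).aemeasurable,
    h1.map_prod_eq_prod_map_map m2.aemeasurable m3.aemeasurable, S.claims₁.law_wait,
    S.claims₂.law_wait, S.claims₂.law_size]
  rfl

omit [IsProbabilityMeasure P] in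
lemma firstClaim_eq (ω : Ω) :
    S.firstClaim ω = min (S.claims₁.wait 0 ω) (S.claims₂.wait 0 ω) := by
  rw [firstClaim, Claims.arrival_zero, Claims.arrival_zero]

omit [IsProbabilityMeasure P] in
lemma measurable_firstClaim : Measurable S.firstClaim :=
  (S.claims₁.measurable_arrival 0).min (S.claims₂.measurable_arrival 0)

lemma map_firstClaim : P.map S.firstClaim = expMeasure S.lam := by
  have e : S.firstClaim = (fun x : ℝ × ℝ => min x.1 x.2) ∘
      fun ω => (S.claims₁.wait 0 ω, S.claims₂.wait 0 ω) := by
    funext ω; exact S.firstClaim_eq ω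
  have m1 := S.claims₁.measurable_wait 0
  have m2 := S.claims₂.measurable_wait 0
  rw [e, ← Measure.map_map (by fun_prop) (by fun_prop), S.map_wait_wait,
    map_min_expMeasure S.lam₁_pos S.lam₂_pos]
  rfl

/-- Simultaneous first claims are negligible because exponential laws have no atoms; hence almost
surely exactly one company is hit at the first claim. -/
lemma ae_wait_ne : ∀ᵐ ω ∂P, S.claims₁.wait 0 ω ≠ S.claims₂.wait 0 ω := by
  have := isProbabilityMeasure_expMeasure S.lam₁_pos
  have := isProbabilityMeasure_expMeasure S.lam₂_pos
  have h : ∀ᵐ x ∂(expMeasure S.lam₁).prod (expMeasure S.lam₂), x.1 ≠ x.2 := by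
    have hm : MeasurableSet {x : ℝ × ℝ | x.1 ≠ x.2} :=
      (measurableSet_eq_fun measurable_fst measurable_snd).compl
    rw [Measure.ae_prod_iff_ae_ae hm]
    refine Eventually.of_forall fun s => ?_
    have : ∀ᵐ y ∂expMeasure S.lam₂, y ∈ ({s} : Set ℝ)ᶜ :=
      compl_mem_ae_iff.2 (expMeasure_singleton _ _)
    filter_upwards [this] with y hy
    exact fun h => hy h.symm
  rw [← S.map_wait_wait] at h
  exact ae_of_ae_map ((S.claims₁.measurable_wait 0).prodMk
    (S.claims₂.measurable_wait 0)).aemeasurable h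

lemma ae_regular : ∀ᵐ ω ∂P, 0 < S.firstClaim ω ∧ (∀ i, 0 < S.claims₁.wait i ω) ∧
    (∀ i, 0 < S.claims₂.wait i ω) ∧ 0 ≤ S.claims₁.size 0 ω ∧ 0 ≤ S.claims₂.size 0 ω ∧
    S.claims₁.wait 0 ω ≠ S.claims₂.wait 0 ω := by
  filter_upwards [S.claims₁.ae_wait_pos, S.claims₂.ae_wait_pos, S.claims₁.ae_size_nonneg 0,
    S.claims₂.ae_size_nonneg 0, S.ae_wait_ne] with ω h1 h2 h3 h4 h5
  exact ⟨by rw [firstClaim_eq]; exact lt_min (h1 0) (h2 0), h1, h2, h3, h4, h5⟩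

variable {W₀ : ℝ × ℝ → ℝ} {z : ℝ × ℝ} {Z : ℝ → ℝ × ℝ}

/-- The payoff up to the first claim of dividends that follow a deterministic path until then. -/
lemma expected_payoff (hW₀ : ContinuousOn W₀ quadrant) (hZ : IsSurplusPath S.p₁ S.p₂ z Z)
    {L₁ L₂ : ℝ≥0 → Ω → ℝ} (hL₁ : IsDividendProcess S.filtration L₁)
    (hL₂ : IsDividendProcess S.filtration L₂)
    (hL : ∀ᵐ ω ∂P, ∀ t : ℝ≥0, 0 < t → (t : ℝ) ≤ S.firstClaim ω →
      L₁ t ω = z.1 + S.p₁ * t - (Z t).1 ∧ L₂ t ω = z.2 + S.p₂ * t - (Z t).2) :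
    Integrable (S.oneStepPayoff W₀ z L₁ L₂) P ∧
    IntegrableOn (fun t => Real.exp (-(S.δ + S.lam) * t) * S.H W₀ (Z t).1 (Z t).2) (Ioi 0) ∧
    S.oneStepValue W₀ z L₁ L₂
      = (∫ t in Ioi 0, (S.δ + S.lam) * Real.exp (-(S.δ + S.lam) * t) *
          (S.a₁ * (z.1 + S.p₁ * t - (Z t).1) + S.a₂ * (z.2 + S.p₂ * t - (Z t).2)))
        + ∫ t in Ioi 0, Real.exp (-(S.δ + S.lam) * t) * S.H W₀ (Z t).1 (Z t).2 := by
  have hq : 0 < S.δ + S.lam := add_pos S.δ_pos S.lam_pos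
  have c1 : ContinuousOn (fun t => z.1 + S.p₁ * t - (Z t).1) (Ici 0) :=
    (by fun_prop : Continuous fun t => z.1 + S.p₁ * t).continuousOn.sub hZ.continuousOn.fst
  have c2 : ContinuousOn (fun t => z.2 + S.p₂ * t - (Z t).2) (Ici 0) :=
    (by fun_prop : Continuous fun t => z.2 + S.p₂ * t).continuousOn.sub hZ.continuousOn.snd
  have j1 := hZ.integrableOn_fst S.p₁_pos hq
  have j2 := hZ.integrableOn_snd S.p₂_pos hq
  obtain ⟨d1, e1⟩ := integral_discountedDividends S.δ_pos S.lam_pos S.measurable_firstClaim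
    S.map_firstClaim hL₁ c1 (fun t ht => hZ.fst_nonneg ht)
    (hL.mono fun ω h t ht h' => (h t ht h').1) j1
  obtain ⟨d2, e2⟩ := integral_discountedDividends S.δ_pos S.lam_pos S.measurable_firstClaim
    S.map_firstClaim hL₂ c2 (fun t ht => hZ.snd_nonneg ht)
    (hL.mono fun ω h t ht h' => (h t ht h').2) j2
  -- the value after the first claim
  set Zc : ℝ → ℝ × ℝ := fun t => Z (max t 0) with hZc
  have hZcc : Continuous Zc := hZ.continuousOn.comp_continuous (by fun_prop) fun t => le_max_right t 0
  have hZcm : Measurable Zc := hZcc.measurable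
  have hZq : ∀ t, Zc t ∈ quadrant := fun t => hZ.mem_quadrant _ (le_max_right t 0)
  obtain ⟨R, hR⟩ := hZ.bounded
  have hR' : ∀ t, (Zc t).1 + (Zc t).2 ≤ R := fun t => hR _ (le_max_right t 0)
  obtain ⟨C, hC⟩ := S.exists_exitValue_le hW₀ R
  have hΦ := S.measurable_exitValue hW₀
  -- Discounted value after a claim on Company One, as a function of its time and size; `φ₂` is the
  -- same for Company Two. The truncations at zero only serve to make both bounded and measurable
  -- everywhere.
  set φ₁ : ℝ × ℝ → ℝ := fun x => Real.exp (-S.δ * max x.1 0) *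
    S.exitValue W₀ ((Zc x.1).1 - max x.2 0, (Zc x.1).2) with hφ₁
  set φ₂ : ℝ × ℝ → ℝ := fun x => Real.exp (-S.δ * max x.1 0) *
    S.exitValue W₀ ((Zc x.1).1, (Zc x.1).2 - max x.2 0) with hφ₂
  have m1 : Measurable φ₁ := by fun_prop
  have m2 : Measurable φ₂ := by fun_prop
  have hexp : ∀ t : ℝ, ‖Real.exp (-S.δ * max t 0)‖ ≤ 1 := fun t => by
    rw [Real.norm_of_nonneg (Real.exp_pos _).le, Real.exp_le_one_iff]
    nlinarith [S.δ_pos, le_max_right t 0]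
  have b1 : ∀ x, ‖φ₁ x‖ ≤ 1 * C := fun x => by
    rw [hφ₁]
    simp only [norm_mul]
    have h1 := hZq x.1
    have h2 := hR' x.1
    have h3 := le_max_right x.2 0
    refine mul_le_mul (hexp _) (hC _ ?_ ?_ ?_) (norm_nonneg _) zero_le_one <;> simp only <;>
      linarith [h1.1, h1.2]
  have b2 : ∀ x, ‖φ₂ x‖ ≤ 1 * C := fun x => by
    rw [hφ₂]
    simp only [norm_mul]
    have h1 := hZq x.1
    have h2 := hR' x.1
    have h3 := le_max_right x.2 0
    refine mul_le_mul (hexp _) (hC _ ?_ ?_ ?_) (norm_nonneg _) zero_le_one <;> simp only <;>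
      linarith [h1.1, h1.2]
  obtain ⟨i1, v1, k1⟩ := integral_ite_lt_of_law S.lam₁_pos S.lam₂_pos
    (S.claims₁.measurable_wait 0) (S.claims₂.measurable_wait 0) (S.claims₁.measurable_size 0)
    S.map_first_second_size₁ m1 b1
  obtain ⟨i2, v2, k2⟩ := integral_ite_lt_of_law S.lam₂_pos S.lam₁_pos
    (S.claims₂.measurable_wait 0) (S.claims₁.measurable_wait 0) (S.claims₂.measurable_size 0)
    S.map_first_second_size₂ m2 b2
  -- The arrival densities of the two companies share the factor `e^{-lam t}`; with the discount it
  -- becomes `e^{-(δ + lam) t}`, and the claim size averages add up to `H`.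
  have hH : EqOn (fun t => S.lam₁ * Real.exp (-(S.lam₁ + S.lam₂) * t) * ∫ α, φ₁ (t, α) ∂S.F₁
      + S.lam₂ * Real.exp (-(S.lam₂ + S.lam₁) * t) * ∫ α, φ₂ (t, α) ∂S.F₂)
      (fun t => Real.exp (-(S.δ + S.lam) * t) * S.H W₀ (Z t).1 (Z t).2) (Ioi 0) := fun t ht => by
    have ht' : 0 ≤ t := le_of_lt ht
    simp only [hφ₁, hφ₂, hZc, max_eq_left ht', integral_const_mul]
    rw [S.H_eq hW₀ (hZ.mem_quadrant t ht')]
    have h1 : Real.exp (-(S.δ + S.lam) * t)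
        = Real.exp (-(S.lam₁ + S.lam₂) * t) * Real.exp (-S.δ * t) := by
      rw [← Real.exp_add, lam]; congr 1; ring
    rw [h1, add_comm S.lam₂ S.lam₁]
    ring
  have hHi : IntegrableOn (fun t => Real.exp (-(S.δ + S.lam) * t) * S.H W₀ (Z t).1 (Z t).2)
      (Ioi 0) := (k1.add k2).congr_fun hH measurableSet_Ioi
  have hHv : ∫ t in Ioi 0, Real.exp (-(S.δ + S.lam) * t) * S.H W₀ (Z t).1 (Z t).2
      = (∫ t in Ioi 0, S.lam₁ * Real.exp (-(S.lam₁ + S.lam₂) * t) * ∫ α, φ₁ (t, α) ∂S.F₁)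
      + ∫ t in Ioi 0, S.lam₂ * Real.exp (-(S.lam₂ + S.lam₁) * t) * ∫ α, φ₂ (t, α) ∂S.F₂ := by
    rw [← integral_add k1 k2]
    exact (setIntegral_congr_fun measurableSet_Ioi hH).symm
  set D₁ : Ω → ℝ := fun ω =>
    (discountedDividends S.δ (fun t => L₁ t ω) (ENNReal.ofReal (S.firstClaim ω))).toReal with hD₁
  set D₂ : Ω → ℝ := fun ω =>
    (discountedDividends S.δ (fun t => L₂ t ω) (ENNReal.ofReal (S.firstClaim ω))).toReal with hD₂
  set J₁ : Ω → ℝ := fun ω => if S.claims₁.wait 0 ω < S.claims₂.wait 0 ω then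
    φ₁ (S.claims₁.wait 0 ω, S.claims₁.size 0 ω) else 0 with hJ₁
  set J₂ : Ω → ℝ := fun ω => if S.claims₂.wait 0 ω < S.claims₁.wait 0 ω then
    φ₂ (S.claims₂.wait 0 ω, S.claims₂.size 0 ω) else 0 with hJ₂
  have hpay : S.oneStepPayoff W₀ z L₁ L₂
      =ᵐ[P] fun ω => (S.a₁ * D₁ ω + S.a₂ * D₂ ω) + (J₁ ω + J₂ ω) := by
    filter_upwards [hL, S.ae_regular] with ω h ⟨h0, w1, w2, s1, s2, hne⟩
    have ha1 := S.claims₁.arrival_zero ω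
    have ha2 := S.claims₂.arrival_zero ω
    have hcoe : ((S.firstClaim ω).toNNReal : ℝ) = S.firstClaim ω := Real.coe_toNNReal _ h0.le
    obtain ⟨l1, l2⟩ := h (S.firstClaim ω).toNNReal (Real.toNNReal_pos.2 h0) hcoe.le
    rw [hcoe] at l1 l2
    -- The company hit first loses its claim while the other has only collected premiums; the
    -- dividends at the claim time are known because the path formula includes that time.
    have key : Real.exp (-S.δ * S.firstClaim ω) *
        S.exitValue W₀ (S.surplus z L₁ L₂ (S.firstClaim ω).toNNReal ω) = J₁ ω + J₂ ω := by
      have hfc := S.firstClaim_eq ω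
      rcases hne.lt_or_gt with hlt | hlt
      · rw [min_eq_left hlt.le] at hfc
        have n1 := S.claims₁.net_of_eq w1 s1 (t := (S.firstClaim ω).toNNReal)
          (by rw [hcoe, hfc, ha1])
        have n2 := S.claims₂.net_of_lt w2 (t := (S.firstClaim ω).toNNReal)
          (by rw [hcoe, hfc, ha2]; exact hlt)
        have hs : S.surplus z L₁ L₂ (S.firstClaim ω).toNNReal ω
            = ((Z (S.firstClaim ω)).1 - S.claims₁.size 0 ω, (Z (S.firstClaim ω)).2) := by
          unfold surplus
          rw [n1, n2, l1, l2, hcoe]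
          refine Prod.ext ?_ ?_ <;> simp only [p₁, p₂] <;> ring
        rw [hs]
        simp only [hJ₁, hJ₂, if_pos hlt, if_neg hlt.not_gt, add_zero, hφ₁, hZc,
          max_eq_left (w1 0).le, max_eq_left s1, hfc]
      · rw [min_eq_right hlt.le] at hfc
        have n1 := S.claims₁.net_of_lt w1 (t := (S.firstClaim ω).toNNReal)
          (by rw [hcoe, hfc, ha1]; exact hlt)
        have n2 := S.claims₂.net_of_eq w2 s2 (t := (S.firstClaim ω).toNNReal)
          (by rw [hcoe, hfc, ha2])
        have hs : S.surplus z L₁ L₂ (S.firstClaim ω).toNNReal ω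
            = ((Z (S.firstClaim ω)).1, (Z (S.firstClaim ω)).2 - S.claims₂.size 0 ω) := by
          unfold surplus
          rw [n1, n2, l1, l2, hcoe]
          refine Prod.ext ?_ ?_ <;> simp only [p₁, p₂] <;> ring
        rw [hs]
        simp only [hJ₁, hJ₂, if_pos hlt, if_neg hlt.not_gt, zero_add, hφ₂, hZc,
          max_eq_left (w2 0).le, max_eq_left s2, hfc]
    rw [← key]
    rfl
  have hDi : Integrable (fun ω => S.a₁ * D₁ ω + S.a₂ * D₂ ω) P :=
    (d1.const_mul S.a₁).add (d2.const_mul S.a₂)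
  have hJi : Integrable (fun ω => J₁ ω + J₂ ω) P := i1.add i2
  refine ⟨(hDi.add hJi).congr hpay.symm, hHi, ?_⟩
  unfold oneStepValue
  rw [integral_congr_ae hpay, integral_add hDi hJi, integral_add (d1.const_mul S.a₁)
    (d2.const_mul S.a₂), integral_add i1 i2, integral_const_mul, integral_const_mul, e1, e2, v1, v2,
    hHv, ← integral_const_mul, ← integral_const_mul, ← integral_add (j1.const_mul _)
    (j2.const_mul _)]
  congr 1
  refine setIntegral_congr_fun measurableSet_Ioi fun t _ => ?_
  ring

end Model

/-! ### Existence and uniqueness of dividends following the strategy -/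

/-- A deterministic nondecreasing left continuous path is a dividend process. -/
lemma isDividendProcess_of_deterministic
    (𝓕 : Filtration ℝ≥0 (inferInstance : MeasurableSpace Ω)) {g : ℝ≥0 → ℝ} (h0 : g 0 = 0)
    (hm : Monotone g) (hl : ∀ t, ContinuousWithinAt g (Iic t) t) :
    IsDividendProcess 𝓕 (fun t (_ : Ω) => g t) where
  zero _ := h0
  mono _ := hm
  left_continuous _ := hl
  predictable := by
    -- Rays `(i, ∞)` generate the Borel sets of times, and `(i, ∞) × Ω` is predictable.
    have hfst : Measurable[𝓕.predictable] (Prod.fst : ℝ≥0 × Ω → ℝ≥0) := by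
      refine @measurable_of_Ioi ℝ≥0 (ℝ≥0 × Ω) _ _ _ 𝓕.predictable _ _ _ _ fun i => ?_
      have e : (Prod.fst : ℝ≥0 × Ω → ℝ≥0) ⁻¹' Ioi i = Ioi i ×ˢ univ := by
        ext; simp
      rw [e]
      exact measurableSet_predictable_Ioi_prod MeasurableSet.univ
    exact (hm.measurable.comp hfst).stronglyMeasurable

/-- The dividends `f t` at times `t > 0`, and `0` at time `0`. -/
lemma isDividendProcess_ite (𝓕 : Filtration ℝ≥0 (inferInstance : MeasurableSpace Ω)) {f : ℝ → ℝ}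
    (hf : ContinuousOn f (Ici 0)) (hm : MonotoneOn f (Ici 0)) (h0 : 0 ≤ f 0) :
    IsDividendProcess 𝓕 (fun (t : ℝ≥0) (_ : Ω) => if t = 0 then 0 else f t) := by
  refine isDividendProcess_of_deterministic 𝓕 (if_pos rfl) ?_ fun t => ?_
  · intro s t hst
    simp only
    have hs : (0 : ℝ) ≤ s := s.2
    have ht : (0 : ℝ) ≤ t := t.2
    split_ifs with h1 h2 h2
    · exact le_rfl
    · exact h0.trans (hm self_mem_Ici ht ht)
    · exact absurd (le_antisymm (hst.trans h2.le) zero_le) h1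
    · exact hm hs ht hst
  · rcases eq_zero_or_pos t with rfl | ht
    · have : Iic (0 : ℝ≥0) = {0} := by ext; simp
      rw [this]
      exact continuousWithinAt_singleton
    · have hc : Continuous fun t : ℝ≥0 => f t :=
        hf.comp_continuous NNReal.continuous_coe fun t => t.2
      refine (hc.continuousAt.congr ?_).continuousWithinAt
      filter_upwards [lt_mem_nhds ht] with s hs
      rw [if_neg hs.ne']

/-- `Z` is the surplus path of the curve strategy before the first claim. -/
structure CurveData.IsCurvePath {p₁ p₂ : ℝ} (ξ : CurveData p₁ p₂) (z : ℝ × ℝ) (Z : ℝ → ℝ × ℝ) :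
    Prop extends IsSurplusPath p₁ p₂ z Z where
  follows : ∀ τ, ξ.Follows z τ Z
  unique : ∀ τ Z', ξ.Follows z τ Z' → ∀ t, 0 < t → t < τ → Z' t = Z t

namespace CurveData

variable {p₁ p₂ : ℝ} {ξ : CurveData p₁ p₂} {z : ℝ × ℝ}

lemma isCurvePath_path (hp₁ : 0 < p₁) (hp₂ : 0 < p₂) (hz : z ∈ ξ.regionO₁) :
    ξ.IsCurvePath z (ξ.path z) where
  toIsSurplusPath := isSurplusPath_path hp₁ hp₂ hz
  follows := follows_path hp₁ hp₂ hz
  unique _ _ hZ' _ ht htτ := hZ'.eq_path hp₁ hp₂ hz ht htτ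

lemma isCurvePath_swap_path (hp₁ : 0 < p₁) (hp₂ : 0 < p₂) (hz : z ∈ ξ.regionO₂) :
    ξ.IsCurvePath z (fun t => (ξ.swap.path z.swap t).swap) where
  toIsSurplusPath := (isSurplusPath_path hp₂ hp₁ (mem_swap_regionO₁ hz)).swap
  follows τ := (follows_path hp₂ hp₁ (mem_swap_regionO₁ hz) τ).swap hp₂ hp₁
  unique τ Z' hZ' t ht htτ := by
    have := (hZ'.swap hp₁ hp₂).eq_path hp₂ hp₁ (mem_swap_regionO₁ hz) ht htτ
    rw [← this, Prod.swap_swap]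

end CurveData

namespace Model

variable {P : Measure Ω} (S : Model P)

lemma surplus_of_lt {ω : Ω} (w₁ : ∀ i, 0 < S.claims₁.wait i ω) (w₂ : ∀ i, 0 < S.claims₂.wait i ω)
    {t : ℝ≥0} (ht : (t : ℝ) < S.firstClaim ω) (z : ℝ × ℝ) (L₁ L₂ : ℝ≥0 → Ω → ℝ) :
    S.surplus z L₁ L₂ t ω
      = (z.1 + S.p₁ * t - L₁ t ω, z.2 + S.p₂ * t - L₂ t ω) := by
  unfold surplus
  rw [S.claims₁.net_of_lt w₁ (ht.trans_le (min_le_left _ _)),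
    S.claims₂.net_of_lt w₂ (ht.trans_le (min_le_right _ _))]
  rfl

variable [IsProbabilityMeasure P] {ξ : CurveData S.p₁ S.p₂} {z : ℝ × ℝ} {Z : ℝ → ℝ × ℝ}

/-- The deterministic dividends of the path are used at all times: the rule constrains them only
before the first claim, and being deterministic they are predictable. -/
lemma exists_isCurveStrategy (hZ : ξ.IsCurvePath z Z) :
    ∃ L₁ L₂ : ℝ≥0 → Ω → ℝ, S.IsCurveStrategy ξ z L₁ L₂ := by
  have c1 : ContinuousOn (fun t => z.1 + S.p₁ * t - (Z t).1) (Ici 0) :=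
    (by fun_prop : Continuous fun t => z.1 + S.p₁ * t).continuousOn.sub hZ.continuousOn.fst
  have c2 : ContinuousOn (fun t => z.2 + S.p₂ * t - (Z t).2) (Ici 0) :=
    (by fun_prop : Continuous fun t => z.2 + S.p₂ * t).continuousOn.sub hZ.continuousOn.snd
  refine ⟨fun t _ => if t = 0 then 0 else z.1 + S.p₁ * t - (Z t).1,
    fun t _ => if t = 0 then 0 else z.2 + S.p₂ * t - (Z t).2,
    isDividendProcess_ite _ c1 hZ.mono_fst (hZ.fst_nonneg le_rfl),
    isDividendProcess_ite _ c2 hZ.mono_snd (hZ.snd_nonneg le_rfl), ?_⟩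
  filter_upwards [S.ae_regular] with ω ⟨_, w1, w2, _⟩ t ht htτ
  have hsur : ∀ s : ℝ≥0, 0 < s → s ≤ t → S.surplus z
      (fun t _ => if t = 0 then 0 else z.1 + S.p₁ * t - (Z t).1)
      (fun t _ => if t = 0 then 0 else z.2 + S.p₂ * t - (Z t).2) s ω = Z s := fun s hs hst => by
    rw [S.surplus_of_lt w1 w2 (lt_of_le_of_lt (NNReal.coe_le_coe.2 hst) htτ), if_neg hs.ne',
      if_neg hs.ne']
    simp
  have htR : (0 : ℝ) < t := ht
  obtain ⟨f1, f2, f3⟩ := hZ.follows (S.firstClaim ω) t htR htτ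
  have hEq : EqOn (fun s : ℝ => ξ.rate (Z s)) (fun s : ℝ => ξ.rate (S.surplus z
      (fun t _ => if t = 0 then 0 else z.1 + S.p₁ * t - (Z t).1)
      (fun t _ => if t = 0 then 0 else z.2 + S.p₂ * t - (Z t).2) s.toNNReal ω))
      (uIoc 0 (t : ℝ)) := fun s hs => by
    rw [uIoc_of_le htR.le] at hs
    simp only
    rw [hsur _ (Real.toNNReal_pos.2 hs.1) (Real.toNNReal_le_iff_le_coe.2 hs.2),
      Real.coe_toNNReal _ hs.1.le]
  refine ⟨by rw [hsur t ht le_rfl]; exact f1, f2.congr hEq, ?_⟩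
  rw [if_neg ht.ne', if_neg ht.ne',
    ← intervalIntegral.integral_congr_ae (Filter.Eventually.of_forall hEq)]
  have e1 := congrArg Prod.fst f3
  have e2 := congrArg Prod.snd f3
  simp only [Prod.fst_sub, Prod.fst_add, Prod.smul_fst, smul_eq_mul] at e1
  simp only [Prod.snd_sub, Prod.snd_add, Prod.smul_snd, smul_eq_mul] at e2
  refine Prod.ext ?_ ?_
  · simp only [Prod.fst_add]; linarith
  · simp only [Prod.snd_add]; linarith

/-- Used at the first claim itself: the rule speaks of earlier times only, and left continuity
determines the dividends at that time. -/
lemma eq_of_eq_on_lt {L ℓ : ℝ≥0 → ℝ} {t : ℝ≥0} (ht : 0 < t)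
    (hL : ContinuousWithinAt L (Iic t) t) (hℓ : ContinuousWithinAt ℓ (Iic t) t)
    (h : ∀ s, 0 < s → s < t → L s = ℓ s) : L t = ℓ t := by
  have : (𝓝[<] t).NeBot := nhdsLT_neBot_of_exists_lt ⟨0, ht⟩
  have h1 : Tendsto L (𝓝[<] t) (𝓝 (L t)) := hL.mono_left (nhdsWithin_mono _ Iio_subset_Iic_self)
  have h2 : Tendsto ℓ (𝓝[<] t) (𝓝 (ℓ t)) := hℓ.mono_left (nhdsWithin_mono _ Iio_subset_Iic_self)
  refine tendsto_nhds_unique (h1.congr' ?_) h2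
  filter_upwards [self_mem_nhdsWithin, nhdsWithin_le_nhds (lt_mem_nhds ht)] with s hs hs0
    using h s hs0 hs

/-- Dividends that follow the curve strategy are determined up to the first claim. -/
lemma IsCurveStrategy.eq_path (hZ : ξ.IsCurvePath z Z) {L₁ L₂ : ℝ≥0 → Ω → ℝ}
    (hL : S.IsCurveStrategy ξ z L₁ L₂) :
    ∀ᵐ ω ∂P, ∀ t : ℝ≥0, 0 < t → (t : ℝ) ≤ S.firstClaim ω →
      L₁ t ω = z.1 + S.p₁ * t - (Z t).1 ∧ L₂ t ω = z.2 + S.p₂ * t - (Z t).2 := by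
  filter_upwards [S.ae_regular, hL.rule] with ω ⟨_, w1, w2, _⟩ hr
  -- Before the first claim the random surplus is premiums minus dividends, so for each outcome it
  -- is a deterministic trajectory to which path uniqueness applies.
  have hF : ξ.Follows z (S.firstClaim ω) (fun s => S.surplus z L₁ L₂ s.toNNReal ω) := by
    intro t ht htτ
    have hc : (t.toNNReal : ℝ) = t := Real.coe_toNNReal _ ht.le
    obtain ⟨f1, f2, f3⟩ := hr t.toNNReal (Real.toNNReal_pos.2 ht) (by rwa [hc])
    rw [hc] at f2 f3
    refine ⟨f1, f2, ?_⟩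
    simp only
    rw [S.surplus_of_lt w1 w2 (by rwa [hc]), ← f3, hc]
    refine Prod.ext ?_ ?_ <;> simp [mul_comm]
  have hlt : ∀ t : ℝ≥0, 0 < t → (t : ℝ) < S.firstClaim ω →
      L₁ t ω = z.1 + S.p₁ * t - (Z t).1 ∧ L₂ t ω = z.2 + S.p₂ * t - (Z t).2 := by
    intro t ht htτ
    have h := hZ.unique _ _ hF t ht htτ
    simp only [Real.toNNReal_coe] at h
    rw [S.surplus_of_lt w1 w2 htτ] at h
    have h1 := congrArg Prod.fst h
    have h2 := congrArg Prod.snd h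
    simp only at h1 h2
    exact ⟨by linarith, by linarith⟩
  have hZc : Continuous fun t : ℝ≥0 => Z t :=
    hZ.continuousOn.comp_continuous NNReal.continuous_coe fun t => t.2
  intro t ht htτ
  have hlt' : ∀ s : ℝ≥0, s < t → (s : ℝ) < S.firstClaim ω := fun s hs =>
    lt_of_lt_of_le (NNReal.coe_lt_coe.2 hs) htτ
  refine ⟨?_, ?_⟩
  · refine eq_of_eq_on_lt (ℓ := fun t : ℝ≥0 => z.1 + S.p₁ * t - (Z t).1) ht
      (hL.dividend₁.left_continuous ω t) ?_ fun s hs hst => (hlt s hs (hlt' s hst)).1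
    exact ((by fun_prop : Continuous fun t : ℝ≥0 => z.1 + S.p₁ * t).sub
      hZc.fst).continuousWithinAt
  · refine eq_of_eq_on_lt (ℓ := fun t : ℝ≥0 => z.2 + S.p₂ * t - (Z t).2) ht
      (hL.dividend₂.left_continuous ω t) ?_ fun s hs hst => (hlt s hs (hlt' s hst)).2
    exact ((by fun_prop : Continuous fun t : ℝ≥0 => z.2 + S.p₂ * t).sub
      hZc.snd).continuousWithinAt

variable {W₀ : ℝ × ℝ → ℝ} {L₁ L₂ : ℝ≥0 → Ω → ℝ}

omit [IsProbabilityMeasure P] in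
-- The function `kTilde` is the analogue of `k` for the exchanged companies, with weights and
-- arguments of `H` interchanged; apart from the order of the two terms of `p` this is definitional.
lemma kTilde_eq (v : ℝ) : S.kTilde W₀ ξ v
    = ξ.swap.curveValue (S.δ + S.lam) S.a₂ S.a₁ (fun w => S.H W₀ w.2 w.1) v := by
  unfold CurveData.curveValue
  rw [add_comm (S.a₂ * S.p₂)]
  rfl

lemma oneStepValue_of_mem_regionO₁ (hW₀ : ContinuousOn W₀ quadrant) (hz : z ∈ ξ.regionO₁)
    (hL : S.IsCurveStrategy ξ z L₁ L₂) :
    IntegrableOn (fun t => Real.exp (-(S.δ + S.lam) * t) *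
      (fun w : ℝ × ℝ => S.H W₀ w.1 w.2) (ξ.path z t)) (Ioi 0) ∧
    S.oneStepValue W₀ z L₁ L₂
      = ξ.pathValue (S.δ + S.lam) S.a₁ S.a₂ (fun w => S.H W₀ w.1 w.2) z := by
  have hZ := CurveData.isCurvePath_path S.p₁_pos S.p₂_pos hz
  exact (S.expected_payoff hW₀ hZ.toIsSurplusPath hL.dividend₁ hL.dividend₂ (hL.eq_path S hZ)).2

lemma oneStepValue_of_mem_regionO₂ (hW₀ : ContinuousOn W₀ quadrant) (hz : z ∈ ξ.regionO₂)
    (hL : S.IsCurveStrategy ξ z L₁ L₂) :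
    IntegrableOn (fun t => Real.exp (-(S.δ + S.lam) * t) *
      (fun w : ℝ × ℝ => S.H W₀ w.2 w.1) (ξ.swap.path z.swap t)) (Ioi 0) ∧
    S.oneStepValue W₀ z L₁ L₂
      = ξ.swap.pathValue (S.δ + S.lam) S.a₂ S.a₁ (fun w => S.H W₀ w.2 w.1) z.swap := by
  have hZ := CurveData.isCurvePath_swap_path S.p₁_pos S.p₂_pos hz
  obtain ⟨-, h1, h2⟩ :=
    S.expected_payoff hW₀ hZ.toIsSurplusPath hL.dividend₁ hL.dividend₂ (hL.eq_path S hZ)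
  refine ⟨h1, h2.trans ?_⟩
  simp only [add_comm (S.a₁ * _)]
  rfl

omit [IsProbabilityMeasure P] in
lemma exists_isCurvePath (ξ : CurveData S.p₁ S.p₂) (hz : z ∈ quadrant) :
    ∃ Z, ξ.IsCurvePath z Z := by
  rcases CurveData.mem_regionO₁_or (ξ := ξ) S.p₁_pos S.p₂_pos hz with h | h
  · exact ⟨_, CurveData.isCurvePath_path S.p₁_pos S.p₂_pos h⟩
  · exact ⟨_, CurveData.isCurvePath_swap_path S.p₁_pos S.p₂_pos h⟩

end Model

end TwoInsurers

theorem mainTheorem7 {Ω : Type*} [MeasurableSpace Ω] (P : Measure Ω) [IsProbabilityMeasure P]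
    (S : TwoInsurers.Model P) (ξ : TwoInsurers.CurveData S.p₁ S.p₂)
    (W₀ : ℝ × ℝ → ℝ) (hW₀ : ContinuousOn W₀ TwoInsurers.quadrant)
    (x y : ℝ) (hx : 0 ≤ x) (hy : 0 ≤ y) :
    (∃ L₁ L₂ : ℝ≥0 → Ω → ℝ, S.IsCurveStrategy ξ (x, y) L₁ L₂) ∧
    ∀ L₁ L₂ : ℝ≥0 → Ω → ℝ, S.IsCurveStrategy ξ (x, y) L₁ L₂ →
      Integrable (S.oneStepPayoff W₀ (x, y) L₁ L₂) P ∧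
      ((x, y) ∈ ξ.regionO₁ →
        (y ≤ ξ.ybar → x ≤ ξ.inv₁ y + S.p₁ / S.p₂ * y →
          S.oneStepValue W₀ (x, y) L₁ L₂ =
            Real.exp (-(S.δ + S.lam) * ((ξ.ξ₁ (x - S.p₁ / S.p₂ * y) - y) / S.p₂)) *
                S.k W₀ ξ (x - S.p₁ / S.p₂ * y)
              + ∫ w in (0 : ℝ)..((ξ.ξ₁ (x - S.p₁ / S.p₂ * y) - y) / S.p₂),
                  Real.exp (-(S.δ + S.lam) * w) * S.H W₀ (x + S.p₁ * w) (y + S.p₂ * w)) ∧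
        (y ≤ ξ.ybar → ξ.inv₁ y + S.p₁ / S.p₂ * y ≤ x →
          S.oneStepValue W₀ (x, y) L₁ L₂ =
            S.a₁ * (x - ξ.inv₁ y - S.p₁ / S.p₂ * y) + S.k W₀ ξ (ξ.inv₁ y)) ∧
        (ξ.xbar ≤ x → ξ.ybar ≤ y →
          S.oneStepValue W₀ (x, y) L₁ L₂ =
            S.a₁ * (x - ξ.xbar) + S.a₂ * (y - ξ.ybar)
              + S.k W₀ ξ (ξ.xbar - S.p₁ / S.p₂ * ξ.ybar))) ∧
      ((x, y) ∈ ξ.regionO₂ →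
        (x ≤ ξ.xbar → y ≤ ξ.inv₂ x + S.p₂ / S.p₁ * x →
          S.oneStepValue W₀ (x, y) L₁ L₂ =
            Real.exp (-(S.δ + S.lam) * ((ξ.ξ₂ (y - S.p₂ / S.p₁ * x) - x) / S.p₁)) *
                S.kTilde W₀ ξ (y - S.p₂ / S.p₁ * x)
              + ∫ w in (0 : ℝ)..((ξ.ξ₂ (y - S.p₂ / S.p₁ * x) - x) / S.p₁),
                  Real.exp (-(S.δ + S.lam) * w) * S.H W₀ (x + S.p₁ * w) (y + S.p₂ * w)) ∧
        (x ≤ ξ.xbar → ξ.inv₂ x + S.p₂ / S.p₁ * x ≤ y →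
          S.oneStepValue W₀ (x, y) L₁ L₂ =
            S.a₂ * (y - ξ.inv₂ x - S.p₂ / S.p₁ * x) + S.kTilde W₀ ξ (ξ.inv₂ x)) ∧
        (ξ.xbar ≤ x → ξ.ybar ≤ y →
          S.oneStepValue W₀ (x, y) L₁ L₂ =
            S.a₁ * (x - ξ.xbar) + S.a₂ * (y - ξ.ybar)
              + S.kTilde W₀ ξ (ξ.ybar - S.p₂ / S.p₁ * ξ.xbar))) := by
  have hz : (x, y) ∈ TwoInsurers.quadrant := ⟨hx, hy⟩
  have hp₁ := S.p₁_pos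
  have hp₂ := S.p₂_pos
  have hq : 0 < S.δ + S.lam := add_pos S.δ_pos S.lam_pos
  obtain ⟨Z, hZ⟩ := S.exists_isCurvePath ξ hz
  -- Integrability needs no choice of region. The two families of formulas are then derived
  -- independently, so on the common line both hold.
  refine ⟨S.exists_isCurveStrategy hZ, fun L₁ L₂ hL => ⟨(S.expected_payoff hW₀ hZ.toIsSurplusPath
    hL.dividend₁ hL.dividend₂ (hL.eq_path S hZ)).1, fun h => ?_, fun h => ?_⟩⟩
  · obtain ⟨hh, hv⟩ := S.oneStepValue_of_mem_regionO₁ hW₀ h hL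
    refine ⟨fun h1 h2 => hv.trans ?_, fun h1 h2 => hv.trans ?_, fun h1 h2 => hv.trans ?_⟩
    · exact ξ.pathValue_of_le hp₁ hp₂ h hq S.a₁_nonneg S.a₂_nonneg hh h1 h2
    · exact ξ.pathValue_of_ge hp₁ hp₂ h hq S.a₁_nonneg S.a₂_nonneg hh h1 h2
    · exact ξ.pathValue_of_vertex_le hp₁ hp₂ h hq S.a₁_nonneg S.a₂_nonneg hh h2
  · obtain ⟨hh, hv⟩ := S.oneStepValue_of_mem_regionO₂ hW₀ h hL
    have h' := ξ.mem_swap_regionO₁ h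
    simp only [S.kTilde_eq]
    refine ⟨fun h1 h2 => hv.trans ?_, fun h1 h2 => hv.trans ?_, fun h1 h2 => hv.trans ?_⟩
    · exact ξ.swap.pathValue_of_le hp₂ hp₁ h' hq S.a₂_nonneg S.a₁_nonneg hh h1 h2
    · exact ξ.swap.pathValue_of_ge hp₂ hp₁ h' hq S.a₂_nonneg S.a₁_nonneg hh h1 h2
    · rw [add_comm (S.a₁ * _)]
      exact ξ.swap.pathValue_of_vertex_le hp₂ hp₁ h' hq S.a₂_nonneg S.a₁_nonneg hh h1
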